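/- Let $n\ge 2$, $Q:=(-1,1)^n\subset\mathbb R^n$, and let $0<\alpha<\infty$, $1<q<\infty$ satisfy $q>1+\alpha$. Let $s\in[0,1]$, $\Lambda\ge 1$, $\mu\ge 1$. Let $g:[0,\infty)\to[0,\infty)$ be continuous, nondecreasing, unbounded and concave, such that $t\mapsto t\,g(t)$ is convex and such that for every $\varepsilon>0$ there is a constant $c$ (depending on $g$ and $\varepsilon$) with $g(t)\le c(1+t^{\varepsilon})$ for all $t\ge 0$. Let $L\in C^2(\mathbb R^n\setminus\{0\})\cap C^1(\mathbb R^n)$ be real valued with $$\frac1\Lambda |z|g(|z|)\le L(z)\le \Lambda|z|g(|z|)+\Lambda,\qquad \frac{|\xi|^2}{\Lambda(1+|z|^2)^{\mu/2}}\le\langle\partial^2L(z)\xi,\xi\rangle,\qquad |\partial^2L(z)|\le\frac{\Lambda(g(|z|)+1)}{(1+|z|^2)^{1/2}}$$ for all $z\in\mathbb R^n\setminus\{0\}$ and $\xi\in\mathbb R^n$. For a coefficient $a:\overline Q\to[0,\infty)$ and a weakly differentiable $w$ on $Q$ put $$\mathcal H(w;Q):=\int_Q L(Dw)+a(x)(s^2+|Dw|^2)^{q/2}\,dx,\qquad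 \mathcal G(w;Q):=\int_Q |Dw|\,g(|Dw|)+a(x)|Dw|^q\,dx,$$ both with values in $[0,\infty]$. Then there exist a coefficient $0\le a\in C^{\alpha}(\overline Q)$ (that is, $a$ is $\lfloor\alpha\rfloor$ times continuously differentiable up to the boundary, with derivatives of order $\lfloor\alpha\rfloor$ Hölder continuous with exponent $\alpha-\lfloor\alpha\rfloor$ when $\alpha\notin\mathbb N$), a function $\bar u_0\in W^{1,1}_0(Q)\cap L^\infty(Q)$ with $\mathcal G(\bar u_0;Q)<\infty$, and a function $\tilde u_0\in C^\infty(\overline Q)$ such that the following two assertions hold. 1. The Lavrentiev phenomenon occurs: $$\inf_{w\in\tilde u_0+C_c^\infty(Q)}\mathcal H(w;Q)>\inf_{w\in\tilde u_0+W^{1,1}_0(Q)}\mathcal H(w;Q).$$ 2. There is no sequence $(u_i)_{i\in\mathbb N}\subset C_c^\infty(Q)$ such that $\mathcal G(u_i-\bar u_0;Q)\to 0$; that is, smooth compactly supported functions are not dense in $\{w\in W^{1,1}_0(Q):\mathcal G(w;Q)<\infty\}$ with respect to modular convergence. -/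

import Mathlib

open MeasureTheory Filter Topology Set
open scoped ContDiff ENNReal

noncomputable section

namespace DoublePhase

/-- The open cube `Q = (-1,1)^n` in Euclidean `n`-space. -/
def cube (n : ℕ) : Set (EuclideanSpace ℝ (Fin n)) := {x | ∀ i, x i ∈ Ioo (-1 : ℝ) 1}

/-- `C_c^∞(U)`: smooth functions on `ℝ^n` whose support is a compact subset of `U`. -/
def testFunctions {n : ℕ} (U : Set (EuclideanSpace ℝ (Fin n))) :
    Set (EuclideanSpace ℝ (Fin n) → ℝ) :=
  {φ | ContDiff ℝ ∞ φ ∧ HasCompactSupport φ ∧ tsupport φ ⊆ U}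

/-- `V` is a weak (distributional) gradient of `w` on `U`. -/
def HasWeakGrad {n : ℕ} (U : Set (EuclideanSpace ℝ (Fin n)))
    (w : EuclideanSpace ℝ (Fin n) → ℝ)
    (V : EuclideanSpace ℝ (Fin n) → EuclideanSpace ℝ (Fin n)) : Prop :=
  LocallyIntegrableOn w U ∧ LocallyIntegrableOn V U ∧
    ∀ φ ∈ testFunctions U, ∀ i : Fin n,
      ∫ x in U, w x * fderiv ℝ φ x (EuclideanSpace.single i 1) = -∫ x in U, V x i * φ x

open Classical in
/-- The weak gradient `Dw` of `w` on `U` (unique up to null sets when it exists; only used for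
weakly differentiable `w`). -/
def weakGrad {n : ℕ} (U : Set (EuclideanSpace ℝ (Fin n)))
    (w : EuclideanSpace ℝ (Fin n) → ℝ) :
    EuclideanSpace ℝ (Fin n) → EuclideanSpace ℝ (Fin n) :=
  if h : ∃ V, HasWeakGrad U w V then h.choose else 0

/-- `W^{1,1}(U)`. -/
def W11 {n : ℕ} (U : Set (EuclideanSpace ℝ (Fin n))) :
    Set (EuclideanSpace ℝ (Fin n) → ℝ) :=
  {w | IntegrableOn w U ∧ ∃ V, HasWeakGrad U w V ∧ IntegrableOn V U}

/-- `W^{1,1}_0(U)`: the closure of `C_c^∞(U)` in `W^{1,1}(U)`. -/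
def W11Zero {n : ℕ} (U : Set (EuclideanSpace ℝ (Fin n))) :
    Set (EuclideanSpace ℝ (Fin n) → ℝ) :=
  {w | w ∈ W11 U ∧ ∃ φ : ℕ → EuclideanSpace ℝ (Fin n) → ℝ, (∀ i, φ i ∈ testFunctions U) ∧
    Tendsto (fun i => (∫⁻ x in U, ‖φ i x - w x‖ₑ) +
      ∫⁻ x in U, ‖gradient (φ i) x - weakGrad U w x‖ₑ) atTop (𝓝 0)}

/-- `f ∈ C^α(K)` for real `α > 0`: `f` is `⌊α⌋` times continuously differentiable on `K` and its
derivative of order `⌊α⌋` is Hölder continuous with exponent `α - ⌊α⌋` (bounded, if `α` is an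
integer). Used for `K` the closure of a convex open set. -/
def MemHolder {n : ℕ} (α : ℝ) (f : EuclideanSpace ℝ (Fin n) → ℝ)
    (K : Set (EuclideanSpace ℝ (Fin n))) : Prop :=
  ContDiffOn ℝ (⌊α⌋₊ : ℕ) f K ∧
    ∃ C : NNReal, HolderOnWith C (α - ⌊α⌋₊).toNNReal (iteratedFDerivWithin ℝ ⌊α⌋₊ f K) K

/-- Assumptions on the growth function `g : [0,∞) → [0,∞)`. -/
structure GrowthFunction (g : ℝ → ℝ) : Prop where
  nonneg : ∀ t, 0 ≤ t → 0 ≤ g t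
  continuousOn : ContinuousOn g (Ici 0)
  convexOn_mul : ConvexOn ℝ (Ici 0) (fun t => t * g t)
  monotoneOn : MonotoneOn g (Ici 0)
  unbounded : ∀ M : ℝ, ∃ t, 0 ≤ t ∧ M < g t
  concaveOn : ConcaveOn ℝ (Ici 0) g
  subpolynomial : ∀ ε : ℝ, 0 < ε → ∃ c : ℝ, ∀ t : ℝ, 0 ≤ t → g t ≤ c * (1 + t ^ ε)

/-- Regularity, growth and `μ`-ellipticity of the integrand `L` with constant `Λ`. -/
structure EllipticIntegrand {n : ℕ} (L : EuclideanSpace ℝ (Fin n) → ℝ) (g : ℝ → ℝ) (Λ μ : ℝ) :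
    Prop where
  contDiff_one : ContDiff ℝ 1 L
  contDiffOn_two : ContDiffOn ℝ 2 L {0}ᶜ
  growth_lower : ∀ z, z ≠ 0 → 1 / Λ * (‖z‖ * g ‖z‖) ≤ L z
  growth_upper : ∀ z, z ≠ 0 → L z ≤ Λ * (‖z‖ * g ‖z‖) + Λ
  elliptic : ∀ z, z ≠ 0 → ∀ ξ,
    ‖ξ‖ ^ 2 / (Λ * (1 + ‖z‖ ^ 2) ^ (μ / 2)) ≤ fderiv ℝ (fderiv ℝ L) z ξ ξ
  hessian_upper : ∀ z, z ≠ 0 →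
    ‖fderiv ℝ (fderiv ℝ L) z‖ ≤ Λ * (g ‖z‖ + 1) / (1 + ‖z‖ ^ 2) ^ (1 / 2 : ℝ)

/-- `𝓗(w;U) = ∫_U L(Dw) + a(x) (s² + |Dw|²)^{q/2} dx ∈ [0,∞]` (the integrand is nonnegative). -/
def energy {n : ℕ} (L a : EuclideanSpace ℝ (Fin n) → ℝ) (s q : ℝ)
    (U : Set (EuclideanSpace ℝ (Fin n))) (w : EuclideanSpace ℝ (Fin n) → ℝ) : ℝ≥0∞ :=
  ∫⁻ x in U, ENNReal.ofReal
    (L (weakGrad U w x) + a x * (s ^ 2 + ‖weakGrad U w x‖ ^ 2) ^ (q / 2))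

/-- The modular `𝓖(w;U) = ∫_U |Dw| g(|Dw|) + a(x) |Dw|^q dx ∈ [0,∞]`. -/
def modular {n : ℕ} (g : ℝ → ℝ) (a : EuclideanSpace ℝ (Fin n) → ℝ) (q : ℝ)
    (U : Set (EuclideanSpace ℝ (Fin n))) (w : EuclideanSpace ℝ (Fin n) → ℝ) : ℝ≥0∞ :=
  ∫⁻ x in U, ENNReal.ofReal
    (‖weakGrad U w x‖ * g ‖weakGrad U w x‖ + a x * ‖weakGrad U w x‖ ^ q)

end DoublePhase

end

noncomputable section

namespace DoublePhase

/-! ### The Cantor function with contraction ratio `lam` -/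

/-! Fix two coordinates `i ≠ j` and a Cantor set in the `x i`-axis of dimension `1 - δ`, with `δ`
small. Singularities sit over this set on the hyperplane `x j = 0`. The Cantor function `F` has two
roles, played on complementary regions separated by a regularised distance `d` to the Cantor set.

The competitor: `base` is a fixed smooth step across `x j = 0`, and `base + ubar` is, where the
outer cutoff is 1, the steeper step `step (x j / d (x i))`, whose gradient lives in `|x j| ≤ d (x i)
/ 2`. The gradient of `ubar` is at most a multiple of `1 / max (d (x i)) |x j|`. A small negative
power of `d` is integrable, so some power `1 + σ` of this bound is integrable too; that is enough
for the nearly linear growth of `t * g t`.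

The dual field: the mean of `F` over `[x i - |x j|, x i + |x j|]` is a stream function. Its rotated
gradient, times a cutoff in the other variables, is solenoidal. It has size `|x j| ^ (-δ)` because
`F` is Hölder of exponent `1 - δ`, and it vanishes for `|x j| ≤ d (x i)` because `F` is constant
there. The coefficient `coeff` vanishes for `|x j| ≤ d (x i) / 2` and dominates `(|x j| / 2) ^ r`,
`r = α + δ`, on the support of the field. So `base + ubar` is locally constant where the coefficient
is positive, while the field is controlled by the coefficient: Hölder's inequality with exponent `q`
asks for `δ * q + r < q - 1`, which small `δ` allows exactly because `α < q - 1`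
(`exists_flux_bound`).

Pairing with the field gives a linear functional, the flux. It vanishes on gradients of test
functions (`integral_flux_test`), equals some `κ > 0` on `base` (`flux_base_pos`) and equals `-κ` on
`ubar` (`flux_ubar_ae_eq`), although `ubar` has zero trace. Take the datum `M • base`. Every smooth
competitor has flux `M * κ`, hence energy at least of order `M ^ q` (`le_energy_base_add_test`). The
competitor `M • (base + ubar)` pays nearly nothing in the coefficient term and at most order `M ^ (1
+ σ)` in total (`exists_energy_base_add_ubar_le`). As `1 + σ < q`, a large `M` opens the Lavrentiev
gap. Likewise `φ - ubar` has flux `κ` for every test function `φ`, so its modular stays away from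
zero (`le_modular_test_sub_ubar`). -/

/-- Approximations of the Cantor function on `[-1/2, 1/2]` with contraction ratio `lam`. -/
def cantorApprox (lam : ℝ) : ℕ → ℝ → ℝ
  | 0 => fun x => max 0 (min 1 (x + 1 / 2))
  | k + 1 => fun x => (cantorApprox lam k ((x - (1 - lam) / 2) / lam) +
      cantorApprox lam k ((x + (1 - lam) / 2) / lam)) / 2

section CantorFunction

variable {lam : ℝ}

lemma inv_branch_le (h0 : 0 < lam) {x t s : ℝ} (h : x ≤ lam * t + s) : (x - s) / lam ≤ t := by
  rw [div_le_iff₀ h0]; linarith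

lemma le_inv_branch (h0 : 0 < lam) {x t s : ℝ} (h : lam * t + s ≤ x) : t ≤ (x - s) / lam := by
  rw [le_div_iff₀ h0]; linarith

lemma cantorApprox_zero_one (h0 : 0 < lam) (h1 : lam < 1 / 2) (k : ℕ) :
    (∀ x, x ≤ -(1 / 2) → cantorApprox lam k x = 0) ∧
      (∀ x, 1 / 2 ≤ x → cantorApprox lam k x = 1) := by
  induction k with
  | zero =>
    constructor <;> intro x hx <;> simp only [cantorApprox]
    · rw [max_eq_left]; exact (min_le_right _ _).trans (by linarith)
    · rw [min_eq_left (by linarith)]; norm_num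
  | succ k ih =>
    constructor <;> intro x hx <;> simp only [cantorApprox]
    · rw [ih.1 _ (inv_branch_le h0 (by linarith)), ← sub_neg_eq_add x,
        ih.1 _ (inv_branch_le h0 (by linarith))]
      norm_num
    · rw [ih.2 _ (le_inv_branch h0 (by linarith)), ← sub_neg_eq_add x,
        ih.2 _ (le_inv_branch h0 (by linarith))]
      norm_num

lemma monotone_cantorApprox (h0 : 0 < lam) (k : ℕ) : Monotone (cantorApprox lam k) := by
  induction k with
  | zero =>
    intro x y hxy
    exact max_le_max le_rfl (min_le_min le_rfl (by linarith))
  | succ k ih =>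
    intro x y hxy
    simp only [cantorApprox]
    have a := ih (show (x - (1 - lam) / 2) / lam ≤ (y - (1 - lam) / 2) / lam by gcongr)
    have b := ih (show (x + (1 - lam) / 2) / lam ≤ (y + (1 - lam) / 2) / lam by gcongr)
    linarith

lemma cantorApprox_mem (h0 : 0 < lam) (h1 : lam < 1 / 2) (k : ℕ) (x : ℝ) :
    cantorApprox lam k x ∈ Icc (0 : ℝ) 1 := by
  obtain ⟨hl, hr⟩ := cantorApprox_zero_one h0 h1 k
  constructor
  · rcases le_total x (-(1 / 2)) with h | h
    · exact (hl x h).ge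
    · rw [← hl _ le_rfl]; exact monotone_cantorApprox h0 k h
  · rcases le_total x (1 / 2) with h | h
    · rw [← hr _ le_rfl]; exact monotone_cantorApprox h0 k h
    · exact (hr x h).le

/-- On each half-line one of the two branches is already constant (0 on the left, 1 on the right),
so only the other contributes and the average halves the error. -/
lemma abs_cantorApprox_succ_sub (h0 : 0 < lam) (h1 : lam < 1 / 2) (k : ℕ) (x : ℝ) :
    |cantorApprox lam k x - cantorApprox lam (k + 1) x| ≤ 1 * (1 / 2) ^ k := by
  induction k generalizing x with
  | zero =>
    have a := cantorApprox_mem h0 h1 0 x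
    have b := cantorApprox_mem h0 h1 1 x
    rw [abs_le]; constructor <;> linarith [a.1, a.2, b.1, b.2]
  | succ k ih =>
    rw [cantorApprox, cantorApprox]
    beta_reduce
    rcases le_total x 0 with hx | hx
    · have e : (x - (1 - lam) / 2) / lam ≤ -(1 / 2) := inv_branch_le h0 (by linarith)
      rw [(cantorApprox_zero_one h0 h1 k).1 _ e, (cantorApprox_zero_one h0 h1 (k + 1)).1 _ e]
      have := ih ((x + (1 - lam) / 2) / lam)
      rw [← sub_div, abs_div, abs_two, zero_add, zero_add, pow_succ]
      linarith
    · have e : 1 / 2 ≤ (x + (1 - lam) / 2) / lam := by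
        rw [← sub_neg_eq_add x]; exact le_inv_branch h0 (by linarith)
      rw [(cantorApprox_zero_one h0 h1 k).2 _ e, (cantorApprox_zero_one h0 h1 (k + 1)).2 _ e]
      have := ih ((x - (1 - lam) / 2) / lam)
      rw [← sub_div, abs_div, abs_two, add_sub_add_right_eq_sub, pow_succ]
      linarith

/-- The Hölder constant survives the recursion: increments of length at least the middle gap `1 - 2
* lam` are covered by the bound 1, and shorter ones see a single branch, where the factor `1 / 2`
cancels `lam ^ D = 1 / 2` exactly. -/
lemma cantorApprox_holder (h0 : 0 < lam) (h1 : lam < 1 / 2) {D : ℝ} (hD : 0 < D)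
    (hlam : lam ^ D = 1 / 2) (k : ℕ) (hk : ∀ x y, x ≤ y →
      cantorApprox lam k y - cantorApprox lam k x ≤ (1 - 2 * lam) ^ (-D) * (y - x) ^ D)
    {x y : ℝ} (hxy : x ≤ y) :
    cantorApprox lam (k + 1) y - cantorApprox lam (k + 1) x
      ≤ (1 - 2 * lam) ^ (-D) * (y - x) ^ D := by
  have hg : 0 < 1 - 2 * lam := by linarith
  have key : ∀ s : ℝ, cantorApprox lam k ((y - s) / lam) - cantorApprox lam k ((x - s) / lam)
      ≤ 2 * ((1 - 2 * lam) ^ (-D) * (y - x) ^ D) := by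
    intro s
    have := hk ((x - s) / lam) ((y - s) / lam) (by gcongr)
    rw [← sub_div, sub_sub_sub_cancel_right, Real.div_rpow (by linarith) h0.le, hlam] at this
    calc _ ≤ _ := this
      _ = _ := by ring
  by_cases hfar : 1 - 2 * lam ≤ y - x
  · have a := cantorApprox_mem h0 h1 (k + 1) x
    have b := cantorApprox_mem h0 h1 (k + 1) y
    have : (1 : ℝ) ≤ (1 - 2 * lam) ^ (-D) * (y - x) ^ D := by
      rw [Real.rpow_neg hg.le, ← div_eq_inv_mul, one_le_div (Real.rpow_pos_of_pos hg _)]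
      exact Real.rpow_le_rpow hg.le hfar hD.le
    linarith [a.1, b.2]
  · simp only [cantorApprox]
    push Not at hfar
    -- The interval from `x` to `y` is shorter than the middle gap, so it misses the right or the
    -- left copy of the Cantor set.
    rcases le_total y ((1 - 2 * lam) / 2) with h | h
    · rw [(cantorApprox_zero_one h0 h1 k).1 ((y - (1 - lam) / 2) / lam)
          (inv_branch_le h0 (by linarith)),
        (cantorApprox_zero_one h0 h1 k).1 ((x - (1 - lam) / 2) / lam)
          (inv_branch_le h0 (by linarith))]
      have := key (-((1 - lam) / 2))
      rw [sub_neg_eq_add, sub_neg_eq_add] at this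
      linarith
    · rw [← sub_neg_eq_add x, ← sub_neg_eq_add y,
        (cantorApprox_zero_one h0 h1 k).2 ((y - -((1 - lam) / 2)) / lam)
          (le_inv_branch h0 (by linarith)),
        (cantorApprox_zero_one h0 h1 k).2 ((x - -((1 - lam) / 2)) / lam)
          (le_inv_branch h0 (by linarith))]
      have := key ((1 - lam) / 2)
      linarith

/-- The Cantor function: monotone, Hölder continuous and self-similar. -/
theorem exists_cantorFunction (h0 : 0 < lam) (h1 : lam < 1 / 2) {D : ℝ} (hD : 0 < D) (hD1 : D ≤ 1)
    (hlam : lam ^ D = 1 / 2) : ∃ F : ℝ → ℝ, Monotone F ∧ (∀ x, x ≤ -(1 / 2) → F x = 0) ∧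
      (∀ x, 1 / 2 ≤ x → F x = 1) ∧
      (∃ C, 0 ≤ C ∧ ∀ x y, x ≤ y → F y - F x ≤ C * (y - x) ^ D) ∧
      ∀ x, F x = (F ((x - (1 - lam) / 2) / lam) + F ((x + (1 - lam) / 2) / lam)) / 2 := by
  have hconv : ∀ x, ∃ l, Tendsto (fun k => cantorApprox lam k x) atTop (𝓝 l) := fun x =>
    cauchySeq_tendsto_of_complete (cauchySeq_of_le_geometric (1 / 2) 1 (by norm_num)
      (fun k => by rw [Real.dist_eq]; exact abs_cantorApprox_succ_sub h0 h1 k x))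
  choose F hF using hconv
  have hg : 0 < 1 - 2 * lam := by linarith
  have hhol : ∀ k x y, x ≤ y →
      cantorApprox lam k y - cantorApprox lam k x ≤ (1 - 2 * lam) ^ (-D) * (y - x) ^ D := by
    intro k
    induction k with
    | zero =>
      intro x y hxy
      have hC : 1 ≤ (1 - 2 * lam) ^ (-D) :=
        Real.one_le_rpow_of_pos_of_le_one_of_nonpos hg (by linarith) (by linarith)
      have a := cantorApprox_mem h0 h1 0 x
      have b := cantorApprox_mem h0 h1 0 y
      have hle : cantorApprox lam 0 y - cantorApprox lam 0 x ≤ (y - x) ^ D := by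
        rcases le_total 1 (y - x) with h | h
        · have := Real.one_le_rpow h hD.le
          linarith [a.1, b.2]
        · have h2 : y - x ≤ (y - x) ^ D := by
            rcases eq_or_lt_of_le (sub_nonneg.2 hxy) with h3 | h3
            · rw [← h3, Real.zero_rpow hD.ne']
            · calc y - x = (y - x) ^ (1 : ℝ) := (Real.rpow_one _).symm
                _ ≤ _ := Real.rpow_le_rpow_of_exponent_ge h3 h hD1
          refine le_trans ?_ h2
          simp only [cantorApprox]
          have h4 : max 0 (min 1 (y + 1 / 2)) ≤ max 0 (min 1 (x + 1 / 2)) + (y - x) := by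
            rcases le_total 1 (x + 1 / 2) with h5 | h5
            · rw [min_eq_left h5]
              have : max (0:ℝ) (min 1 (y + 1 / 2)) ≤ 1 := max_le zero_le_one (min_le_left _ _)
              have : (1:ℝ) ≤ max 0 1 := le_max_right _ _
              linarith
            · rw [min_eq_right h5]
              refine max_le (by linarith [le_max_left (0:ℝ) (x + 1 / 2)]) ?_
              linarith [le_max_right (0:ℝ) (x + 1 / 2), min_le_right (1:ℝ) (y + 1 / 2)]
          linarith
      nlinarith [Real.rpow_nonneg (sub_nonneg.2 hxy) D]
    | succ k ih => exact fun x y hxy => cantorApprox_holder h0 h1 hD hlam k ih hxy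
  refine ⟨F, ?_, ?_, ?_, ⟨(1 - 2 * lam) ^ (-D), Real.rpow_nonneg hg.le _, ?_⟩, ?_⟩
  · intro x y hxy
    exact le_of_tendsto_of_tendsto' (hF x) (hF y) fun k => monotone_cantorApprox h0 k hxy
  · intro x hx
    refine tendsto_nhds_unique (hF x) ?_
    simp only [(cantorApprox_zero_one h0 h1 _).1 x hx, tendsto_const_nhds]
  · intro x hx
    refine tendsto_nhds_unique (hF x) ?_
    simp only [(cantorApprox_zero_one h0 h1 _).2 x hx, tendsto_const_nhds]
  · intro x y hxy
    exact le_of_tendsto' ((hF y).sub (hF x)) fun k => hhol k x y hxy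
  · intro x
    refine tendsto_nhds_unique ((tendsto_add_atTop_iff_nat 1).2 (hF x)) ?_
    exact ((hF _).add (hF _)).div_const 2

end CantorFunction

/-! ### A regularised distance to the Cantor set -/

/-- A smooth bump adapted to the two branches of the Cantor construction of ratio `lam`. -/
structure BaseBump (lam kap : ℝ) (β : ℝ → ℝ) : Prop where
  lam_pos : 0 < lam
  lam_lt : lam < 1 / 2
  kap_pos : 0 < kap
  kap_le : kap ≤ lam / 4
  contDiff : ContDiff ℝ ∞ β
  nonneg : ∀ x, 0 ≤ β x
  le : ∀ x, β x ≤ 1 - kap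
  eq_of_abs_le : ∀ x, |x| ≤ (1 - lam) * (1 / 2 + lam) → β x = 1 - kap
  eq_zero : ∀ x, 1 - lam ≤ |x| → β x = 0

/-- The rescaled copies of `β` at generation `j`. -/
def layer (lam kap : ℝ) (β : ℝ → ℝ) : ℕ → ℝ → ℝ
  | 0 => β
  | j + 1 => fun x => kap * (layer lam kap β j ((x - (1 - lam) / 2) / lam) +
      layer lam kap β j ((x - -((1 - lam) / 2)) / lam))

/-- Smooth positive approximations of the regularised distance to the Cantor set. -/
def gapApprox (lam kap : ℝ) (β : ℝ → ℝ) (k : ℕ) (x : ℝ) : ℝ :=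
  1 - ∑ j ∈ Finset.range k, layer lam kap β j x

/-- A regularised distance to the Cantor set. -/
def gap (lam kap : ℝ) (β : ℝ → ℝ) (x : ℝ) : ℝ := 1 - ∑' j, layer lam kap β j x

namespace BaseBump

variable {lam kap : ℝ} {β : ℝ → ℝ}

lemma contDiff_layer (h : BaseBump lam kap β) (j : ℕ) : ContDiff ℝ ∞ (layer lam kap β j) := by
  induction j with
  | zero => exact h.contDiff
  | succ j ih =>
    have aux : ∀ s : ℝ, ContDiff ℝ ∞ (fun x : ℝ => (x - s) / lam) := fun s =>
      (contDiff_id.sub contDiff_const).div_const _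
    exact contDiff_const.mul ((ih.comp (aux _)).add (ih.comp (aux _)))

lemma layer_nonneg (h : BaseBump lam kap β) (j : ℕ) (x : ℝ) : 0 ≤ layer lam kap β j x := by
  induction j generalizing x with
  | zero => exact h.nonneg x
  | succ j ih => exact mul_nonneg h.kap_pos.le (add_nonneg (ih _) (ih _))

lemma abs_branch_ge (h : BaseBump lam kap β) {x : ℝ} (hx : 1 - lam ≤ |x|) {s : ℝ}
    (hs : |s| = (1 - lam) / 2) : 1 - lam ≤ |(x - s) / lam| := by
  have h0 := h.lam_pos
  have h1 := h.lam_lt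
  rw [abs_div, abs_of_pos h0, le_div_iff₀ h0]
  have := abs_sub_abs_le_abs_sub x s
  nlinarith

lemma abs_shift (h : BaseBump lam kap β) : |(1 - lam) / 2| = (1 - lam) / 2 :=
  abs_of_pos (by linarith [h.lam_lt])

lemma layer_eq_zero (h : BaseBump lam kap β) (j : ℕ) {x : ℝ} (hx : 1 - lam ≤ |x|) :
    layer lam kap β j x = 0 := by
  induction j generalizing x with
  | zero => exact h.eq_zero x hx
  | succ j ih =>
    simp only [layer]
    rw [ih (h.abs_branch_ge hx h.abs_shift),
      ih (h.abs_branch_ge hx (by rw [abs_neg, h.abs_shift]))]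
    simp

/-- The two branches of the construction do not overlap. -/
lemma branch_disjoint (h : BaseBump lam kap β) {x s : ℝ} (hs : |s| = (1 - lam) / 2)
    (hx : |(x - s) / lam| < 1 - lam) : 1 - lam ≤ |(x - -s) / lam| := by
  have h0 := h.lam_pos
  have h1 := h.lam_lt
  rw [abs_div, abs_of_pos h0, div_lt_iff₀ h0] at hx
  rw [abs_div, abs_of_pos h0, le_div_iff₀ h0]
  have h2 : |2 * s| ≤ |x - -s| + |x - s| := by
    have := abs_sub (x - -s) (x - s)
    rwa [show x - -s - (x - s) = 2 * s by ring] at this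
  rw [abs_mul, abs_two, hs] at h2
  nlinarith

lemma gapApprox_zero (x : ℝ) : gapApprox lam kap β 0 x = 1 := by simp [gapApprox]

lemma gapApprox_succ (k : ℕ) (x : ℝ) : gapApprox lam kap β (k + 1) x =
    1 - β x - kap * ((1 - gapApprox lam kap β k ((x - (1 - lam) / 2) / lam)) +
      (1 - gapApprox lam kap β k ((x - -((1 - lam) / 2)) / lam))) := by
  simp only [gapApprox, Finset.sum_range_succ', layer, ← Finset.mul_sum, Finset.sum_add_distrib]
  ring

lemma gapApprox_eq_one (h : BaseBump lam kap β) (k : ℕ) {x : ℝ} (hx : 1 - lam ≤ |x|) :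
    gapApprox lam kap β k x = 1 := by
  simp [gapApprox, h.layer_eq_zero _ hx]

/-- Self-similarity: in the window of one branch, `β` has its plateau value `1 - kap` and the other
branch contributes nothing, so the recursion collapses to multiplication by `kap`. -/
lemma gapApprox_branch (h : BaseBump lam kap β) (k : ℕ) {x s : ℝ}
    (hs : s = (1 - lam) / 2 ∨ s = -((1 - lam) / 2))
    (hx : |(x - s) / lam| < 1 - lam) :
    gapApprox lam kap β (k + 1) x = kap * gapApprox lam kap β k ((x - s) / lam) := by
  have h0 := h.lam_pos
  have h1 := h.lam_lt
  have hs' : |s| = (1 - lam) / 2 := by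
    rcases hs with rfl | rfl
    · exact h.abs_shift
    · rw [abs_neg, h.abs_shift]
  have hb : β x = 1 - kap := by
    apply h.eq_of_abs_le
    rw [abs_div, abs_of_pos h0, div_lt_iff₀ h0] at hx
    have := abs_sub_abs_le_abs_sub x s
    rw [hs'] at this
    linarith
  have hd := h.gapApprox_eq_one k (h.branch_disjoint hs' hx)
  rw [gapApprox_succ, hb]
  rcases hs with rfl | rfl
  · rw [hd]; ring
  · rw [neg_neg] at hd; rw [hd]; ring

lemma gapApprox_no_branch (h : BaseBump lam kap β) (k : ℕ) {x : ℝ}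
    (hx : 1 - lam ≤ |(x - (1 - lam) / 2) / lam|) (hx' : 1 - lam ≤ |(x - -((1 - lam) / 2)) / lam|) :
    gapApprox lam kap β (k + 1) x = 1 - β x := by
  rw [gapApprox_succ, h.gapApprox_eq_one k hx, h.gapApprox_eq_one k hx']; ring

lemma kap_lt_one (h : BaseBump lam kap β) : kap < 1 := by
  linarith [h.kap_le, h.lam_lt]

lemma pow_le_gapApprox (h : BaseBump lam kap β) (k : ℕ) (x : ℝ) :
    kap ^ k ≤ gapApprox lam kap β k x := by
  induction k generalizing x with
  | zero => simp [gapApprox]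
  | succ k ih =>
    by_cases hx : |(x - (1 - lam) / 2) / lam| < 1 - lam
    · rw [h.gapApprox_branch k (Or.inl rfl) hx, pow_succ']
      exact mul_le_mul_of_nonneg_left (ih _) h.kap_pos.le
    by_cases hx' : |(x - -((1 - lam) / 2)) / lam| < 1 - lam
    · rw [h.gapApprox_branch k (Or.inr rfl) hx', pow_succ']
      exact mul_le_mul_of_nonneg_left (ih _) h.kap_pos.le
    rw [h.gapApprox_no_branch k (not_lt.1 hx) (not_lt.1 hx')]
    have : kap ^ (k + 1) ≤ kap := pow_le_of_le_one h.kap_pos.le h.kap_lt_one.le (by simp)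
    linarith [h.le x]

lemma gapApprox_pos (h : BaseBump lam kap β) (k : ℕ) (x : ℝ) : 0 < gapApprox lam kap β k x :=
  (pow_pos h.kap_pos k).trans_le (h.pow_le_gapApprox k x)

lemma gapApprox_le_one (h : BaseBump lam kap β) (k : ℕ) (x : ℝ) : gapApprox lam kap β k x ≤ 1 := by
  have := Finset.sum_nonneg fun j (_ : j ∈ Finset.range k) => h.layer_nonneg j x
  rw [gapApprox]; linarith

lemma contDiff_gapApprox (h : BaseBump lam kap β) (k : ℕ) :
    ContDiff ℝ ∞ (gapApprox lam kap β k) :=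
  contDiff_const.sub (ContDiff.sum fun j _ => h.contDiff_layer j)

/-- Each generation gains a factor `kap`, each of the `i` derivatives costs a factor `1 / lam`, and
the 2 comes from adding both branches crudely. -/
lemma iteratedDeriv_layer_bound (h : BaseBump lam kap β) {i : ℕ} {B : ℝ}
    (hB : ∀ x, |iteratedDeriv i β x| ≤ B) (j : ℕ) (x : ℝ) :
    |iteratedDeriv i (layer lam kap β j) x| ≤ B * (2 * kap / lam ^ i) ^ j := by
  induction j generalizing x with
  | zero => simpa [layer] using hB x
  | succ j ih =>
    have h0 := h.lam_pos
    have hf : ContDiff ℝ i (layer lam kap β j) := (h.contDiff_layer j).of_le (by exact_mod_cast le_top)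
    have hscale : ∀ s : ℝ, (fun x : ℝ => layer lam kap β j ((x - s) / lam)) =
        fun x => (fun z => layer lam kap β j (lam⁻¹ * z)) (x - s) := by
      intro s; ext x; simp only; congr 1; field_simp
    have hder : ∀ s y : ℝ, iteratedDeriv i (fun x : ℝ => layer lam kap β j ((x - s) / lam)) y =
        (lam⁻¹) ^ i * iteratedDeriv i (layer lam kap β j) (lam⁻¹ * (y - s)) := by
      intro s y
      rw [hscale, iteratedDeriv_comp_sub_const i (fun z => layer lam kap β j (lam⁻¹ * z)) s,
        iteratedDeriv_comp_const_mul hf]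
    have hcd : ∀ s : ℝ, ContDiff ℝ i (fun x : ℝ => layer lam kap β j ((x - s) / lam)) := fun s =>
      hf.comp ((contDiff_id.sub contDiff_const).div_const _)
    have e : iteratedDeriv i (layer lam kap β (j + 1)) x =
        kap * ((lam⁻¹) ^ i * iteratedDeriv i (layer lam kap β j) (lam⁻¹ * (x - (1 - lam) / 2)) +
          (lam⁻¹) ^ i * iteratedDeriv i (layer lam kap β j) (lam⁻¹ * (x - -((1 - lam) / 2)))) := by
      rw [← hder, ← hder]
      have := iteratedDeriv_const_mul (n := i) (x := x) kap
        (((hcd ((1 - lam) / 2)).add (hcd (-((1 - lam) / 2)))).contDiffAt)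
      have h2 := iteratedDeriv_add (n := i) (x := x) (hcd ((1 - lam) / 2)).contDiffAt
        (hcd (-((1 - lam) / 2))).contDiffAt
      rw [← h2]
      exact this
    rw [e, abs_mul, abs_of_pos h.kap_pos]
    calc _ ≤ kap * ((lam⁻¹) ^ i * (B * (2 * kap / lam ^ i) ^ j) +
          (lam⁻¹) ^ i * (B * (2 * kap / lam ^ i) ^ j)) := by
          refine mul_le_mul_of_nonneg_left ((abs_add_le _ _).trans ?_) h.kap_pos.le
          rw [abs_mul, abs_mul, abs_of_pos (pow_pos (inv_pos.2 h0) i)]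
          gcongr <;> exact ih _
      _ = _ := by rw [pow_succ, inv_pow]; field_simp; ring

lemma exists_bound (h : BaseBump lam kap β) (i : ℕ) :
    ∃ B, 0 ≤ B ∧ ∀ x, |iteratedDeriv i β x| ≤ B := by
  have hc : Continuous (iteratedDeriv i β) := h.contDiff.continuous_iteratedDeriv i (by exact_mod_cast le_top)
  have hs : HasCompactSupport β := by
    refine HasCompactSupport.of_support_subset_isCompact (isCompact_Icc (a := -1) (b := (1:ℝ))) ?_
    intro x hx
    by_contra hx'
    apply hx
    apply h.eq_zero
    rw [mem_Icc, ← abs_le] at hx'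
    linarith [h.lam_pos]
  have hs' : HasCompactSupport (iteratedDeriv i β) := by
    rw [iteratedDeriv_eq_equiv_comp]
    exact (hs.iteratedFDeriv i).comp_left (by simp)
  obtain ⟨B, hB⟩ := hs'.exists_bound_of_continuous hc
  exact ⟨B, (norm_nonneg _).trans (hB 0), hB⟩

lemma ratio_le (h : BaseBump lam kap β) {N i : ℕ} (hN : kap ≤ lam ^ N / 4) (hi : i ≤ N) :
    2 * kap / lam ^ i ≤ 1 / 2 := by
  have h0 := h.lam_pos
  rw [div_le_iff₀ (pow_pos h0 i)]
  have := pow_le_pow_of_le_one h0.le (by linarith [h.lam_lt]) hi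
  linarith

lemma summable_ratio (h : BaseBump lam kap β) {N i : ℕ} (hN : kap ≤ lam ^ N / 4) (hi : i ≤ N)
    (B : ℝ) : Summable fun j => B * (2 * kap / lam ^ i) ^ j :=
  (summable_geometric_of_lt_one (div_nonneg (by linarith [h.kap_pos])
    (pow_pos h.lam_pos i).le) ((h.ratio_le hN hi).trans_lt (by norm_num))).mul_left _

/-- Weierstrass test for the derivatives: `kap ≤ lam ^ N / 4` makes the geometric ratio at most `1 /
2` up to order `N`. A faster decay of the gap function thus buys smoothness. -/
lemma contDiff_gap (h : BaseBump lam kap β) {N : ℕ} (hN : kap ≤ lam ^ N / 4) :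
    ContDiff ℝ N (gap lam kap β) := by
  choose B hB0 hB using h.exists_bound
  refine contDiff_const.sub ?_
  have := contDiff_tsum (𝕜 := ℝ) (f := layer lam kap β) (N := (N : ℕ∞))
    (v := fun i j => B i * (2 * kap / lam ^ i) ^ j)
    (fun j => (h.contDiff_layer j).of_le (by exact_mod_cast le_top))
    (fun i hi => h.summable_ratio hN (by exact_mod_cast hi) _)
    (fun i j x hi => by
      rw [norm_iteratedFDeriv_eq_norm_iteratedDeriv]
      exact h.iteratedDeriv_layer_bound (hB i) j x)
  exact_mod_cast this

lemma tendsto_gapApprox (h : BaseBump lam kap β) (x : ℝ) :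
    Tendsto (fun k => gapApprox lam kap β k x) atTop (𝓝 (gap lam kap β x)) := by
  obtain ⟨B, hB0, hB⟩ := h.exists_bound 0
  have hs : Summable fun j => layer lam kap β j x := by
    refine Summable.of_norm_bounded (h.summable_ratio (N := 1) (by rw [pow_one]; exact h.kap_le)
      (Nat.zero_le _) B) fun j => ?_
    simpa using h.iteratedDeriv_layer_bound hB j x
  exact tendsto_const_nhds.sub hs.hasSum.tendsto_sum_nat

lemma gapApprox_antitone (h : BaseBump lam kap β) (x : ℝ) :
    Antitone fun k => gapApprox lam kap β k x := by
  refine antitone_nat_of_succ_le fun k => ?_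
  simp only [gapApprox, Finset.sum_range_succ]
  linarith [h.layer_nonneg k x]

lemma gap_le_gapApprox (h : BaseBump lam kap β) (k : ℕ) (x : ℝ) :
    gap lam kap β x ≤ gapApprox lam kap β k x :=
  (h.gapApprox_antitone x).le_of_tendsto (h.tendsto_gapApprox x) k

lemma gap_nonneg (h : BaseBump lam kap β) (x : ℝ) : 0 ≤ gap lam kap β x :=
  ge_of_tendsto' (h.tendsto_gapApprox x) fun k => (h.gapApprox_pos k x).le

lemma gap_branch (h : BaseBump lam kap β) {x s : ℝ}
    (hs : s = (1 - lam) / 2 ∨ s = -((1 - lam) / 2)) (hx : |(x - s) / lam| < 1 - lam) :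
    gap lam kap β x = kap * gap lam kap β ((x - s) / lam) := by
  refine tendsto_nhds_unique ((tendsto_add_atTop_iff_nat 1).2 (h.tendsto_gapApprox x)) ?_
  simp only [h.gapApprox_branch _ hs hx]
  exact (h.tendsto_gapApprox _).const_mul _

lemma gap_le_one (h : BaseBump lam kap β) (x : ℝ) : gap lam kap β x ≤ 1 :=
  (h.gap_le_gapApprox 0 x).trans_eq (gapApprox_zero x)

lemma abs_deriv_gapApprox_le (h : BaseBump lam kap β) :
    ∃ C, 0 ≤ C ∧ ∀ k x, |deriv (gapApprox lam kap β k) x| ≤ C := by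
  obtain ⟨B, hB0, hB⟩ := h.exists_bound 1
  have hN : kap ≤ lam ^ 1 / 4 := by rw [pow_one]; exact h.kap_le
  have hsum := h.summable_ratio hN le_rfl B
  have hnn : ∀ j, 0 ≤ B * (2 * kap / lam ^ 1) ^ j := fun j =>
    mul_nonneg hB0 (pow_nonneg (div_nonneg (by linarith [h.kap_pos]) (pow_pos h.lam_pos 1).le) _)
  refine ⟨∑' j, B * (2 * kap / lam ^ 1) ^ j, tsum_nonneg hnn, fun k x => ?_⟩
  have hd : ∀ j, DifferentiableAt ℝ (layer lam kap β j) x := fun j =>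
    ((h.contDiff_layer j).differentiable (by simp)).differentiableAt
  have e : deriv (gapApprox lam kap β k) x =
      -∑ j ∈ Finset.range k, deriv (layer lam kap β j) x := by
    have : HasDerivAt (gapApprox lam kap β k)
        (-∑ j ∈ Finset.range k, deriv (layer lam kap β j) x) x := by
      have := HasDerivAt.fun_sum fun j (_ : j ∈ Finset.range k) => (hd j).hasDerivAt
      exact this.const_sub 1
    exact this.deriv
  rw [e, abs_neg]
  refine (Finset.abs_sum_le_sum_abs _ _).trans (le_trans (Finset.sum_le_sum fun j _ => ?_)
    (hsum.sum_le_tsum _ fun j _ => hnn j))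
  have := h.iteratedDeriv_layer_bound hB j x
  rwa [iteratedDeriv_one] at this

/-- A nonzero layer of generation `j` means that the point lies in nested branch windows, and each
of them multiplies the gap by `kap`. -/
lemma gap_le_of_layer_ne_zero (h : BaseBump lam kap β) (j : ℕ) {x : ℝ}
    (hx : layer lam kap β j x ≠ 0) : gap lam kap β x ≤ kap ^ j := by
  induction j generalizing x with
  | zero => simpa using h.gap_le_one x
  | succ j ih =>
    have aux : ∀ s, (s = (1 - lam) / 2 ∨ s = -((1 - lam) / 2)) →
        layer lam kap β j ((x - s) / lam) ≠ 0 → gap lam kap β x ≤ kap ^ (j + 1) := by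
      intro s hs hne
      have hlt : |(x - s) / lam| < 1 - lam := by
        by_contra hge
        exact hne (h.layer_eq_zero j (not_lt.1 hge))
      rw [h.gap_branch hs hlt, pow_succ']
      exact mul_le_mul_of_nonneg_left (ih hne) h.kap_pos.le
    by_cases h1 : layer lam kap β j ((x - (1 - lam) / 2) / lam) = 0
    · refine aux _ (Or.inr rfl) fun h2 => hx ?_
      simp only [layer, h1, h2, add_zero, mul_zero]
    · exact aux _ (Or.inl rfl) h1

/-- Near a point with positive gap only finitely many layers are active, so the smooth
approximations are locally stationary, not merely convergent. -/
lemma eventually_gapApprox_eq (h : BaseBump lam kap β) {x : ℝ} (hx : 0 < gap lam kap β x) :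
    ∃ K, ∀ k ≥ K, ∀ᶠ y in 𝓝 x, gapApprox lam kap β k y = gap lam kap β y := by
  obtain ⟨K, hK⟩ := exists_pow_lt_of_lt_one hx h.kap_lt_one
  refine ⟨K, fun k hk => ?_⟩
  have hc : Continuous (gap lam kap β) := (h.contDiff_gap (N := 1) (by rw [pow_one]; exact h.kap_le)).continuous
  filter_upwards [hc.continuousAt.eventually (lt_mem_nhds hK)] with y hy
  rw [gapApprox, gap, sub_right_inj]
  symm
  refine tsum_eq_sum fun j hj => ?_
  by_contra hne
  have h1 := h.gap_le_of_layer_ne_zero j hne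
  have h2 : kap ^ j ≤ kap ^ K := pow_le_pow_of_le_one h.kap_pos.le h.kap_lt_one.le
    (hk.le.trans (by simpa using hj))
  linarith

/-- The Cantor function is constant on intervals of length comparable to the gap function. -/
lemma cantor_const (h : BaseBump lam kap β) {F : ℝ → ℝ} (hmono : Monotone F)
    (hl : ∀ x, x ≤ -(1 / 2) → F x = 0)
    (hr : ∀ x, 1 / 2 ≤ x → F x = 1)
    (hF : ∀ x, F x = (F ((x - (1 - lam) / 2) / lam) + F ((x + (1 - lam) / 2) / lam)) / 2)
    {x y : ℝ} (hxy : |x - y| ≤ lam * (1 - 2 * lam) / 2 * gap lam kap β x) : F y = F x := by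
  have h0 := h.lam_pos
  have h1 := h.lam_lt
  have hF' : ∀ x, F x = (F ((x - (1 - lam) / 2) / lam) + F ((x - -((1 - lam) / 2)) / lam)) / 2 := by
    intro x; rw [sub_neg_eq_add]; exact hF x
  have hmem : ∀ x, F x ∈ Icc (0 : ℝ) 1 := by
    intro x
    constructor
    · rcases le_total x (-(1 / 2)) with h | h
      · exact (hl x h).ge
      · rw [← hl _ le_rfl]; exact hmono h
    · rcases le_total x (1 / 2) with h | h
      · rw [← hr _ le_rfl]; exact hmono h
      · exact (hr x h).le
  have hdiv : ∀ x y s : ℝ, |(x - s) / lam - (y - s) / lam| = |x - y| / lam := by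
    intro x y s
    rw [← sub_div, sub_sub_sub_cancel_right, abs_div, abs_of_pos h0]
  -- Outside a branch window a shift of at most `(1 - 2 * lam) / 2` in the rescaled variable leaves
  -- the modulus at least `1 / 2`, where `F` is 0 or 1.
  have hfar : ∀ x y s : ℝ, |x - y| ≤ lam * (1 - 2 * lam) / 2 →
      1 - lam ≤ |(x - s) / lam| → F ((y - s) / lam) = F ((x - s) / lam) := by
    intro x y s hd hge
    have h2 : |(x - s) / lam - (y - s) / lam| ≤ (1 - 2 * lam) / 2 := by
      rw [hdiv, div_le_iff₀ h0]; linarith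
    rw [abs_le] at h2
    rcases le_abs.1 hge with h3 | h3
    · rw [hr _ (by linarith), hr _ (by linarith)]
    · rw [hl _ (by linarith), hl _ (by linarith)]
  -- At most one branch sees a difference, and the average halves it; iterating gives the bound `(1
  -- / 2) ^ k` for every `k`.
  have key : ∀ k : ℕ, ∀ x y : ℝ, |x - y| ≤ lam * (1 - 2 * lam) / 2 * gap lam kap β x →
      |F y - F x| ≤ (1 / 2) ^ k := by
    intro k
    induction k with
    | zero =>
      intro x y _
      rw [abs_le]
      constructor <;> linarith [(hmem x).1, (hmem x).2, (hmem y).1, (hmem y).2, pow_zero (1/2 : ℝ)]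
    | succ k ih =>
      intro x y hxy
      have hc : 0 < lam * (1 - 2 * lam) / 2 := by
        have : 0 < 1 - 2 * lam := by linarith
        positivity
      have hxy1 : |x - y| ≤ lam * (1 - 2 * lam) / 2 :=
        hxy.trans (mul_le_of_le_one_right hc.le (h.gap_le_one x))
      -- Rescaling divides distances by `lam` and the gap by `kap`; since `kap ≤ lam`, the
      -- hypothesis is reproduced.
      have hnear : ∀ s, (s = (1 - lam) / 2 ∨ s = -((1 - lam) / 2)) → |(x - s) / lam| < 1 - lam →
          |F ((y - s) / lam) - F ((x - s) / lam)| ≤ (1 / 2) ^ k := by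
        intro s hs hlt
        apply ih
        rw [hdiv, div_le_iff₀ h0]
        rw [h.gap_branch hs hlt] at hxy
        refine hxy.trans ?_
        have := h.gap_nonneg ((x - s) / lam)
        have hkl : kap ≤ lam := by linarith [h.kap_le]
        calc _ ≤ lam * (1 - 2 * lam) / 2 * (lam * gap lam kap β ((x - s) / lam)) := by gcongr
          _ = _ := by ring
      rw [hF' y, hF' x]
      by_cases hp : |(x - (1 - lam) / 2) / lam| < 1 - lam
      · rw [hfar x y (-((1 - lam) / 2)) hxy1 (h.branch_disjoint h.abs_shift hp), ← sub_div,
          add_sub_add_right_eq_sub, abs_div, abs_two, pow_succ]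
        linarith [hnear _ (Or.inl rfl) hp]
      rw [hfar x y ((1 - lam) / 2) hxy1 (not_lt.1 hp)]
      by_cases hm : |(x - -((1 - lam) / 2)) / lam| < 1 - lam
      · rw [← sub_div, add_sub_add_left_eq_sub, abs_div, abs_two, pow_succ]
        linarith [hnear _ (Or.inr rfl) hm]
      rw [hfar x y (-((1 - lam) / 2)) hxy1 (not_lt.1 hm)]
      simp
  have hz : |F y - F x| ≤ 0 :=
    ge_of_tendsto' (tendsto_pow_atTop_nhds_zero_of_lt_one (by norm_num) (by norm_num : (1/2:ℝ) < 1))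
      fun k => key k x y hxy
  exact sub_eq_zero.1 (abs_nonpos_iff.1 hz)

end BaseBump

/-! ### Integrability of small negative powers of the gap function -/

lemma lintegral_comp_branch {lam : ℝ} (h0 : 0 < lam) (s : ℝ) (f : ℝ → ℝ≥0∞) :
    ∫⁻ x, f ((x - s) / lam) = ENNReal.ofReal lam * ∫⁻ x, f x := by
  have h1 := lintegral_sub_right_eq_self (μ := volume) (fun x => f (x / lam)) s
  rw [h1]
  have hne : lam⁻¹ ≠ 0 := inv_ne_zero h0.ne'
  have h2 := (Homeomorph.mulLeft₀ lam⁻¹ hne).measurableEmbedding.lintegral_map (μ := volume) f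
  simp only [Homeomorph.coe_mulLeft₀] at h2
  rw [Real.map_volume_mul_left hne, inv_inv, abs_of_pos h0, lintegral_smul_measure] at h2
  simp only [div_eq_inv_mul]
  rw [← h2, smul_eq_mul]

lemma ennreal_rpow_neg_le {ε : ℝ} (hε : 0 ≤ ε) {a b : ℝ≥0∞} (hab : a ≤ b) :
    b ^ (-ε) ≤ a ^ (-ε) := by
  rw [ENNReal.rpow_neg, ENNReal.rpow_neg, ENNReal.inv_le_inv]
  exact ENNReal.rpow_le_rpow hab hε

namespace BaseBump

variable {lam kap : ℝ} {β : ℝ → ℝ}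

/-- Pointwise form of the recursion for the integrals: inside a branch window the power is that of a
rescaled copy times `kap ^ (-ε)`, and outside both windows the gap is at least `kap`. -/
lemma gapApprox_rpow_le (h : BaseBump lam kap β) {ε : ℝ} (hε : 0 < ε) (k : ℕ) (x : ℝ) :
    (Ioo (-(1 - lam)) (1 - lam)).indicator
        (fun x => ENNReal.ofReal (gapApprox lam kap β (k + 1) x) ^ (-ε)) x ≤
      (Ioo (-(1 - lam)) (1 - lam)).indicator (fun _ => ENNReal.ofReal (kap ^ (-ε))) x +
      ENNReal.ofReal (kap ^ (-ε)) *
        ((Ioo (-(1 - lam)) (1 - lam)).indicator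
          (fun x => ENNReal.ofReal (gapApprox lam kap β k x) ^ (-ε)) ((x - (1 - lam) / 2) / lam) +
        (Ioo (-(1 - lam)) (1 - lam)).indicator
          (fun x => ENNReal.ofReal (gapApprox lam kap β k x) ^ (-ε))
          ((x - -((1 - lam) / 2)) / lam)) := by
  have hmem : ∀ y : ℝ, y ∈ Ioo (-(1 - lam)) (1 - lam) ↔ |y| < 1 - lam := fun y => by
    rw [abs_lt]; rfl
  by_cases hx : x ∈ Ioo (-(1 - lam)) (1 - lam)
  swap
  · rw [indicator_of_notMem hx]; exact zero_le
  rw [indicator_of_mem hx, indicator_of_mem hx, ← ENNReal.ofReal_rpow_of_pos h.kap_pos]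
  have hb : ∀ s, (s = (1 - lam) / 2 ∨ s = -((1 - lam) / 2)) → |(x - s) / lam| < 1 - lam →
      ENNReal.ofReal (gapApprox lam kap β (k + 1) x) ^ (-ε) ≤
      ENNReal.ofReal kap ^ (-ε) * (Ioo (-(1 - lam)) (1 - lam)).indicator
          (fun x => ENNReal.ofReal (gapApprox lam kap β k x) ^ (-ε)) ((x - s) / lam) := by
    intro s hs hlt
    rw [indicator_of_mem ((hmem _).2 hlt), h.gapApprox_branch k hs hlt,
      ENNReal.ofReal_mul h.kap_pos.le,
      ENNReal.mul_rpow_of_ne_top ENNReal.ofReal_ne_top ENNReal.ofReal_ne_top]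
  rw [mul_add]
  by_cases hp : |(x - (1 - lam) / 2) / lam| < 1 - lam
  · exact (hb _ (Or.inl rfl) hp).trans (le_self_add.trans le_add_self)
  by_cases hm : |(x - -((1 - lam) / 2)) / lam| < 1 - lam
  · exact (hb _ (Or.inr rfl) hm).trans (le_add_self.trans le_add_self)
  rw [h.gapApprox_no_branch k (not_lt.1 hp) (not_lt.1 hm)]
  refine le_trans ?_ le_self_add
  refine ennreal_rpow_neg_le hε.le (ENNReal.ofReal_le_ofReal ?_)
  linarith [h.le x]

/-- The integrals satisfy an affine recursion with slope `2 * lam * kap ^ (-ε) < 1`: two branches,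
each contracting length by `lam`. The bound is its fixed point. -/
lemma lintegral_gapApprox_le (h : BaseBump lam kap β) {ε : ℝ} (hε : 0 < ε)
    (hr : 2 * lam * kap ^ (-ε) < 1) (k : ℕ) :
    ∫⁻ x, (Ioo (-(1 - lam)) (1 - lam)).indicator
        (fun x => ENNReal.ofReal (gapApprox lam kap β k x) ^ (-ε)) x ≤
      ENNReal.ofReal (kap ^ (-ε) * (2 * (1 - lam)) / (1 - 2 * lam * kap ^ (-ε))) := by
  have h0 := h.lam_pos
  have h1 := h.lam_lt
  have hK : 1 ≤ kap ^ (-ε) :=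
    Real.one_le_rpow_of_pos_of_le_one_of_nonpos h.kap_pos h.kap_lt_one.le (by linarith)
  have hr0 : 0 < 2 * lam * kap ^ (-ε) := by positivity
  have hvol : volume (Ioo (-(1 - lam)) (1 - lam)) = ENNReal.ofReal (2 * (1 - lam)) := by
    rw [Real.volume_Ioo]; congr 1; ring
  induction k with
  | zero =>
    simp only [gapApprox_zero, ENNReal.ofReal_one, ENNReal.one_rpow]
    rw [lintegral_indicator measurableSet_Ioo, lintegral_one, Measure.restrict_apply_univ, hvol]
    apply ENNReal.ofReal_le_ofReal
    rw [le_div_iff₀ (by linarith)]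
    have : 0 < 1 - lam := by linarith
    nlinarith
  | succ k ih =>
    have hmeas : Measurable ((Ioo (-(1 - lam)) (1 - lam)).indicator
        (fun x => ENNReal.ofReal (gapApprox lam kap β k x) ^ (-ε))) :=
      (((h.contDiff_gapApprox k).continuous.measurable.ennreal_ofReal).pow_const _).indicator
        measurableSet_Ioo
    have hmeas' : ∀ s : ℝ, Measurable fun x : ℝ => (Ioo (-(1 - lam)) (1 - lam)).indicator
        (fun x => ENNReal.ofReal (gapApprox lam kap β k x) ^ (-ε)) ((x - s) / lam) := fun s =>
      hmeas.comp (by fun_prop)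
    refine (lintegral_mono (h.gapApprox_rpow_le hε k)).trans ?_
    rw [lintegral_add_left (measurable_const.indicator measurableSet_Ioo),
      lintegral_const_mul' _ _ ENNReal.ofReal_ne_top, lintegral_add_left (hmeas' _),
      lintegral_comp_branch h0, lintegral_comp_branch h0, lintegral_indicator measurableSet_Ioo,
      lintegral_const, Measure.restrict_apply_univ, hvol]
    set I := ∫⁻ x, (Ioo (-(1 - lam)) (1 - lam)).indicator
        (fun x => ENNReal.ofReal (gapApprox lam kap β k x) ^ (-ε)) x
    have e : ENNReal.ofReal (kap ^ (-ε)) * (ENNReal.ofReal lam * I + ENNReal.ofReal lam * I) =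
        ENNReal.ofReal (2 * lam * kap ^ (-ε)) * I := by
      rw [← two_mul, ENNReal.ofReal_mul (by linarith), ENNReal.ofReal_mul (by norm_num),
        ENNReal.ofReal_ofNat]
      ring
    rw [e, ← ENNReal.ofReal_mul (by linarith)]
    calc _ ≤ ENNReal.ofReal (kap ^ (-ε) * (2 * (1 - lam))) + ENNReal.ofReal (2 * lam * kap ^ (-ε)) *
          ENNReal.ofReal (kap ^ (-ε) * (2 * (1 - lam)) / (1 - 2 * lam * kap ^ (-ε))) := by gcongr
      _ = _ := by
        have h2 : 0 < 1 - lam := by linarith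
        have h3 : 0 < 1 - 2 * lam * kap ^ (-ε) := by linarith
        rw [← ENNReal.ofReal_mul hr0.le, ← ENNReal.ofReal_add (by positivity) (by positivity)]
        congr 1
        linear_combination -(div_mul_cancel₀ (kap ^ (-ε) * (2 * (1 - lam))) h3.ne')

/-- Monotone convergence from the approximations; away from the window `|x| < 1 - lam` these are
equal to 1. -/
lemma lintegral_gap_lt_top (h : BaseBump lam kap β) {ε : ℝ} (hε : 0 < ε)
    (hr : 2 * lam * kap ^ (-ε) < 1) :
    ∫⁻ x in Ioo (-1 : ℝ) 1, ENNReal.ofReal (gap lam kap β x) ^ (-ε) < ⊤ := by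
  have h0 := h.lam_pos
  have hmeas : ∀ k, Measurable fun x => ENNReal.ofReal (gapApprox lam kap β k x) ^ (-ε) := fun k =>
    (((h.contDiff_gapApprox k).continuous.measurable.ennreal_ofReal).pow_const _)
  have hlim := lintegral_tendsto_of_tendsto_of_monotone (μ := volume.restrict (Ioo (-1 : ℝ) 1))
    (f := fun k x => ENNReal.ofReal (gapApprox lam kap β k x) ^ (-ε))
    (F := fun x => ENNReal.ofReal (gap lam kap β x) ^ (-ε))
    (fun k => (hmeas k).aemeasurable)
    (ae_of_all _ fun x i j hij => ennreal_rpow_neg_le hε.le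
      (ENNReal.ofReal_le_ofReal (h.gapApprox_antitone x hij)))
    (ae_of_all _ fun x => (ENNReal.continuous_rpow_const.tendsto _).comp
      (ENNReal.tendsto_ofReal (h.tendsto_gapApprox x)))
  refine lt_of_le_of_lt (le_of_tendsto' hlim fun k => ?_)
    (ENNReal.add_lt_top.2 ⟨(ENNReal.ofReal_lt_top :
      ENNReal.ofReal (kap ^ (-ε) * (2 * (1 - lam)) / (1 - 2 * lam * kap ^ (-ε))) < ⊤),
      (ENNReal.ofReal_lt_top : ENNReal.ofReal (1 - (-1)) < ⊤)⟩)
  calc _ ≤ ∫⁻ x in Ioo (-1 : ℝ) 1, ((Ioo (-(1 - lam)) (1 - lam)).indicator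
          (fun x => ENNReal.ofReal (gapApprox lam kap β k x) ^ (-ε)) x + 1) := by
        refine lintegral_mono fun x => ?_
        by_cases hx : x ∈ Ioo (-(1 - lam)) (1 - lam)
        · simp only [indicator_of_mem hx]; exact le_self_add
        · have : 1 - lam ≤ |x| := by
            by_contra hlt
            exact hx (abs_lt.1 (not_le.1 hlt))
          rw [h.gapApprox_eq_one k this]
          simp
    _ ≤ _ := by
        rw [lintegral_add_right _ measurable_const]
        refine add_le_add ((setLIntegral_le_lintegral _ _).trans
          (h.lintegral_gapApprox_le hε hr k)) ?_
        rw [lintegral_one, Measure.restrict_apply_univ, Real.volume_Ioo]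

end BaseBump

/-! ### The Cantor profile: everything needed of the Cantor set -/

/-- A Cantor function `F` of Hölder exponent `1 - δ`, together with a regularised distance `d` to
the Cantor set that carries its variation and smooth positive approximations of `d`. -/
structure CantorProfile (δ : ℝ) (N : ℕ) where
  /-- the Cantor function -/
  F : ℝ → ℝ
  /-- the regularised distance -/
  d : ℝ → ℝ
  /-- smooth approximations of `d` -/
  dk : ℕ → ℝ → ℝ
  /-- the value of `d` far from the Cantor set -/
  c : ℝ
  /-- radius of an interval containing the Cantor set -/
  ρ : ℝ
  /-- Hölder and Lipschitz constant -/
  C : ℝ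
  /-- exponent of integrability of `1 / d` -/
  ε : ℝ
  c_pos : 0 < c
  c_le : c ≤ 1 / 2
  ρ_lt : ρ < 1
  C_nonneg : 0 ≤ C
  ε_pos : 0 < ε
  monotone_F : Monotone F
  F_left : ∀ x, x ≤ -(1 / 2) → F x = 0
  F_right : ∀ x, 1 / 2 ≤ x → F x = 1
  F_holder : ∀ x y, x ≤ y → F y - F x ≤ C * (y - x) ^ (1 - δ)
  F_const : ∀ x y, |x - y| ≤ d x → F y = F x
  dk_contDiff : ∀ k, ContDiff ℝ ∞ (dk k)
  dk_pos : ∀ k x, 0 < dk k x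
  dk_le : ∀ k x, dk k x ≤ c
  d_le_dk : ∀ k x, d x ≤ dk k x
  dk_deriv : ∀ k x, |deriv (dk k) x| ≤ C
  dk_far : ∀ k x, ρ ≤ |x| → dk k x = c
  dk_eventually : ∀ x, 0 < d x → ∃ K, ∀ k ≥ K, ∀ᶠ y in 𝓝 x, dk k y = d y
  d_nonneg : ∀ x, 0 ≤ d x
  d_contDiff : ContDiff ℝ N d
  d_integrable : ∫⁻ x in Ioo (-1 : ℝ) 1, ENNReal.ofReal (d x) ^ (-ε) < ⊤

/-- Two contraction ratios are at play: `lam` fixes the dimension of the Cantor set, and the much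
smaller `kap` makes the distance `C^N`. As `2 * lam < 1`, a small enough negative power of the
distance remains integrable. -/
theorem exists_cantorProfile {δ : ℝ} (hδ0 : 0 < δ) (hδ1 : δ < 1) (N : ℕ) :
    Nonempty (CantorProfile δ N) := by
  set lam : ℝ := (1 / 2) ^ (1 / (1 - δ)) with hlamdef
  have hD : 0 < 1 - δ := by linarith
  have h0 : 0 < lam := by positivity
  have h1 : lam < 1 / 2 := by
    calc lam < (1 / 2 : ℝ) ^ (1 : ℝ) := by
          apply Real.rpow_lt_rpow_of_exponent_gt (by norm_num) (by norm_num)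
          rw [lt_div_iff₀ hD]; linarith
      _ = 1 / 2 := Real.rpow_one _
  have hlam : lam ^ (1 - δ) = 1 / 2 := by
    rw [hlamdef, ← Real.rpow_mul (by norm_num), one_div_mul_cancel hD.ne', Real.rpow_one]
  -- The exponent `N + 1` yields both `kap ≤ lam ^ N / 4` and `kap ≤ lam / 4`, also for `N = 0`.
  set kap : ℝ := lam ^ (N + 1) / 4 with hkap
  have hk0 : 0 < kap := by positivity
  have hpow1 : lam ^ (N + 1) ≤ lam := pow_le_of_le_one h0.le (by linarith) (by simp)
  have hpowN : lam ^ (N + 1) ≤ lam ^ N := pow_le_pow_of_le_one h0.le (by linarith) (by simp)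
  -- The plateau covers both branch windows: `(1 - lam) / 2 + lam * (1 - lam) = (1 - lam) * (1 / 2 +
  -- lam)`.
  let bump : ContDiffBump (0 : ℝ) :=
    { rIn := (1 - lam) * (1 / 2 + lam)
      rOut := 1 - lam
      rIn_pos := by
        have : 0 < 1 - lam := by linarith
        positivity
      rIn_lt_rOut := by
        have : 0 < 1 - lam := by linarith
        nlinarith }
  have hb : BaseBump lam kap (fun x => (1 - kap) * bump x) :=
    { lam_pos := h0
      lam_lt := h1
      kap_pos := hk0
      kap_le := by rw [hkap]; linarith
      contDiff := contDiff_const.mul bump.contDiff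
      nonneg := fun x => mul_nonneg (by linarith) bump.nonneg
      le := fun x => mul_le_of_le_one_right (by linarith) bump.le_one
      eq_of_abs_le := fun x hx => by
        rw [bump.one_of_mem_closedBall (by rw [mem_closedBall_zero_iff]; exact hx), mul_one]
      eq_zero := fun x hx => by
        rw [bump.zero_of_le_dist (by rw [dist_zero_right]; exact hx), mul_zero] }
  obtain ⟨F, hmono, hl, hr, ⟨C₁, hC₁, hhol⟩, hself⟩ :=
    exists_cantorFunction h0 h1 hD (by linarith) hlam
  obtain ⟨C₂, hC₂, hder⟩ := hb.abs_deriv_gapApprox_le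
  obtain ⟨ε, hε, hεr⟩ : ∃ ε : ℝ, 0 < ε ∧ 2 * lam * kap ^ (-ε) < 1 := by
    have hc : Tendsto (fun ε : ℝ => 2 * lam * kap ^ (-ε)) (𝓝[>] 0) (𝓝 (2 * lam * kap ^ (-(0:ℝ)))) := by
      refine Tendsto.mono_left (Continuous.tendsto ?_ 0) nhdsWithin_le_nhds
      exact continuous_const.mul ((Real.continuous_const_rpow hk0.ne').comp continuous_neg)
    rw [neg_zero, Real.rpow_zero, mul_one] at hc
    obtain ⟨ε, h2, h3⟩ := ((hc.eventually (gt_mem_nhds (show 2 * lam < 1 by linarith))).and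
      self_mem_nhdsWithin).exists
    exact ⟨ε, h3, h2⟩
  -- The factor of `BaseBump.cantor_const`: after this normalisation `F` is constant within distance
  -- `d x` of `x`.
  set c : ℝ := lam * (1 - 2 * lam) / 2 with hcdef
  have hg : 0 < 1 - 2 * lam := by linarith
  have hc0 : 0 < c := by positivity
  have hc1 : c ≤ 1 / 2 := by rw [hcdef]; nlinarith
  set β : ℝ → ℝ := fun x => (1 - kap) * bump x
  exact ⟨{
    F := F
    d := fun x => c * gap lam kap β x
    dk := fun k x => c * gapApprox lam kap β k x
    c := c
    ρ := 1 - lam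
    C := C₁ + C₂
    ε := ε
    c_pos := hc0
    c_le := hc1
    ρ_lt := by linarith
    C_nonneg := by linarith
    ε_pos := hε
    monotone_F := hmono
    F_left := hl
    F_right := hr
    F_holder := fun x y hxy => (hhol x y hxy).trans (by
      have := Real.rpow_nonneg (sub_nonneg.2 hxy) (1 - δ)
      gcongr; linarith)
    F_const := fun x y hxy => hb.cantor_const hmono hl hr hself hxy
    dk_contDiff := fun k => contDiff_const.mul (hb.contDiff_gapApprox k)
    dk_pos := fun k x => mul_pos hc0 (hb.gapApprox_pos k x)
    dk_le := fun k x => mul_le_of_le_one_right hc0.le (hb.gapApprox_le_one k x)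
    d_le_dk := fun k x => mul_le_mul_of_nonneg_left (hb.gap_le_gapApprox k x) hc0.le
    dk_deriv := fun k x => by
      rw [deriv_const_mul_field, abs_mul, abs_of_pos hc0]
      have := hder k x
      have h3 := abs_nonneg (deriv (gapApprox lam kap β k) x)
      nlinarith
    dk_far := fun k x hx => by rw [hb.gapApprox_eq_one k hx, mul_one]
    dk_eventually := fun x hx => by
      obtain ⟨K, hK⟩ := hb.eventually_gapApprox_eq (pos_of_mul_pos_right hx hc0.le)
      exact ⟨K, fun k hk => (hK k hk).mono fun y hy => by rw [hy]⟩
    d_nonneg := fun x => mul_nonneg hc0.le (hb.gap_nonneg x)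
    d_contDiff := contDiff_const.mul (hb.contDiff_gap (by rw [hkap]; linarith))
    d_integrable := by
      simp only [ENNReal.ofReal_mul hc0.le,
        ENNReal.mul_rpow_of_ne_top ENNReal.ofReal_ne_top ENNReal.ofReal_ne_top]
      rw [lintegral_const_mul' _ _ (ENNReal.rpow_ne_top_of_ne_zero
        (by simpa using hc0) ENNReal.ofReal_ne_top)]
      exact ENNReal.mul_lt_top (lt_top_iff_ne_top.2 (ENNReal.rpow_ne_top_of_ne_zero
        (by simpa using hc0) ENNReal.ofReal_ne_top)) (hb.lintegral_gap_lt_top hε hεr) }⟩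

/-! ### Weak gradients -/

section WeakGradient

variable {n : ℕ} {U : Set (EuclideanSpace ℝ (Fin n))}

lemma isOpen_cube (n : ℕ) : IsOpen (cube n) := by
  have : cube n = ⋂ i, (fun x : EuclideanSpace ℝ (Fin n) => x i) ⁻¹' Ioo (-1 : ℝ) 1 := by
    ext x; simp [cube]
  rw [this]
  exact isOpen_iInter_of_finite fun i => isOpen_Ioo.preimage (by fun_prop)

lemma gradient_apply (φ : EuclideanSpace ℝ (Fin n) → ℝ) (x : EuclideanSpace ℝ (Fin n))
    (i : Fin n) : gradient φ x i = fderiv ℝ φ x (EuclideanSpace.single i 1) := by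
  have h : inner ℝ (gradient φ x) (EuclideanSpace.single i (1 : ℝ)) =
      fderiv ℝ φ x (EuclideanSpace.single i 1) := by
    rw [gradient, InnerProductSpace.toDual_symm_apply]
  rw [← h, EuclideanSpace.inner_single_right]
  simp

lemma norm_gradient (φ : EuclideanSpace ℝ (Fin n) → ℝ) (x : EuclideanSpace ℝ (Fin n)) :
    ‖gradient φ x‖ = ‖fderiv ℝ φ x‖ := by
  rw [gradient, LinearIsometryEquiv.norm_map]

lemma continuous_gradient {φ : EuclideanSpace ℝ (Fin n) → ℝ} (hφ : ContDiff ℝ 1 φ) :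
    Continuous (gradient φ) :=
  (LinearIsometryEquiv.continuous _).comp (hφ.continuous_fderiv (by simp))

lemma setIntegral_eq_integral_of_tsupport {φ : EuclideanSpace ℝ (Fin n) → ℝ}
    (hφ : tsupport φ ⊆ U) (f : EuclideanSpace ℝ (Fin n) → ℝ)
    (hf : ∀ x, x ∉ tsupport φ → f x = 0) : ∫ x in U, f x = ∫ x, f x :=
  setIntegral_eq_integral_of_forall_compl_eq_zero fun x hx => hf x fun h => hx (hφ h)

lemma fderiv_eq_zero_of_notMem {φ : EuclideanSpace ℝ (Fin n) → ℝ} {x : EuclideanSpace ℝ (Fin n)}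
    (hx : x ∉ tsupport φ) : fderiv ℝ φ x = 0 := by
  by_contra h
  exact hx (support_fderiv_subset ℝ h)

/-- The classical gradient of a `C¹` function is a weak gradient. -/
lemma hasWeakGrad_gradient {f : EuclideanSpace ℝ (Fin n) → ℝ} (hf : ContDiff ℝ 1 f) :
    HasWeakGrad U f (gradient f) := by
  refine ⟨hf.continuous.locallyIntegrable.locallyIntegrableOn U,
    (continuous_gradient hf).locallyIntegrable.locallyIntegrableOn U, fun φ hφ i => ?_⟩
  obtain ⟨hφ1, hφ2, hφ3⟩ := hφ
  have hd : Continuous fun x => fderiv ℝ φ x (EuclideanSpace.single i 1) :=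
    (hφ1.continuous_fderiv (by simp)).clm_apply continuous_const
  have hd' : Continuous fun x => fderiv ℝ f x (EuclideanSpace.single i 1) :=
    (hf.continuous_fderiv (by simp)).clm_apply continuous_const
  have hs : HasCompactSupport fun x => fderiv ℝ φ x (EuclideanSpace.single i 1) :=
    hφ2.fderiv_apply (𝕜 := ℝ) _
  rw [setIntegral_eq_integral_of_tsupport hφ3 _ (fun x hx => by
      rw [fderiv_eq_zero_of_notMem hx]; simp),
    setIntegral_eq_integral_of_tsupport hφ3 _ (fun x hx => by
      rw [image_eq_zero_of_notMem_tsupport hx, mul_zero])]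
  simp only [gradient_apply]
  refine integral_mul_fderiv_eq_neg_fderiv_mul_of_integrable ?_ ?_ ?_
    (fun x _ => hf.differentiable (by simp) x) (fun x _ => hφ1.differentiable (by simp) x)
  · exact (hd'.mul hφ1.continuous).integrable_of_hasCompactSupport hφ2.mul_left
  · exact (hf.continuous.mul hd).integrable_of_hasCompactSupport hs.mul_left
  · exact (hf.continuous.mul hφ1.continuous).integrable_of_hasCompactSupport hφ2.mul_left

lemma integrableOn_mul_test {f φ : EuclideanSpace ℝ (Fin n) → ℝ}
    (hf : LocallyIntegrableOn f U) (hc : Continuous φ)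
    (hs : HasCompactSupport φ) (hU : tsupport φ ⊆ U) : IntegrableOn (fun x => f x * φ x) U := by
  have h1 : IntegrableOn f (tsupport φ) := hf.integrableOn_compact_subset hU hs
  have h2 : IntegrableOn (fun x => f x * φ x) (tsupport φ) :=
    h1.mul_continuousOn hc.continuousOn hs
  refine IntegrableOn.mono_set ?_ (subset_univ U)
  refine integrableOn_univ.2 ((integrableOn_iff_integrable_of_support_subset ?_).1 h2)
  intro x hx
  refine subset_tsupport _ fun h => hx ?_
  simp [h]

lemma LocallyIntegrableOn.coord {V : EuclideanSpace ℝ (Fin n) → EuclideanSpace ℝ (Fin n)}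
    (hV : LocallyIntegrableOn V U) (i : Fin n) : LocallyIntegrableOn (fun x => V x i) U :=
  fun x hx => by
    obtain ⟨s, hs, hi⟩ := hV x hx
    exact ⟨s, hs, (EuclideanSpace.proj (𝕜 := ℝ) i).integrable_comp hi⟩

lemma HasWeakGrad.add {w₁ w₂ : EuclideanSpace ℝ (Fin n) → ℝ}
    {V₁ V₂ : EuclideanSpace ℝ (Fin n) → EuclideanSpace ℝ (Fin n)}
    (h₁ : HasWeakGrad U w₁ V₁) (h₂ : HasWeakGrad U w₂ V₂) :
    HasWeakGrad U (w₁ + w₂) (V₁ + V₂) := by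
  refine ⟨h₁.1.add h₂.1, h₁.2.1.add h₂.2.1, fun φ hφ i => ?_⟩
  have hd : Continuous fun x => fderiv ℝ φ x (EuclideanSpace.single i 1) :=
    (hφ.1.continuous_fderiv (by simp)).clm_apply continuous_const
  have hs : HasCompactSupport fun x => fderiv ℝ φ x (EuclideanSpace.single i 1) :=
    hφ.2.1.fderiv_apply (𝕜 := ℝ) _
  have hsU : tsupport (fun x => fderiv ℝ φ x (EuclideanSpace.single i 1)) ⊆ U :=
    (tsupport_fderiv_apply_subset ℝ _).trans hφ.2.2
  have hc := hφ.1.continuous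
  simp only [Pi.add_apply, add_mul, PiLp.add_apply]
  rw [integral_add (integrableOn_mul_test h₁.1 hd hs hsU) (integrableOn_mul_test h₂.1 hd hs hsU),
    integral_add (integrableOn_mul_test (LocallyIntegrableOn.coord h₁.2.1 i) hc hφ.2.1 hφ.2.2)
      (integrableOn_mul_test (LocallyIntegrableOn.coord h₂.2.1 i) hc hφ.2.1 hφ.2.2),
    h₁.2.2 φ hφ i, h₂.2.2 φ hφ i]
  ring

lemma HasWeakGrad.const_smul {w : EuclideanSpace ℝ (Fin n) → ℝ}
    {V : EuclideanSpace ℝ (Fin n) → EuclideanSpace ℝ (Fin n)}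
    (h : HasWeakGrad U w V) (M : ℝ) : HasWeakGrad U (M • w) (M • V) := by
  refine ⟨h.1.smul M, h.2.1.smul M, fun φ hφ i => ?_⟩
  simp only [Pi.smul_apply, PiLp.smul_apply, smul_eq_mul, mul_assoc, integral_const_mul]
  rw [h.2.2 φ hφ i]; ring

lemma HasWeakGrad.ae_eq (hU : IsOpen U) {w : EuclideanSpace ℝ (Fin n) → ℝ}
    {V₁ V₂ : EuclideanSpace ℝ (Fin n) → EuclideanSpace ℝ (Fin n)}
    (h₁ : HasWeakGrad U w V₁) (h₂ : HasWeakGrad U w V₂) : V₁ =ᵐ[volume.restrict U] V₂ := by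
  have hcoord : ∀ i : Fin n, ∀ᵐ x, x ∈ U → V₁ x i - V₂ x i = 0 := by
    intro i
    refine hU.ae_eq_zero_of_integral_contDiff_smul_eq_zero
      ((LocallyIntegrableOn.coord h₁.2.1 i).sub (LocallyIntegrableOn.coord h₂.2.1 i))
      fun φ hφ1 hφ2 hφ3 => ?_
    rw [← setIntegral_eq_integral_of_tsupport hφ3 _ (fun x hx => by
      rw [image_eq_zero_of_notMem_tsupport hx, zero_smul])]
    have hφ : φ ∈ testFunctions U := ⟨hφ1, hφ2, hφ3⟩
    have e := (h₁.2.2 φ hφ i).symm.trans (h₂.2.2 φ hφ i)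
    have e' := integral_sub
      (integrableOn_mul_test (LocallyIntegrableOn.coord h₁.2.1 i) hφ1.continuous hφ2 hφ3)
      (integrableOn_mul_test (LocallyIntegrableOn.coord h₂.2.1 i) hφ1.continuous hφ2 hφ3)
    rw [← sub_eq_zero.2 (neg_injective e), ← e']
    refine integral_congr_ae (ae_of_all _ fun x => ?_)
    simp only [smul_eq_mul]; ring
  rw [EventuallyEq, ae_restrict_iff' hU.measurableSet]
  filter_upwards [ae_all_iff.2 hcoord] with x hx hxU
  ext i
  exact sub_eq_zero.1 (hx i hxU)

/-- By uniqueness almost everywhere, the chosen representative in `weakGrad` may be replaced under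
integrals by any explicit weak gradient. -/
lemma HasWeakGrad.weakGrad_ae_eq (hU : IsOpen U) {w : EuclideanSpace ℝ (Fin n) → ℝ}
    {V : EuclideanSpace ℝ (Fin n) → EuclideanSpace ℝ (Fin n)}
    (h : HasWeakGrad U w V) : weakGrad U w =ᵐ[volume.restrict U] V := by
  have hex : ∃ V, HasWeakGrad U w V := ⟨V, h⟩
  rw [weakGrad, dif_pos hex]
  exact hex.choose_spec.ae_eq hU h

/-- A dominated limit of test functions with dominated convergent gradients lies in
`W^{1,1}_0(U)`, and its weak gradient is the limit of the gradients. -/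
lemma mem_W11Zero_of_dominated (hU : IsOpen U) {w : EuclideanSpace ℝ (Fin n) → ℝ}
    {V : EuclideanSpace ℝ (Fin n) → EuclideanSpace ℝ (Fin n)}
    {φ : ℕ → EuclideanSpace ℝ (Fin n) → ℝ} {G : EuclideanSpace ℝ (Fin n) → ℝ}
    (hφ : ∀ k, φ k ∈ testFunctions U) (hG : IntegrableOn G U)
    (hb : ∀ k, ∀ᵐ x ∂volume.restrict U, ‖φ k x‖ ≤ G x)
    (hb' : ∀ k, ∀ᵐ x ∂volume.restrict U, ‖gradient (φ k) x‖ ≤ G x)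
    (hlim : ∀ᵐ x ∂volume.restrict U, Tendsto (fun k => φ k x) atTop (𝓝 (w x)))
    (hlim' : ∀ᵐ x ∂volume.restrict U, Tendsto (fun k => gradient (φ k) x) atTop (𝓝 (V x))) :
    HasWeakGrad U w V ∧ w ∈ W11Zero U ∧ IntegrableOn V U := by
  have hm : ∀ k, AEStronglyMeasurable (φ k) (volume.restrict U) := fun k =>
    (hφ k).1.continuous.aestronglyMeasurable
  have hm' : ∀ k, AEStronglyMeasurable (gradient (φ k)) (volume.restrict U) := fun k =>
    (continuous_gradient ((hφ k).1.of_le (by simp))).aestronglyMeasurable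
  have hwm := aestronglyMeasurable_of_tendsto_ae atTop hm hlim
  have hVm := aestronglyMeasurable_of_tendsto_ae atTop hm' hlim'
  have hwb : ∀ᵐ x ∂volume.restrict U, ‖w x‖ ≤ G x := by
    filter_upwards [ae_all_iff.2 hb, hlim] with x hx hl
    exact le_of_tendsto' hl.norm hx
  have hVb : ∀ᵐ x ∂volume.restrict U, ‖V x‖ ≤ G x := by
    filter_upwards [ae_all_iff.2 hb', hlim'] with x hx hl
    exact le_of_tendsto' hl.norm hx
  have hwi : IntegrableOn w U := hG.mono' hwm hwb
  have hVi : IntegrableOn V U := hG.mono' hVm hVb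
  have hweak : HasWeakGrad U w V := by
    refine ⟨hwi.locallyIntegrableOn, hVi.locallyIntegrableOn, fun ψ hψ i => ?_⟩
    have hd : Continuous fun x => fderiv ℝ ψ x (EuclideanSpace.single i 1) :=
      (hψ.1.continuous_fderiv (by simp)).clm_apply continuous_const
    have hs : HasCompactSupport fun x => fderiv ℝ ψ x (EuclideanSpace.single i 1) :=
      hψ.2.1.fderiv_apply (𝕜 := ℝ) _
    obtain ⟨C₁, hC₁⟩ := hs.exists_bound_of_continuous hd
    obtain ⟨C₂, hC₂⟩ := hψ.2.1.exists_bound_of_continuous hψ.1.continuous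
    have t1 : Tendsto (fun k => ∫ x in U, φ k x * fderiv ℝ ψ x (EuclideanSpace.single i 1)) atTop
        (𝓝 (∫ x in U, w x * fderiv ℝ ψ x (EuclideanSpace.single i 1))) := by
      refine tendsto_integral_of_dominated_convergence (fun x => G x * C₁)
        (fun k => (hm k).mul hd.aestronglyMeasurable) (hG.mul_const C₁) (fun k => ?_) ?_
      · filter_upwards [hb k] with x hx
        rw [norm_mul]
        exact mul_le_mul hx (hC₁ x) (norm_nonneg _) ((norm_nonneg _).trans hx)
      · filter_upwards [hlim] with x hx
        exact hx.mul_const _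
    have t2 : Tendsto (fun k => -∫ x in U, gradient (φ k) x i * ψ x) atTop
        (𝓝 (-∫ x in U, V x i * ψ x)) := by
      refine Tendsto.neg ?_
      refine tendsto_integral_of_dominated_convergence (fun x => G x * C₂)
        (fun k => (((EuclideanSpace.proj (𝕜 := ℝ) i).continuous.comp_aestronglyMeasurable
          (hm' k))).mul hψ.1.continuous.aestronglyMeasurable) (hG.mul_const C₂) (fun k => ?_) ?_
      · filter_upwards [hb' k] with x hx
        rw [norm_mul]
        exact mul_le_mul ((PiLp.norm_apply_le _ i).trans hx) (hC₂ x) (norm_nonneg _)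
          ((norm_nonneg _).trans hx)
      · filter_upwards [hlim'] with x hx
        exact (((EuclideanSpace.proj (𝕜 := ℝ) i).continuous.tendsto _).comp hx).mul_const _
    refine tendsto_nhds_unique t1 (t2.congr fun k => ?_)
    exact ((hasWeakGrad_gradient ((hφ k).1.of_le (by simp))).2.2 ψ hψ i).symm
  refine ⟨hweak, ⟨⟨hwi, V, hweak, hVi⟩, φ, hφ, ?_⟩, hVi⟩
  have s1 := tendsto_lintegral_norm_of_dominated_convergence hm hG.2 hb hlim
  have s2 := tendsto_lintegral_norm_of_dominated_convergence hm' hG.2 hb' hlim'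
  have s3 := s1.add s2
  rw [add_zero] at s3
  refine s3.congr fun k => ?_
  simp only [ofReal_norm]
  congr 1
  refine lintegral_congr_ae ?_
  filter_upwards [hweak.weakGrad_ae_eq hU] with x hx
  rw [hx]

end WeakGradient

/-! ### Hölder regularity of truncated powers -/

section HolderRegularity

lemma norm_sub_le_mul_rpow {E : Type} [NormedAddCommGroup E] {K : Set E} {γ : ℝ}
    (hK : IsCompact K) (hγ1 : γ ≤ 1) :
    ∃ D, 0 ≤ D ∧ ∀ x ∈ K, ∀ y ∈ K, ‖x - y‖ ≤ D * ‖x - y‖ ^ γ := by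
  obtain ⟨R, hR⟩ := hK.isBounded.exists_norm_le
  refine ⟨(2 * |R|) ^ (1 - γ), by positivity, fun x hx y hy => ?_⟩
  rcases eq_or_lt_of_le (norm_nonneg (x - y)) with h | h
  · rw [← h]; positivity
  · have hle : ‖x - y‖ ≤ 2 * |R| :=
      (norm_sub_le x y).trans (by linarith [hR x hx, hR y hy, le_abs_self R])
    calc ‖x - y‖ = ‖x - y‖ ^ (1 - γ) * ‖x - y‖ ^ γ := by
          rw [← Real.rpow_add h, sub_add_cancel, Real.rpow_one]
      _ ≤ _ := by gcongr

variable {E : Type} [NormedAddCommGroup E] [NormedSpace ℝ E]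

/-- `f` is `C^m`, and its derivative of order `m` is `γ`-Hölder on `K`. -/
def HolderReg (K : Set E) (γ : ℝ) (m : ℕ) {F : Type} [NormedAddCommGroup F] [NormedSpace ℝ F]
    (f : E → F) : Prop :=
  ContDiff ℝ m f ∧ ∃ C, 0 ≤ C ∧ ∀ x ∈ K, ∀ y ∈ K,
    ‖iteratedFDeriv ℝ m f x - iteratedFDeriv ℝ m f y‖ ≤ C * ‖x - y‖ ^ γ

variable {K : Set E} {γ : ℝ} {m : ℕ}
  {F G H : Type} [NormedAddCommGroup F] [NormedSpace ℝ F] [NormedAddCommGroup G] [NormedSpace ℝ G]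
  [NormedAddCommGroup H] [NormedSpace ℝ H]

lemma holderReg_zero_iff {f : E → F} : HolderReg K γ 0 f ↔
    Continuous f ∧ ∃ C, 0 ≤ C ∧ ∀ x ∈ K, ∀ y ∈ K, ‖f x - f y‖ ≤ C * ‖x - y‖ ^ γ := by
  have : ∀ x y, ‖iteratedFDeriv ℝ 0 f x - iteratedFDeriv ℝ 0 f y‖ = ‖f x - f y‖ := fun x y => by
    rw [iteratedFDeriv_zero_eq_comp, Function.comp_apply, Function.comp_apply, ← map_sub,
      LinearIsometryEquiv.norm_map]
  simp only [HolderReg, this]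
  norm_num [contDiff_zero]

/-- Reduces the order by one at the price of a larger target space; the inductions on `m` below rest
on it. -/
lemma holderReg_succ_iff {f : E → F} :
    HolderReg K γ (m + 1) f ↔ Differentiable ℝ f ∧ HolderReg K γ m (fderiv ℝ f) := by
  have h1 : ∀ x y, ‖iteratedFDeriv ℝ (m + 1) f x - iteratedFDeriv ℝ (m + 1) f y‖ =
      ‖iteratedFDeriv ℝ m (fderiv ℝ f) x - iteratedFDeriv ℝ m (fderiv ℝ f) y‖ := fun x y => by
    rw [iteratedFDeriv_succ_eq_comp_right, iteratedFDeriv_succ_eq_comp_right,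
      Function.comp_apply, Function.comp_apply, ← dist_eq_norm, ← dist_eq_norm]
    exact LinearIsometryEquiv.dist_map _ _ _
  simp only [HolderReg, h1]
  have h2 : ContDiff ℝ ((m + 1 : ℕ) : WithTop ℕ∞) f ↔ Differentiable ℝ f ∧ ContDiff ℝ m (fderiv ℝ f) := by
    push_cast
    rw [contDiff_succ_iff_fderiv]
    simp
  rw [h2, and_assoc]

lemma lipschitz_of_contDiff (hK : IsCompact K) (hKc : Convex ℝ K) {f : E → F}
    (hf : ContDiff ℝ 1 f) : ∃ C, 0 ≤ C ∧ ∀ x ∈ K, ∀ y ∈ K, ‖f x - f y‖ ≤ C * ‖x - y‖ := by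
  obtain ⟨C, hC⟩ := hK.exists_bound_of_continuousOn (hf.continuous_fderiv (by simp)).continuousOn
  refine ⟨|C|, abs_nonneg C, fun x hx y hy => ?_⟩
  exact hKc.norm_image_sub_le_of_norm_fderiv_le (fun z _ => hf.differentiable (by simp) z)
    (fun z hz => (hC z hz).trans (le_abs_self C)) hy hx

lemma holderReg_of_contDiff (hK : IsCompact K) (hKc : Convex ℝ K) (hγ1 : γ ≤ 1) {f : E → F}
    (hf : ContDiff ℝ (m + 1) f) : HolderReg K γ m f := by
  refine ⟨hf.of_le (by exact_mod_cast Nat.le_succ m), ?_⟩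
  obtain ⟨C, hC0, hC⟩ := lipschitz_of_contDiff hK hKc
    (hf.iteratedFDeriv_right (i := m) (m := 1) (by rw [add_comm]))
  obtain ⟨D, hD0, hD⟩ := norm_sub_le_mul_rpow hK hγ1
  refine ⟨C * D, by positivity, fun x hx y hy => (hC x hx y hy).trans ?_⟩
  rw [mul_assoc]
  exact mul_le_mul_of_nonneg_left (hD x hx y hy) hC0

lemma HolderReg.add {f g : E → F} (hf : HolderReg K γ m f) (hg : HolderReg K γ m g) :
    HolderReg K γ m (fun x => f x + g x) := by
  obtain ⟨hf1, C, hC0, hC⟩ := hf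
  obtain ⟨hg1, D, hD0, hD⟩ := hg
  refine ⟨hf1.add hg1, C + D, by positivity, fun x hx y hy => ?_⟩
  have e : iteratedFDeriv ℝ m (fun x => f x + g x) =
      iteratedFDeriv ℝ m f + iteratedFDeriv ℝ m g := iteratedFDeriv_add hf1 hg1
  rw [e, Pi.add_apply, Pi.add_apply, add_sub_add_comm, add_mul]
  exact (norm_add_le _ _).trans (add_le_add (hC x hx y hy) (hD x hx y hy))

/-- A Leibniz rule by induction on `m`. General bilinear maps are needed because differentiation
replaces `B` by its operator-valued versions `precompR` and `precompL`. -/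
lemma HolderReg.bilinear (hK : IsCompact K) (hKc : Convex ℝ K) (hγ1 : γ ≤ 1)
    (B : F →L[ℝ] G →L[ℝ] H) {f : E → F} {g : E → G} (hf : HolderReg K γ m f)
    (hg : ContDiff ℝ (m + 1) g) : HolderReg K γ m (fun x => B (f x) (g x)) := by
  induction m generalizing F G H with
  | zero =>
    rw [holderReg_zero_iff] at hf ⊢
    obtain ⟨hfc, C, hC0, hC⟩ := hf
    have hg' : ContDiff ℝ 1 g := by simpa using hg
    have hgc := hg'.continuous
    refine ⟨(B.continuous.comp hfc).clm_apply hgc, ?_⟩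
    obtain ⟨L, hL0, hL⟩ := lipschitz_of_contDiff hK hKc hg'
    obtain ⟨D, hD0, hD⟩ := norm_sub_le_mul_rpow hK hγ1
    obtain ⟨Mf, hMf⟩ := hK.exists_bound_of_continuousOn hfc.continuousOn
    obtain ⟨Mg, hMg⟩ := hK.exists_bound_of_continuousOn hgc.continuousOn
    refine ⟨‖B‖ * C * |Mg| + ‖B‖ * |Mf| * (L * D), by positivity, fun x hx y hy => ?_⟩
    have e : B (f x) (g x) - B (f y) (g y) = B (f x - f y) (g x) + B (f y) (g x - g y) := by
      simp only [map_sub, sub_apply]; abel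
    rw [e, add_mul]
    refine (norm_add_le _ _).trans (add_le_add ?_ ?_)
    · refine (B.le_opNorm₂ _ _).trans ?_
      calc _ ≤ ‖B‖ * (C * ‖x - y‖ ^ γ) * |Mg| := by
            gcongr
            · exact hC x hx y hy
            · exact (hMg x hx).trans (le_abs_self _)
        _ = _ := by ring
    · refine (B.le_opNorm₂ _ _).trans ?_
      calc _ ≤ ‖B‖ * |Mf| * (L * (D * ‖x - y‖ ^ γ)) := by
            gcongr
            · exact (hMf y hy).trans (le_abs_self _)
            · exact (hL x hx y hy).trans (mul_le_mul_of_nonneg_left (hD x hx y hy) hL0)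
        _ = _ := by ring
  | succ m ih =>
    have hfm : HolderReg K γ m f := holderReg_of_contDiff hK hKc hγ1 (by exact_mod_cast hf.1)
    rw [holderReg_succ_iff] at hf ⊢
    have hg1 : ContDiff ℝ (m + 1) g := hg.of_le (by exact_mod_cast Nat.le_succ _)
    have hgd : Differentiable ℝ g := hg1.differentiable (by simp)
    have hdg : ContDiff ℝ (m + 1) (fderiv ℝ g) := hg.fderiv_right (by norm_cast)
    refine ⟨fun x => ((B.hasFDerivAt_of_bilinear (hf.1 x).hasFDerivAt
      (hgd x).hasFDerivAt)).differentiableAt, ?_⟩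
    have e : fderiv ℝ (fun x => B (f x) (g x)) = fun x => (B.precompR E) (f x) (fderiv ℝ g x) +
        (B.precompL E) (fderiv ℝ f x) (g x) := by
      ext1 x; exact B.fderiv_of_bilinear (hf.1 x) (hgd x)
    rw [e]
    exact (ih (B.precompR E) hfm hdg).add (ih (B.precompL E) hf.2 hg1)

lemma hasDerivAt_truncated_rpow {r : ℝ} (hr : 1 < r) (t : ℝ) :
    HasDerivAt (fun t : ℝ => max t 0 ^ r) (r * max t 0 ^ (r - 1)) t := by
  rcases lt_trichotomy t 0 with ht | rfl | ht
  · rw [max_eq_right ht.le, Real.zero_rpow (by linarith), mul_zero]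
    refine (hasDerivAt_const t (0 : ℝ)).congr_of_eventuallyEq ?_
    filter_upwards [gt_mem_nhds ht] with s hs
    rw [max_eq_right hs.le, Real.zero_rpow (by linarith)]
  · rw [max_self, Real.zero_rpow (by linarith), mul_zero, ← hasDerivWithinAt_univ, ← Iic_union_Ici (a := (0:ℝ))]
    refine HasDerivWithinAt.union ?_ ?_
    · refine (hasDerivWithinAt_const (0:ℝ) (Iic (0:ℝ)) (0 : ℝ)).congr (fun s hs => ?_) ?_
      · rw [max_eq_right hs, Real.zero_rpow (by linarith)]
      · rw [max_self, Real.zero_rpow (by linarith)]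
    · have := (Real.hasDerivAt_rpow_const (x := 0) (p := r) (Or.inr hr.le)).hasDerivWithinAt (s := Ici (0:ℝ))
      rw [Real.zero_rpow (by linarith), mul_zero] at this
      refine this.congr (fun s hs => ?_) ?_
      · rw [max_eq_left hs]
      · rw [max_self]
  · rw [max_eq_left ht.le]
    refine (Real.hasDerivAt_rpow_const (Or.inl ht.ne')).congr_of_eventuallyEq ?_
    filter_upwards [lt_mem_nhds ht] with s hs
    rw [max_eq_left hs.le]

lemma abs_rpow_sub_rpow_le {b s t : ℝ} (hb0 : 0 ≤ b) (hb1 : b ≤ 1) (hs : 0 ≤ s) (ht : 0 ≤ t) :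
    |s ^ b - t ^ b| ≤ |s - t| ^ b := by
  wlog hst : t ≤ s generalizing s t
  · rw [abs_sub_comm, abs_sub_comm s]; exact this ht hs (le_of_not_ge hst)
  rw [abs_of_nonneg (sub_nonneg.2 hst),
    abs_of_nonneg (sub_nonneg.2 (Real.rpow_le_rpow ht hst hb0))]
  have := Real.rpow_add_le_add_rpow (sub_nonneg.2 hst) ht hb0 hb1
  rw [sub_add_cancel] at this
  linarith

/-- By the chain rule the derivative of the power `m + 1 + b` is the power `m + b` times a multiple
of the derivative of `g`, which closes the induction. The base case is subadditivity of `t ^ b` for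
`b ≤ 1`. -/
lemma holderReg_truncated_rpow (hK : IsCompact K) (hKc : Convex ℝ K) {b : ℝ}
    (hb0 : 0 < b) (hb1 : b ≤ 1) (hγb : γ ≤ b) {g : E → ℝ} (hg : ContDiff ℝ (m + 1) g) :
    HolderReg K γ m (fun x => max (g x) 0 ^ (m + b)) := by
  induction m with
  | zero =>
    have hg' : ContDiff ℝ 1 g := by simpa using hg
    rw [holderReg_zero_iff]
    simp only [Nat.cast_zero, zero_add]
    refine ⟨(hg'.continuous.max continuous_const).rpow_const fun x => Or.inr hb0.le, ?_⟩
    obtain ⟨L, hL0, hL⟩ := lipschitz_of_contDiff hK hKc hg'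
    obtain ⟨R, hR⟩ := hK.isBounded.exists_norm_le
    refine ⟨L ^ b * (2 * |R|) ^ (b - γ), by positivity, fun x hx y hy => ?_⟩
    rw [Real.norm_eq_abs]
    have h1 := abs_rpow_sub_rpow_le hb0.le hb1 (le_max_right (g x) 0) (le_max_right (g y) 0)
    have h2 : |max (g x) 0 - max (g y) 0| ≤ L * ‖x - y‖ :=
      (abs_max_sub_max_le_abs _ _ _).trans (hL x hx y hy)
    have h3 : |max (g x) 0 - max (g y) 0| ^ b ≤ (L * ‖x - y‖) ^ b :=
      Real.rpow_le_rpow (abs_nonneg _) h2 hb0.le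
    refine h1.trans (h3.trans ?_)
    rw [Real.mul_rpow hL0 (norm_nonneg _), mul_assoc]
    refine mul_le_mul_of_nonneg_left ?_ (by positivity)
    rcases eq_or_lt_of_le (norm_nonneg (x - y)) with h | h
    · rw [← h, Real.zero_rpow hb0.ne']; positivity
    · have hle : ‖x - y‖ ≤ 2 * |R| :=
        (norm_sub_le x y).trans (by linarith [hR x hx, hR y hy, le_abs_self R])
      calc ‖x - y‖ ^ b = ‖x - y‖ ^ (b - γ) * ‖x - y‖ ^ γ := by
            rw [← Real.rpow_add h, sub_add_cancel]
        _ ≤ _ := by gcongr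
  | succ m ih =>
    have hg1 : ContDiff ℝ (m + 1) g := hg.of_le (by exact_mod_cast Nat.le_succ _)
    have hgd : Differentiable ℝ g := hg1.differentiable (by simp)
    have hdg : ContDiff ℝ (m + 1) (fderiv ℝ g) := hg.fderiv_right (by norm_cast)
    have hr : (1 : ℝ) < ((m + 1 : ℕ) : ℝ) + b := by
      push_cast; linarith [(Nat.cast_nonneg m : (0 : ℝ) ≤ m)]
    have hder : ∀ x, HasFDerivAt (fun x => max (g x) 0 ^ (((m + 1 : ℕ) : ℝ) + b))
        ((((m + 1 : ℕ) : ℝ) + b) • (max (g x) 0 ^ (m + b) • fderiv ℝ g x)) x := by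
      intro x
      have := (hasDerivAt_truncated_rpow hr (g x)).comp_hasFDerivAt x (hgd x).hasFDerivAt
      have hexp : ((m + 1 : ℕ) : ℝ) + b - 1 = m + b := by push_cast; ring
      rw [mul_smul, hexp] at this
      exact this
    rw [holderReg_succ_iff]
    refine ⟨fun x => (hder x).differentiableAt, ?_⟩
    have e : fderiv ℝ (fun x => max (g x) 0 ^ (((m + 1 : ℕ) : ℝ) + b)) = fun x =>
        ContinuousLinearMap.lsmul ℝ ℝ (max (g x) 0 ^ (m + b))
          ((((m + 1 : ℕ) : ℝ) + b) • fderiv ℝ g x) := by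
      ext1 x
      rw [(hder x).fderiv, ContinuousLinearMap.lsmul_apply, smul_comm]
    rw [e]
    exact (ih hg1).bilinear hK hKc (hγb.trans hb1) _ (hdg.const_smul _)

end HolderRegularity

/-! ### Geometry of the cube and Hölder classes on its closure -/

section Cube

variable {n : ℕ}

lemma isBounded_cube (n : ℕ) : Bornology.IsBounded (cube n) := by
  rw [isBounded_iff_forall_norm_le]
  refine ⟨∑ _i : Fin n, 1, fun x hx => ?_⟩
  have h : ‖x‖ ≤ ∑ i, ‖x i‖ := by
    conv_lhs => rw [← (EuclideanSpace.basisFun (Fin n) ℝ).sum_repr x]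
    refine (norm_sum_le _ _).trans (Finset.sum_le_sum fun i _ => ?_)
    rw [norm_smul, (EuclideanSpace.basisFun (Fin n) ℝ).norm_eq_one, mul_one]
    simp
  refine h.trans (Finset.sum_le_sum fun i _ => ?_)
  exact (abs_lt.2 (hx i)).le

lemma isCompact_closure_cube (n : ℕ) : IsCompact (closure (cube n)) :=
  (isBounded_cube n).isCompact_closure

lemma convex_cube (n : ℕ) : Convex ℝ (cube n) := by
  intro x hx y hy a b ha hb hab i
  have := convex_Ioo (-1 : ℝ) 1 (hx i) (hy i) ha hb hab
  simpa using this

lemma zero_mem_cube (n : ℕ) : (0 : EuclideanSpace ℝ (Fin n)) ∈ cube n := fun i => by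
  simp

lemma memHolder_of_holderReg {α : ℝ} (hα : 0 ≤ α) {f : EuclideanSpace ℝ (Fin n) → ℝ}
    (hf : HolderReg (closure (cube n)) (α - ⌊α⌋₊) ⌊α⌋₊ f) : MemHolder α f (closure (cube n)) := by
  obtain ⟨hc, C, hC0, hC⟩ := hf
  have hud : UniqueDiffOn ℝ (closure (cube n)) :=
    uniqueDiffOn_convex (convex_cube n).closure ⟨0, interior_mono subset_closure
      ((isOpen_cube n).interior_eq.symm ▸ zero_mem_cube n)⟩
  have hγ : 0 ≤ α - ⌊α⌋₊ := sub_nonneg.2 (Nat.floor_le hα)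
  refine ⟨hc.contDiffOn, C.toNNReal, fun x hx y hy => ?_⟩
  rw [iteratedFDerivWithin_eq_iteratedFDeriv hud hc.contDiffAt hx,
    iteratedFDerivWithin_eq_iteratedFDeriv hud hc.contDiffAt hy, edist_dist, edist_dist,
    dist_eq_norm, dist_eq_norm, Real.coe_toNNReal _ hγ,
    ENNReal.ofReal_rpow_of_nonneg (norm_nonneg _) hγ]
  change _ ≤ ENNReal.ofReal C * _
  rw [← ENNReal.ofReal_mul hC0]
  exact ENNReal.ofReal_le_ofReal (hC x hx y hy)

end Cube

/-! ### Integrability on the cube -/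

section CubeIntegrability

variable {n : ℕ}

/-- Fubini: the integrand is a product over all coordinates in which every coordinate other than `i`
and `j` carries the constant 1. -/
lemma integrableOn_cube_mul {i j : Fin n} (hij : i ≠ j) {f g : ℝ → ℝ}
    (hf : IntegrableOn f (Ioo (-1) 1)) (hg : IntegrableOn g (Ioo (-1) 1)) :
    IntegrableOn (fun x : EuclideanSpace ℝ (Fin n) => f (x i) * g (x j)) (cube n) := by
  classical
  set h : Fin n → ℝ → ℝ := fun k t => (if k = i then f t else 1) * (if k = j then g t else 1) with hh
  have h_int : ∀ k, Integrable (h k) (volume.restrict (Ioo (-1 : ℝ) 1)) := by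
    intro k
    by_cases hki : k = i
    · subst hki
      simpa [hh, hij, IntegrableOn] using hf
    · by_cases hkj : k = j
      · subst hkj
        simpa [hh, hki, IntegrableOn] using hg
      · simp [hh, hki, hkj]
  have hprod := Integrable.fintype_prod h_int
  have hpi : (volume : Measure (Fin n → ℝ)).restrict (univ.pi fun _ => Ioo (-1 : ℝ) 1) =
      Measure.pi fun _ => volume.restrict (Ioo (-1 : ℝ) 1) := Measure.restrict_pi_pi _ _
  rw [← hpi] at hprod
  have hmp := (PiLp.volume_preserving_ofLp (Fin n)).restrict_preimage
    (MeasurableSet.univ_pi fun _ : Fin n => measurableSet_Ioo (a := (-1 : ℝ)) (b := 1))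
  have hpre : (@WithLp.ofLp 2 (Fin n → ℝ)) ⁻¹' (univ.pi fun _ => Ioo (-1 : ℝ) 1) = cube n := by
    ext x; simp [cube]
  rw [hpre] at hmp
  have := hmp.integrable_comp_of_integrable hprod
  refine this.congr (ae_of_all _ fun x => ?_)
  simp only [hh, Function.comp_apply, Finset.prod_mul_distrib, Finset.prod_ite_eq',
    Finset.mem_univ, if_true]

lemma ae_cube_coord (i : Fin n) {p : ℝ → Prop} (hp : ∀ᵐ t : ℝ, t ∈ Ioo (-1 : ℝ) 1 → p t) :
    ∀ᵐ x ∂volume.restrict (cube n), p (x i) := by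
  rw [ae_restrict_iff' (isOpen_cube n).measurableSet]
  have h1 := (Measure.quasiMeasurePreserving_eval (fun _ : Fin n => (volume : Measure ℝ)) i).ae hp
  have h2 := (PiLp.volume_preserving_ofLp (Fin n)).quasiMeasurePreserving.ae h1
  filter_upwards [h2] with x hx hxc
  exact hx (hxc i)

lemma integrableOn_abs_rpow {s : ℝ} (hs : -1 < s) :
    IntegrableOn (fun t : ℝ => |t| ^ s) (Ioo (-1) 1) := by
  have h := intervalIntegral.intervalIntegrable_rpow' (a := 0) (b := 1) hs
  have h1 : IntervalIntegrable (fun t : ℝ => |t| ^ s) volume 0 1 := by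
    refine h.congr fun t ht => ?_
    rw [uIoc_of_le zero_le_one] at ht
    simp only [abs_of_pos ht.1]
  have h2 : IntervalIntegrable (fun t : ℝ => |t| ^ s) volume (-1) 0 := by
    have := (IntervalIntegrable.iff_comp_neg (f := fun t : ℝ => |t| ^ s) (a := 0) (b := 1)).1 h1
    simp only [abs_neg, neg_zero] at this
    exact this.symm
  have h3 := h2.trans h1
  rw [intervalIntegrable_iff_integrableOn_Ioo_of_le (by norm_num)] at h3
  exact h3

lemma integrableOn_cube_abs_rpow {i j : Fin n} (hij : i ≠ j) {s : ℝ} (hs : -1 < s) :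
    IntegrableOn (fun x : EuclideanSpace ℝ (Fin n) => |x j| ^ s) (cube n) := by
  have h1 : IntegrableOn (fun _ : ℝ => (1 : ℝ)) (Ioo (-1) 1) := integrableOn_const (by simp)
  simpa using integrableOn_cube_mul hij h1 (integrableOn_abs_rpow hs)

lemma ae_cube_coord_ne_zero (i : Fin n) :
    ∀ᵐ x : EuclideanSpace ℝ (Fin n) ∂volume.restrict (cube n), x i ≠ 0 := by
  refine ae_cube_coord i (p := fun t => t ≠ 0) ?_
  filter_upwards [Measure.ae_ne volume (0 : ℝ)] with t ht _
  exact ht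

instance isFiniteMeasure_cube (n : ℕ) : IsFiniteMeasure (volume.restrict (cube n)) :=
  isFiniteMeasure_restrict.2 (isBounded_cube n).measure_lt_top.ne

end CubeIntegrability

/-! ### The stream function of the Cantor function -/

namespace CantorProfile

variable {δ : ℝ} {N : ℕ} (P : CantorProfile δ N)

lemma continuous_F (hδ : δ < 1) : Continuous P.F := by
  have hD : 0 < 1 - δ := by linarith
  have hb : ∀ x y, |P.F y - P.F x| ≤ P.C * |y - x| ^ (1 - δ) := by
    intro x y
    rcases le_total x y with h | h
    · rw [abs_of_nonneg (sub_nonneg.2 (P.monotone_F h)), abs_of_nonneg (sub_nonneg.2 h)]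
      exact P.F_holder x y h
    · rw [abs_sub_comm, abs_sub_comm y, abs_of_nonneg (sub_nonneg.2 (P.monotone_F h)),
        abs_of_nonneg (sub_nonneg.2 h)]
      exact P.F_holder y x h
  rw [continuous_iff_continuousAt]
  intro x
  have ht : Tendsto (fun y => P.C * |y - x| ^ (1 - δ)) (𝓝 x) (𝓝 0) := by
    have hc : Continuous fun y => P.C * |y - x| ^ (1 - δ) :=
      continuous_const.mul (((continuous_id.sub continuous_const).abs).rpow_const
        fun _ => Or.inr hD.le)
    have := hc.tendsto x
    simpa [Real.zero_rpow hD.ne'] using this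
  rw [ContinuousAt, tendsto_iff_dist_tendsto_zero]
  refine squeeze_zero (fun _ => dist_nonneg) (fun y => ?_) ht
  rw [Real.dist_eq]
  exact hb x y

/-- A primitive of the Cantor function. -/
def prim (x : ℝ) : ℝ := ∫ t in (0 : ℝ)..x, P.F t

lemma hasDerivAt_prim (hδ : δ < 1) (x : ℝ) : HasDerivAt P.prim (P.F x) x :=
  (P.continuous_F hδ).integral_hasStrictDerivAt 0 x |>.hasDerivAt

/-- The mean of the Cantor function over `[x - r, x + r]`. -/
def stream (x r : ℝ) : ℝ := (P.prim (x + r) - P.prim (x - r)) / (2 * r)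

/-- The derivative of `stream` in `x`. -/
def streamX (x r : ℝ) : ℝ := (P.F (x + r) - P.F (x - r)) / (2 * r)

/-- The derivative of `stream` in `r`. -/
def streamR (x r : ℝ) : ℝ :=
  (P.F (x + r) + P.F (x - r)) / (2 * r) - (P.prim (x + r) - P.prim (x - r)) / (2 * r ^ 2)

lemma streamX_nonneg {r : ℝ} (hr : 0 ≤ r) (x : ℝ) : 0 ≤ P.streamX x r :=
  div_nonneg (sub_nonneg.2 (P.monotone_F (by linarith))) (by linarith)

/-- By the mean value theorem the mean of `F` is a value `F ξ` between the two endpoint values, so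
the radial derivative is bounded by the increment that defines `streamX`. -/
lemma abs_streamR_le (hδ : δ < 1) {r : ℝ} (hr : 0 < r) (x : ℝ) :
    |P.streamR x r| ≤ P.streamX x r := by
  obtain ⟨ξ, hξ, he⟩ := exists_hasDerivAt_eq_slope P.prim P.F (show x - r < x + r by linarith)
    (fun y _ => (P.hasDerivAt_prim hδ y).continuousAt.continuousWithinAt)
    (fun y _ => P.hasDerivAt_prim hδ y)
  have h1 := P.monotone_F hξ.1.le
  have h2 := P.monotone_F hξ.2.le
  have e : P.streamR x r = ((P.F (x + r) + P.F (x - r)) - 2 * P.F ξ) / (2 * r) := by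
    rw [streamR, he, show x + r - (x - r) = 2 * r by ring]
    field_simp
  rw [e, streamX, abs_div, abs_of_pos (show 0 < 2 * r by linarith)]
  gcongr
  rw [abs_le]
  constructor <;> linarith

/-- An increment of a `1 - δ` Hölder function over length `2 * r`, divided by `2 * r`. -/
lemma streamX_le (hδ0 : 0 ≤ δ) {r : ℝ} (hr : 0 < r) (x : ℝ) :
    P.streamX x r ≤ P.C * r ^ (-δ) := by
  have h2 : 0 < 2 * r := by linarith
  rw [streamX, div_le_iff₀ h2]
  refine (P.F_holder (x - r) (x + r) (by linarith)).trans ?_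
  rw [show x + r - (x - r) = 2 * r by ring, mul_assoc]
  refine mul_le_mul_of_nonneg_left ?_ P.C_nonneg
  rw [show 1 - δ = -δ + 1 by ring, Real.rpow_add h2, Real.rpow_one]
  refine mul_le_mul_of_nonneg_right ?_ h2.le
  exact Real.rpow_le_rpow_of_nonpos hr (by linarith) (by linarith)

lemma streamX_eq_zero {x r : ℝ} (hr0 : 0 ≤ r) (hr : r ≤ P.d x) : P.streamX x r = 0 := by
  rw [streamX, P.F_const x (x + r) (by rw [sub_add_cancel_left, abs_neg, abs_of_nonneg hr0]; exact hr),
    P.F_const x (x - r) (by rw [sub_sub_cancel, abs_of_nonneg hr0]; exact hr), sub_self, zero_div]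

lemma continuousOn_streamX (hδ : δ < 1) :
    ContinuousOn (fun p : ℝ × ℝ => P.streamX p.1 p.2) {p | 0 < p.2} := by
  have hF := P.continuous_F hδ
  refine ContinuousOn.div (by fun_prop) (by fun_prop) fun p hp => ?_
  have : 0 < p.2 := hp
  positivity

lemma continuousOn_streamR (hδ : δ < 1) :
    ContinuousOn (fun p : ℝ × ℝ => P.streamR p.1 p.2) {p | 0 < p.2} := by
  have hF := P.continuous_F hδ
  have hP : Continuous P.prim :=
    continuous_iff_continuousAt.2 fun x => (P.hasDerivAt_prim hδ x).continuousAt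
  refine ContinuousOn.sub (ContinuousOn.div (by fun_prop) (by fun_prop) fun p hp => ?_)
    (ContinuousOn.div (by fun_prop) (by fun_prop) fun p hp => ?_)
  all_goals
    have : 0 < p.2 := hp
    positivity

lemma measurable_streamX (hδ : δ < 1) : Measurable fun p : ℝ × ℝ => P.streamX p.1 p.2 := by
  have hF := (P.continuous_F hδ).measurable
  unfold streamX
  fun_prop

lemma measurable_streamR (hδ : δ < 1) : Measurable fun p : ℝ × ℝ => P.streamR p.1 p.2 := by
  have hF := (P.continuous_F hδ).measurable
  have hP : Measurable P.prim :=
    (continuous_iff_continuousAt.2 fun x => (P.hasDerivAt_prim hδ x).continuousAt).measurable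
  unfold streamR
  fun_prop

/-- Otherwise steps of length `2 * y` would not change `F`, and walking from `-1 / 2` to beyond `1 /
2` would carry the value 0 to a point where `F = 1`. -/
lemma exists_streamX_pos {y : ℝ} (hy0 : 0 < y) (hy1 : y ≤ 1 / 2) :
    ∃ x ∈ Ioo (-1 : ℝ) 1, 0 < P.streamX x y := by
  by_contra hcon
  push Not at hcon
  have hper : ∀ x ∈ Ioo (-1 : ℝ) 1, P.F (x + y) = P.F (x - y) := by
    intro x hx
    have h := le_antisymm (hcon x hx) (P.streamX_nonneg hy0.le x)
    rw [streamX, div_eq_zero_iff] at h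
    rcases h with h | h
    · linarith
    · linarith
  have hz : ∀ k : ℕ, -(1 / 2) + 2 * k * y < 1 / 2 + 2 * y → P.F (-(1 / 2) + 2 * k * y) = 0 := by
    intro k
    induction k with
    | zero => intro _; exact P.F_left _ (by simp)
    | succ k ih =>
      intro hk
      push_cast at hk ⊢
      have hk0 : (0 : ℝ) ≤ 2 * k * y := by positivity
      have h1 := ih (by linarith)
      have h2 := hper (-(1 / 2) + 2 * k * y + y) ⟨by linarith, by linarith⟩
      rw [add_sub_cancel_right, h1] at h2
      rw [← h2]
      congr 1
      ring
  have h2y : 0 < 2 * y := by linarith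
  have hk1 := Nat.le_ceil (1 / (2 * y))
  have hk2 := Nat.ceil_lt_add_one (show 0 ≤ 1 / (2 * y) by positivity)
  set k := ⌈1 / (2 * y)⌉₊
  rw [div_le_iff₀ h2y] at hk1
  rw [← sub_lt_iff_lt_add, lt_div_iff₀ h2y] at hk2
  have h3 := hz k (by linarith)
  rw [P.F_right _ (by linarith)] at h3
  norm_num at h3

/-- The smoothed stream function is differentiable. -/
lemma hasFDerivAt_stream {n : ℕ} (hδ : δ < 1) (i j : Fin n) {η : ℝ} (hη : 0 < η)
    (x : EuclideanSpace ℝ (Fin n)) :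
    HasFDerivAt (fun x : EuclideanSpace ℝ (Fin n) => P.stream (x i) √(x j ^ 2 + η ^ 2))
      (P.streamX (x i) √(x j ^ 2 + η ^ 2) • EuclideanSpace.proj (𝕜 := ℝ) i +
        (P.streamR (x i) √(x j ^ 2 + η ^ 2) * (x j / √(x j ^ 2 + η ^ 2))) •
          EuclideanSpace.proj (𝕜 := ℝ) j) x := by
  have hpos : 0 < x j ^ 2 + η ^ 2 := by positivity
  set r := √(x j ^ 2 + η ^ 2) with hr
  have hr0 : 0 < r := Real.sqrt_pos.2 hpos
  have hi : HasFDerivAt (fun x : EuclideanSpace ℝ (Fin n) => x i)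
      (EuclideanSpace.proj (𝕜 := ℝ) i : EuclideanSpace ℝ (Fin n) →L[ℝ] ℝ) x :=
    (EuclideanSpace.proj (𝕜 := ℝ) i).hasFDerivAt
  have hj : HasFDerivAt (fun x : EuclideanSpace ℝ (Fin n) => x j)
      (EuclideanSpace.proj (𝕜 := ℝ) j : EuclideanSpace ℝ (Fin n) →L[ℝ] ℝ) x :=
    (EuclideanSpace.proj (𝕜 := ℝ) j).hasFDerivAt
  have hrd : HasFDerivAt (fun x : EuclideanSpace ℝ (Fin n) => √(x j ^ 2 + η ^ 2))
      ((x j / r) • EuclideanSpace.proj (𝕜 := ℝ) j : EuclideanSpace ℝ (Fin n) →L[ℝ] ℝ) x := by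
    have h1 : HasDerivAt (fun t : ℝ => √(t ^ 2 + η ^ 2)) (x j / r) (x j) := by
      have h0 : HasDerivAt (fun t : ℝ => t ^ 2 + η ^ 2) (2 * x j) (x j) := by
        simpa using (hasDerivAt_pow 2 (x j)).add_const (η ^ 2)
      have := h0.sqrt hpos.ne'
      rwa [mul_div_mul_left _ _ two_ne_zero] at this
    have h2 := h1.comp_hasFDerivAt x hj
    exact h2
  have hp := (P.hasDerivAt_prim hδ (x i + r)).comp_hasFDerivAt x (hi.add hrd)
  have hm := (P.hasDerivAt_prim hδ (x i - r)).comp_hasFDerivAt x (hi.sub hrd)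
  have hnum := hp.sub hm
  have hden := (hrd.const_mul 2)
  have hinv : HasFDerivAt (fun x : EuclideanSpace ℝ (Fin n) => (2 * √(x j ^ 2 + η ^ 2))⁻¹)
      (-((2 * r) ^ 2)⁻¹ • (2 : ℝ) • (x j / r) • EuclideanSpace.proj (𝕜 := ℝ) j :
        EuclideanSpace ℝ (Fin n) →L[ℝ] ℝ) x :=
    (hasDerivAt_inv (show 2 * r ≠ 0 by positivity)).comp_hasFDerivAt x hden
  have := hnum.mul hinv
  refine (this.congr_fderiv ?_)
  ext v
  simp [streamX, streamR, ← hr]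
  field_simp
  ring

end CantorProfile

/-! ### The solenoidal field and its flux -/

namespace CantorProfile

variable {δ : ℝ} {N : ℕ} (P : CantorProfile δ N) {n : ℕ}

/-- Pairing of a vector `W` with the solenoidal field generated by the stream function, multiplied
by a cutoff `θ` in the remaining variables. -/
def flux (i j : Fin n) (θ : EuclideanSpace ℝ (Fin n) → ℝ) (x W : EuclideanSpace ℝ (Fin n)) : ℝ :=
  θ x * (P.streamX (x i) |x j| * W j - P.streamR (x i) |x j| * (x j / |x j|) * W i)

variable {i j : Fin n} {θ : EuclideanSpace ℝ (Fin n) → ℝ}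

lemma flux_add (x W₁ W₂ : EuclideanSpace ℝ (Fin n)) :
    P.flux i j θ x (W₁ + W₂) = P.flux i j θ x W₁ + P.flux i j θ x W₂ := by
  simp only [flux, PiLp.add_apply]; ring

lemma flux_smul (M : ℝ) (x W : EuclideanSpace ℝ (Fin n)) :
    P.flux i j θ x (M • W) = M * P.flux i j θ x W := by
  simp only [flux, PiLp.smul_apply, smul_eq_mul]; ring

lemma abs_flux_aux (hδ : δ < 1) {a r s W₁ W₂ w : ℝ} (hr : 0 < r) (hs : |s| ≤ 1)
    (h₁ : |W₁| ≤ w) (h₂ : |W₂| ≤ w) :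
    |P.streamX a r * W₁ - P.streamR a r * s * W₂| ≤ 2 * P.streamX a r * w := by
  have hX := P.streamX_nonneg hr.le a
  have hR := P.abs_streamR_le hδ hr a
  have hw : 0 ≤ w := (abs_nonneg _).trans h₁
  refine (abs_sub _ _).trans ?_
  rw [abs_mul, abs_mul, abs_mul, abs_of_nonneg hX]
  have e1 : P.streamX a r * |W₁| ≤ P.streamX a r * w := by gcongr
  have e2 : |P.streamR a r| * |s| * |W₂| ≤ P.streamX a r * 1 * w := by gcongr
  linarith

lemma abs_flux_le (hδ : δ < 1) (hθ0 : ∀ x, 0 ≤ θ x) (x W : EuclideanSpace ℝ (Fin n))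
    (hx : x j ≠ 0) :
    |P.flux i j θ x W| ≤ θ x * (2 * P.streamX (x i) |x j| * ‖W‖) := by
  rw [flux, abs_mul, abs_of_nonneg (hθ0 x)]
  refine mul_le_mul_of_nonneg_left ?_ (hθ0 x)
  refine P.abs_flux_aux hδ (abs_pos.2 hx) ?_ (PiLp.norm_apply_le W j) (PiLp.norm_apply_le W i)
  rw [abs_div, abs_abs, div_self (abs_ne_zero.2 hx)]

lemma aestronglyMeasurable_flux (hδ : δ < 1) (hθ : Continuous θ)
    {μ : Measure (EuclideanSpace ℝ (Fin n))} {W : EuclideanSpace ℝ (Fin n) → EuclideanSpace ℝ (Fin n)}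
    (hW : AEStronglyMeasurable W μ) :
    AEStronglyMeasurable (fun x => P.flux i j θ x (W x)) μ := by
  have hc : ∀ k, AEStronglyMeasurable (fun x => W x k) μ := fun k =>
    (EuclideanSpace.proj (𝕜 := ℝ) k).continuous.comp_aestronglyMeasurable hW
  have hi : ∀ k, Measurable fun x : EuclideanSpace ℝ (Fin n) => x k := fun k =>
    (EuclideanSpace.proj (𝕜 := ℝ) k).continuous.measurable
  have hX : Measurable fun x : EuclideanSpace ℝ (Fin n) => P.streamX (x i) |x j| :=
    (P.measurable_streamX hδ).comp ((hi i).prodMk (by have := hi j; fun_prop))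
  have hR : Measurable fun x : EuclideanSpace ℝ (Fin n) => P.streamR (x i) |x j| :=
    (P.measurable_streamR hδ).comp ((hi i).prodMk (by have := hi j; fun_prop))
  have hS : Measurable fun x : EuclideanSpace ℝ (Fin n) => x j / |x j| := by
    have := hi j; fun_prop
  exact hθ.aestronglyMeasurable.mul ((hX.aestronglyMeasurable.mul (hc j)).sub
    ((hR.mul hS).aestronglyMeasurable.mul (hc i)))

lemma integrableOn_flux (hij : i ≠ j) (hδ0 : 0 ≤ δ) (hδ : δ < 1) (hθ : Continuous θ)
    (hθ0 : ∀ x, 0 ≤ θ x) (hθ1 : ∀ x, θ x ≤ 1)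
    {W : EuclideanSpace ℝ (Fin n) → EuclideanSpace ℝ (Fin n)}
    (hW : AEStronglyMeasurable W (volume.restrict (cube n))) {B : ℝ}
    (hB : ∀ x ∈ cube n, ‖W x‖ ≤ B) :
    IntegrableOn (fun x => P.flux i j θ x (W x)) (cube n) := by
  have hI := (integrableOn_cube_abs_rpow hij (show -1 < -δ by linarith)).const_mul (2 * P.C * B)
  refine hI.mono' (P.aestronglyMeasurable_flux hδ hθ hW) ?_
  filter_upwards [ae_cube_coord_ne_zero j, ae_restrict_mem (isOpen_cube n).measurableSet]
    with x hx hxc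
  have hX := P.streamX_le hδ0 (abs_pos.2 hx) (x i)
  have hX0 := P.streamX_nonneg (abs_pos.2 hx).le (x i)
  have hC := P.C_nonneg
  rw [Real.norm_eq_abs]
  refine (P.abs_flux_le hδ hθ0 x (W x) hx).trans ?_
  calc _ ≤ 1 * (2 * (P.C * |x j| ^ (-δ)) * B) := by
        have := hθ0 x
        gcongr
        · exact hθ1 x
        · exact hB x hxc
    _ = _ := by ring

lemma fderiv_mul_partial {φ : EuclideanSpace ℝ (Fin n) → ℝ} (hφ : ContDiff ℝ ∞ φ)
    (hθ : ContDiff ℝ ∞ θ) (x v w : EuclideanSpace ℝ (Fin n)) (hv : fderiv ℝ θ x v = 0) :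
    fderiv ℝ (fun x => θ x * fderiv ℝ φ x w) x v = θ x * fderiv ℝ (fderiv ℝ φ) x v w := by
  have h1 : DifferentiableAt ℝ θ x := hθ.differentiable (by simp) x
  have h2 : DifferentiableAt ℝ (fderiv ℝ φ) x :=
    (hφ.fderiv_right (m := 1) (by norm_cast)).differentiable (by simp) x
  have h3 : HasFDerivAt (fun x => fderiv ℝ φ x w) ((fderiv ℝ (fderiv ℝ φ) x).flip w) x := by
    have := h2.hasFDerivAt.clm_apply (hasFDerivAt_const w x)
    simpa using this
  rw [(h1.hasFDerivAt.fun_mul h3).fderiv]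
  simp [hv]

/-- The smoothed field is solenoidal. -/
lemma integral_smoothed_flux_eq_zero (hδ : δ < 1) (hij : i ≠ j) {φ : EuclideanSpace ℝ (Fin n) → ℝ}
    (hφ : ContDiff ℝ ∞ φ) (hφs : HasCompactSupport φ) (hθ : ContDiff ℝ ∞ θ)
    (hθi : ∀ x, fderiv ℝ θ x (EuclideanSpace.single i 1) = 0)
    (hθj : ∀ x, fderiv ℝ θ x (EuclideanSpace.single j 1) = 0) {η : ℝ} (hη : 0 < η) :
    ∫ x : EuclideanSpace ℝ (Fin n), θ x * (P.streamX (x i) √(x j ^ 2 + η ^ 2) * gradient φ x j -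
      P.streamR (x i) √(x j ^ 2 + η ^ 2) * (x j / √(x j ^ 2 + η ^ 2)) * gradient φ x i) = 0 := by
  set ψ : EuclideanSpace ℝ (Fin n) → ℝ := fun x => P.stream (x i) √(x j ^ 2 + η ^ 2) with hψ
  have hψd := P.hasFDerivAt_stream hδ i j hη
  have hψdiff : Differentiable ℝ ψ := fun x => (hψd x).differentiableAt
  have hpos : ∀ x : EuclideanSpace ℝ (Fin n), 0 < √(x j ^ 2 + η ^ 2) := fun x =>
    Real.sqrt_pos.2 (by positivity)
  have hrc : Continuous fun x : EuclideanSpace ℝ (Fin n) => √(x j ^ 2 + η ^ 2) := by fun_prop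
  have hpc : Continuous fun x : EuclideanSpace ℝ (Fin n) => (x i, √(x j ^ 2 + η ^ 2)) := by fun_prop
  have hXc : Continuous fun x : EuclideanSpace ℝ (Fin n) => P.streamX (x i) √(x j ^ 2 + η ^ 2) :=
    (P.continuousOn_streamX hδ).comp_continuous hpc hpos
  have hRc : Continuous fun x : EuclideanSpace ℝ (Fin n) => P.streamR (x i) √(x j ^ 2 + η ^ 2) :=
    (P.continuousOn_streamR hδ).comp_continuous hpc hpos
  have hsc : Continuous fun x : EuclideanSpace ℝ (Fin n) => x j / √(x j ^ 2 + η ^ 2) :=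
    Continuous.div (by fun_prop) hrc fun x => (hpos x).ne'
  have hfi : ∀ x, fderiv ℝ ψ x (EuclideanSpace.single i 1) = P.streamX (x i) √(x j ^ 2 + η ^ 2) := by
    intro x
    rw [(hψd x).fderiv]
    simp [hij.symm]
  have hfj : ∀ x, fderiv ℝ ψ x (EuclideanSpace.single j 1) =
      P.streamR (x i) √(x j ^ 2 + η ^ 2) * (x j / √(x j ^ 2 + η ^ 2)) := by
    intro x
    rw [(hψd x).fderiv]
    simp [hij]
  have hgc : ∀ k, ContDiff ℝ 1 fun x => θ x * fderiv ℝ φ x (EuclideanSpace.single k 1) := fun k =>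
    (hθ.of_le (by simp)).mul ((hφ.fderiv_right (m := 1) (by norm_cast)).clm_apply contDiff_const)
  have hgs : ∀ k, HasCompactSupport fun x => θ x * fderiv ℝ φ x (EuclideanSpace.single k 1) :=
    fun k => (hφs.fderiv_apply (𝕜 := ℝ) _).mul_left
  have key : ∀ k (v : EuclideanSpace ℝ (Fin n)), (Continuous fun x => fderiv ℝ ψ x v) →
      Integrable (fun x => fderiv ℝ ψ x v * (θ x * fderiv ℝ φ x (EuclideanSpace.single k 1))) ∧
      ∫ x, ψ x * fderiv ℝ (fun x => θ x * fderiv ℝ φ x (EuclideanSpace.single k 1)) x v =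
        -∫ x, fderiv ℝ ψ x v * (θ x * fderiv ℝ φ x (EuclideanSpace.single k 1)) := by
    intro k v hc
    have hI := (hc.mul (hgc k).continuous).integrable_of_hasCompactSupport (μ := volume)
      ((hgs k).mul_left)
    refine ⟨hI, integral_mul_fderiv_eq_neg_fderiv_mul_of_integrable hI ?_ ?_
      (fun x _ => hψdiff x) (fun x _ => (hgc k).differentiable (by simp) x)⟩
    · exact (hψdiff.continuous.mul (((hgc k).continuous_fderiv (by simp)).clm_apply
        continuous_const)).integrable_of_hasCompactSupport
        (((hgs k).fderiv_apply (𝕜 := ℝ) v).mul_left)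
    · exact (hψdiff.continuous.mul (hgc k).continuous).integrable_of_hasCompactSupport
        ((hgs k).mul_left)
  obtain ⟨I1, k1⟩ := key j (EuclideanSpace.single i 1) (by simp only [hfi]; exact hXc)
  obtain ⟨I2, k2⟩ := key i (EuclideanSpace.single j 1) (by simp only [hfj]; exact hRc.mul hsc)
  simp only [fderiv_mul_partial hφ hθ _ _ _ (hθi _)] at k1
  simp only [fderiv_mul_partial hφ hθ _ _ _ (hθj _)] at k2
  -- After integration by parts both terms contain the same mixed second derivative of `φ` with the
  -- same weight, since `θ` does not depend on `x i` and `x j`.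
  have hsymm : ∀ x, fderiv ℝ (fderiv ℝ φ) x (EuclideanSpace.single i 1) (EuclideanSpace.single j 1) =
      fderiv ℝ (fderiv ℝ φ) x (EuclideanSpace.single j 1) (EuclideanSpace.single i 1) := fun x =>
    (hφ.contDiffAt.isSymmSndFDerivAt (by
      simp only [minSmoothness_of_isRCLikeNormedField]
      exact WithTop.coe_le_coe.2 le_top)) _ _
  simp only [hsymm] at k1
  rw [k2] at k1
  rw [← sub_eq_zero.2 (neg_injective k1).symm, ← integral_sub I1 I2]
  refine integral_congr_ae (ae_of_all _ fun x => ?_)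
  simp only [hfi, hfj, gradient_apply]
  ring

/-- The field is solenoidal on the cube. -/
lemma integral_flux_test (hδ0 : 0 ≤ δ) (hδ : δ < 1) (hij : i ≠ j) {φ : EuclideanSpace ℝ (Fin n) → ℝ}
    (hφ : φ ∈ testFunctions (cube n)) (hθ : ContDiff ℝ ∞ θ)
    (hθ0 : ∀ x, 0 ≤ θ x) (hθ1 : ∀ x, θ x ≤ 1)
    (hθi : ∀ x, fderiv ℝ θ x (EuclideanSpace.single i 1) = 0)
    (hθj : ∀ x, fderiv ℝ θ x (EuclideanSpace.single j 1) = 0) :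
    ∫ x in cube n, P.flux i j θ x (gradient φ x) = 0 := by
  obtain ⟨hφ1, hφ2, hφ3⟩ := hφ
  have hgrad := continuous_gradient (hφ1.of_le (by simp) : ContDiff ℝ 1 φ)
  have hgs : HasCompactSupport (gradient φ) :=
    (hφ2.fderiv (𝕜 := ℝ)).comp_left (g := (InnerProductSpace.toDual ℝ _).symm) (map_zero _)
  obtain ⟨B, hB⟩ := hgs.exists_bound_of_continuous hgrad
  have hg0 : ∀ x, x ∉ tsupport φ → gradient φ x = 0 := fun x hx => by
    rw [gradient, fderiv_eq_zero_of_notMem hx, map_zero]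
  -- Smoothed radii decreasing to `|x j|`. They stay above `|x j|`, so all smoothed fields share the
  -- majorant `|x j| ^ (-δ)`, integrable as `δ < 1`.
  set r : ℕ → EuclideanSpace ℝ (Fin n) → ℝ := fun k x => √(x j ^ 2 + (1 / ((k : ℝ) + 1)) ^ 2) with hr
  have hη : ∀ k : ℕ, (0 : ℝ) < 1 / ((k : ℝ) + 1) := fun k => by positivity
  have hrpos : ∀ k x, 0 < r k x := fun k x => Real.sqrt_pos.2 (by have := hη k; positivity)
  have hrle : ∀ k x, |x j| ≤ r k x := fun k x => by
    rw [← Real.sqrt_sq_eq_abs]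
    exact Real.sqrt_le_sqrt (by have := hη k; nlinarith)
  have hpc : ∀ k, Continuous fun x : EuclideanSpace ℝ (Fin n) => (x i, r k x) := fun k => by
    simp only [hr]; fun_prop
  have hzero : ∀ k, ∫ x in cube n, θ x * (P.streamX (x i) (r k x) * gradient φ x j -
      P.streamR (x i) (r k x) * (x j / r k x) * gradient φ x i) = 0 := by
    intro k
    rw [setIntegral_eq_integral_of_tsupport hφ3]
    · exact P.integral_smoothed_flux_eq_zero hδ hij hφ1 hφ2 hθ hθi hθj (hη k)
    · intro x hx
      simp [hg0 x hx]
  have hlim : Tendsto (fun k => ∫ x in cube n, θ x * (P.streamX (x i) (r k x) * gradient φ x j -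
      P.streamR (x i) (r k x) * (x j / r k x) * gradient φ x i)) atTop
      (𝓝 (∫ x in cube n, P.flux i j θ x (gradient φ x))) := by
    refine tendsto_integral_of_dominated_convergence (fun x => 2 * P.C * B * |x j| ^ (-δ))
      (fun k => ?_) ((integrableOn_cube_abs_rpow hij (show -1 < -δ by linarith)).const_mul _)
      (fun k => ?_) ?_
    · have hXc := (P.continuousOn_streamX hδ).comp_continuous (hpc k) (hrpos k)
      have hRc := (P.continuousOn_streamR hδ).comp_continuous (hpc k) (hrpos k)
      have hsc : Continuous fun x : EuclideanSpace ℝ (Fin n) => x j / r k x :=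
        Continuous.div (by fun_prop) ((hpc k).snd) fun x => (hrpos k x).ne'
      have hc : ∀ l, Continuous fun x => gradient φ x l := fun l =>
        (EuclideanSpace.proj (𝕜 := ℝ) l).continuous.comp hgrad
      exact (hθ.continuous.mul ((hXc.mul (hc j)).sub ((hRc.mul hsc).mul (hc i)))).aestronglyMeasurable
    · filter_upwards [ae_cube_coord_ne_zero j] with x hx
      have hX := P.streamX_le hδ0 (hrpos k x) (x i)
      have hX0 := P.streamX_nonneg (hrpos k x).le (x i)
      have hC := P.C_nonneg
      rw [Real.norm_eq_abs, abs_mul, abs_of_nonneg (hθ0 x)]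
      have h1 := P.abs_flux_aux (a := x i) (s := x j / r k x) hδ (hrpos k x)
        (by rw [abs_div, abs_of_pos (hrpos k x), div_le_one (hrpos k x)]; exact hrle k x)
        ((PiLp.norm_apply_le (gradient φ x) j).trans (hB x))
        ((PiLp.norm_apply_le (gradient φ x) i).trans (hB x))
      have hB0 : 0 ≤ B := (norm_nonneg _).trans (hB x)
      have h2 : r k x ^ (-δ) ≤ |x j| ^ (-δ) :=
        Real.rpow_le_rpow_of_nonpos (abs_pos.2 hx) (hrle k x) (by linarith)
      calc _ ≤ 1 * (2 * P.streamX (x i) (r k x) * B) := by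
            gcongr
            exact hθ1 x
        _ ≤ 1 * (2 * (P.C * |x j| ^ (-δ)) * B) := by
            gcongr
            exact hX.trans (mul_le_mul_of_nonneg_left h2 hC)
        _ = _ := by ring
    · filter_upwards [ae_cube_coord_ne_zero j] with x hx
      have hrlim : Tendsto (fun k => r k x) atTop (𝓝 |x j|) := by
        have h1 := (tendsto_one_div_add_atTop_nhds_zero_nat (𝕜 := ℝ)).pow 2
        have h2 := (h1.const_add (x j ^ 2)).sqrt
        simpa [hr, Real.sqrt_sq_eq_abs] using h2
      have hpair : Tendsto (fun k => (x i, r k x)) atTop (𝓝 (x i, |x j|)) :=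
        tendsto_const_nhds.prodMk_nhds hrlim
      have hopen : {p : ℝ × ℝ | 0 < p.2} ∈ 𝓝 (x i, |x j|) :=
        (isOpen_lt continuous_const continuous_snd).mem_nhds (abs_pos.2 hx)
      have hXl := ((P.continuousOn_streamX hδ).continuousAt hopen).tendsto.comp hpair
      have hRl := ((P.continuousOn_streamR hδ).continuousAt hopen).tendsto.comp hpair
      have hsl : Tendsto (fun k => x j / r k x) atTop (𝓝 (x j / |x j|)) :=
        tendsto_const_nhds.div hrlim (abs_ne_zero.2 hx)
      exact ((hXl.mul_const _).sub ((hRl.mul hsl).mul_const _)).const_mul _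
  simp only [hzero] at hlim
  exact (tendsto_nhds_unique hlim tendsto_const_nhds)

end CantorProfile

/-! ### A smooth step and cutoffs in the transversal variables -/

/-- A smooth monotone step from `-1/2` to `1/2`. -/
def step (t : ℝ) : ℝ := Real.smoothTransition (t + 1 / 2) - 1 / 2

lemma contDiff_step : ContDiff ℝ ∞ step :=
  (Real.smoothTransition.contDiff.comp (contDiff_id.add contDiff_const)).sub contDiff_const

lemma monotone_step : Monotone step := fun s t hst =>
  sub_le_sub_right (Real.smoothTransition.monotone (by linarith)) _

lemma step_of_le {t : ℝ} (ht : t ≤ -(1 / 2)) : step t = -(1 / 2) := by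
  rw [step, Real.smoothTransition.zero_of_nonpos (by linarith)]; norm_num

lemma step_of_ge {t : ℝ} (ht : 1 / 2 ≤ t) : step t = 1 / 2 := by
  rw [step, Real.smoothTransition.one_of_one_le (by linarith)]; norm_num

lemma abs_step_le (t : ℝ) : |step t| ≤ 1 / 2 := by
  have h1 := Real.smoothTransition.le_one (t + 1 / 2)
  have h2 := Real.smoothTransition.nonneg (t + 1 / 2)
  rw [step, abs_le]; constructor <;> linarith

lemma deriv_step_eq_zero {t : ℝ} (ht : 1 / 2 < |t|) : deriv step t = 0 := by
  rcases lt_abs.1 ht with h | h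
  · have : step =ᶠ[𝓝 t] fun _ => 1 / 2 := by
      filter_upwards [lt_mem_nhds h] with s hs using step_of_ge hs.le
    rw [this.deriv_eq, deriv_const]
  · have : step =ᶠ[𝓝 t] fun _ => -(1 / 2) := by
      filter_upwards [gt_mem_nhds (show t < -(1 / 2) by linarith)] with s hs using step_of_le hs.le
    rw [this.deriv_eq, deriv_const]

lemma exists_bound_deriv_step : ∃ B, 0 < B ∧ ∀ t, |deriv step t| ≤ B := by
  have hc : Continuous (deriv step) := contDiff_step.continuous_deriv (by simp)
  obtain ⟨B, hB⟩ := (isCompact_Icc (a := -(1 : ℝ)) (b := 1)).exists_bound_of_continuousOn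
    hc.continuousOn
  refine ⟨|B| + 1, by positivity, fun t => ?_⟩
  by_cases ht : t ∈ Icc (-(1 : ℝ)) 1
  · exact (hB t ht).trans (by linarith [le_abs_self B])
  · rw [mem_Icc, ← abs_le, not_le] at ht
    rw [deriv_step_eq_zero (by linarith)]
    simp only [abs_zero]; positivity

lemma hasDerivAt_step (t : ℝ) : HasDerivAt step (deriv step t) t :=
  (contDiff_step.differentiable (by simp) t).hasDerivAt

section Cutoff

variable {n : ℕ}

/-- The orthogonal projection that removes the coordinates `i` and `j`. -/
def transversal (i j : Fin n) : EuclideanSpace ℝ (Fin n) →L[ℝ] EuclideanSpace ℝ (Fin n) :=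
  ContinuousLinearMap.id ℝ _ -
    (EuclideanSpace.proj (𝕜 := ℝ) i).smulRight (EuclideanSpace.single i (1 : ℝ)) -
    (EuclideanSpace.proj (𝕜 := ℝ) j).smulRight (EuclideanSpace.single j (1 : ℝ))

variable {i j : Fin n}

lemma transversal_single_left (hij : i ≠ j) : transversal i j (EuclideanSpace.single i 1) = 0 := by
  simp [transversal, hij.symm]

lemma transversal_single_right (hij : i ≠ j) : transversal i j (EuclideanSpace.single j 1) = 0 := by
  simp [transversal, hij]

lemma transversal_apply {k : Fin n} (hi : k ≠ i) (hj : k ≠ j) (x : EuclideanSpace ℝ (Fin n)) :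
    transversal i j x k = x k := by
  simp [transversal, hi, hj]

/-- A bump function in the variables other than `i` and `j`. -/
def cutoff (i j : Fin n) (b : ContDiffBump (0 : EuclideanSpace ℝ (Fin n)))
    (x : EuclideanSpace ℝ (Fin n)) : ℝ := b (transversal i j x)

variable (b : ContDiffBump (0 : EuclideanSpace ℝ (Fin n)))

lemma contDiff_cutoff : ContDiff ℝ ∞ (cutoff i j b) := b.contDiff.comp (transversal i j).contDiff

lemma cutoff_nonneg (x : EuclideanSpace ℝ (Fin n)) : 0 ≤ cutoff i j b x := b.nonneg

lemma cutoff_le_one (x : EuclideanSpace ℝ (Fin n)) : cutoff i j b x ≤ 1 := b.le_one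

lemma norm_lt_of_cutoff_ne_zero {x : EuclideanSpace ℝ (Fin n)} (hx : cutoff i j b x ≠ 0) :
    ‖transversal i j x‖ < b.rOut := by
  by_contra h
  exact hx (b.zero_of_le_dist (by rw [dist_zero_right]; exact not_lt.1 h))

lemma cutoff_eq_one {x : EuclideanSpace ℝ (Fin n)} (hx : ‖transversal i j x‖ ≤ b.rIn) :
    cutoff i j b x = 1 :=
  b.one_of_mem_closedBall (by rw [mem_closedBall_zero_iff]; exact hx)

lemma cutoff_eventually_eq_one {x : EuclideanSpace ℝ (Fin n)} (hx : ‖transversal i j x‖ < b.rIn) :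
    ∀ᶠ y in 𝓝 x, cutoff i j b y = 1 := by
  have hc : Continuous fun y => ‖transversal i j y‖ := (transversal i j).continuous.norm
  filter_upwards [hc.continuousAt.eventually (gt_mem_nhds hx)] with y hy
  exact cutoff_eq_one b hy.le

lemma fderiv_cutoff_apply_eq_zero {v : EuclideanSpace ℝ (Fin n)} (hv : transversal i j v = 0)
    (x : EuclideanSpace ℝ (Fin n)) : fderiv ℝ (cutoff i j b) x v = 0 := by
  have hb : DifferentiableAt ℝ b (transversal i j x) :=
    (b.contDiff (n := 1)).differentiable (by simp) _
  have h := hb.hasFDerivAt.comp x (transversal i j).hasFDerivAt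
  have h' : fderiv ℝ (cutoff i j b) x = _ := h.fderiv
  rw [h']
  simp [hv]

lemma exists_bound_fderiv_cutoff : ∃ B, 0 < B ∧ ∀ x, ‖fderiv ℝ (cutoff i j b) x‖ ≤ B := by
  have hc : Continuous (fderiv ℝ b) := (b.contDiff (n := 1)).continuous_fderiv (by simp)
  obtain ⟨B, hB⟩ := (b.hasCompactSupport.fderiv (𝕜 := ℝ)).exists_bound_of_continuous hc
  refine ⟨|B| * ‖transversal i j‖ + 1, by positivity, fun x => ?_⟩
  have hb : DifferentiableAt ℝ b (transversal i j x) :=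
    (b.contDiff (n := 1)).differentiable (by simp) _
  have h := hb.hasFDerivAt.comp x (transversal i j).hasFDerivAt
  have h' : fderiv ℝ (cutoff i j b) x = _ := h.fderiv
  rw [h']
  refine (ContinuousLinearMap.opNorm_comp_le _ _).trans ?_
  have := (hB (transversal i j x)).trans (le_abs_self B)
  have h2 := mul_le_mul_of_nonneg_right this (norm_nonneg (transversal i j))
  linarith

/-- The cutoff of the solenoidal field. -/
def innerBump (n : ℕ) : ContDiffBump (0 : EuclideanSpace ℝ (Fin n)) :=
  ⟨1 / 8, 1 / 4, by norm_num, by norm_num⟩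

/-- The cutoff of the coefficient. -/
def middleBump (n : ℕ) : ContDiffBump (0 : EuclideanSpace ℝ (Fin n)) :=
  ⟨1 / 4, 1 / 2, by norm_num, by norm_num⟩

/-- The cutoff of the competitor. -/
def outerBump (n : ℕ) : ContDiffBump (0 : EuclideanSpace ℝ (Fin n)) :=
  ⟨1 / 2, 3 / 4, by norm_num, by norm_num⟩

end Cutoff

lemma norm_proj_le {n : ℕ} (k : Fin n) :
    ‖(EuclideanSpace.proj (𝕜 := ℝ) k : EuclideanSpace ℝ (Fin n) →L[ℝ] ℝ)‖ ≤ 1 :=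
  ContinuousLinearMap.opNorm_le_bound _ zero_le_one fun x => by
    rw [one_mul]; exact PiLp.norm_apply_le x k

namespace CantorProfile

variable {δ : ℝ} {N : ℕ} (P : CantorProfile δ N) {n : ℕ} (i j : Fin n)

/-! ### The competitor and its approximations -/

/-- The smooth reference step across the hyperplane `x j = 0`. -/
def base (x : EuclideanSpace ℝ (Fin n)) : ℝ := step (x j / P.c)

/-- The singular step minus the reference step, cut off in the transversal variables. -/
def ubar (x : EuclideanSpace ℝ (Fin n)) : ℝ :=
  cutoff i j (outerBump n) x * (step (x j / P.d (x i)) - P.base j x)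

/-- Smooth approximations of `ubar`. -/
def ubarApprox (k : ℕ) (x : EuclideanSpace ℝ (Fin n)) : ℝ :=
  cutoff i j (outerBump n) x * (step (x j / P.dk k (x i)) - P.base j x)

variable {i j}

lemma contDiff_base : ContDiff ℝ ∞ (P.base j : EuclideanSpace ℝ (Fin n) → ℝ) :=
  contDiff_step.comp ((EuclideanSpace.proj (𝕜 := ℝ) j).contDiff.div_const _)

lemma hasFDerivAt_base (x : EuclideanSpace ℝ (Fin n)) : HasFDerivAt (P.base j)
    ((deriv step (x j / P.c) / P.c) • (EuclideanSpace.proj (𝕜 := ℝ) j :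
      EuclideanSpace ℝ (Fin n) →L[ℝ] ℝ)) x := by
  have hj : HasFDerivAt (fun x : EuclideanSpace ℝ (Fin n) => x j)
      (EuclideanSpace.proj (𝕜 := ℝ) j : EuclideanSpace ℝ (Fin n) →L[ℝ] ℝ) x :=
    (EuclideanSpace.proj (𝕜 := ℝ) j).hasFDerivAt
  have h1 : HasDerivAt (fun t : ℝ => step (t / P.c)) (deriv step (x j / P.c) / P.c) (x j) := by
    have := (hasDerivAt_step (x j / P.c)).comp (x j) ((hasDerivAt_id (x j)).div_const P.c)
    simpa [div_eq_mul_inv, Function.comp_def] using this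
  have h2 := h1.comp_hasFDerivAt x hj
  exact h2

lemma exists_bound_fderiv_base :
    ∃ B, 0 < B ∧ ∀ x : EuclideanSpace ℝ (Fin n), ‖fderiv ℝ (P.base j) x‖ ≤ B := by
  obtain ⟨B, hB0, hB⟩ := exists_bound_deriv_step
  have hc := P.c_pos
  refine ⟨B / P.c, by positivity, fun x => ?_⟩
  rw [(P.hasFDerivAt_base x).fderiv, norm_smul, Real.norm_eq_abs, abs_div, abs_of_pos hc]
  calc _ ≤ B / P.c * 1 := by
        gcongr
        · exact hB _
        · exact norm_proj_le j
    _ = _ := mul_one _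

lemma abs_base_le (x : EuclideanSpace ℝ (Fin n)) : |P.base j x| ≤ 1 / 2 := abs_step_le _

lemma abs_ubar_le (x : EuclideanSpace ℝ (Fin n)) : |P.ubar i j x| ≤ 1 := by
  rw [ubar, abs_mul, abs_of_nonneg (cutoff_nonneg _ x)]
  have h1 := cutoff_le_one (i := i) (j := j) (outerBump n) x
  have h2 := (abs_sub (step (x j / P.d (x i))) (P.base j x)).trans
    (add_le_add (abs_step_le _) (P.abs_base_le x))
  have := mul_le_mul h1 h2 (abs_nonneg _) zero_le_one
  linarith

lemma abs_ubarApprox_le (k : ℕ) (x : EuclideanSpace ℝ (Fin n)) : |P.ubarApprox i j k x| ≤ 1 := by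
  rw [ubarApprox, abs_mul, abs_of_nonneg (cutoff_nonneg _ x)]
  have h1 := cutoff_le_one (i := i) (j := j) (outerBump n) x
  have h2 := (abs_sub (step (x j / P.dk k (x i))) (P.base j x)).trans
    (add_le_add (abs_step_le _) (P.abs_base_le x))
  have := mul_le_mul h1 h2 (abs_nonneg _) zero_le_one
  linarith

lemma contDiff_stepApprox (k : ℕ) : ContDiff ℝ ∞
    (fun x : EuclideanSpace ℝ (Fin n) => step (x j / P.dk k (x i))) :=
  contDiff_step.comp ((EuclideanSpace.proj (𝕜 := ℝ) j).contDiff.div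
    ((P.dk_contDiff k).comp (EuclideanSpace.proj (𝕜 := ℝ) i).contDiff)
    fun x => (P.dk_pos k (x i)).ne')

lemma contDiff_ubarApprox (k : ℕ) :
    ContDiff ℝ ∞ (P.ubarApprox i j k : EuclideanSpace ℝ (Fin n) → ℝ) :=
  (contDiff_cutoff _).mul ((P.contDiff_stepApprox k).sub P.contDiff_base)

/-- Three mechanisms confine the support: for `|x i| ≥ ρ` and for `|x j| > 3 / 4` the two steps
coincide, and the outer cutoff handles the remaining coordinates. -/
lemma ubarApprox_mem (k : ℕ) : P.ubarApprox i j k ∈ testFunctions (cube n) := by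
  set R := max (3 / 4 : ℝ) P.ρ with hR
  have hR1 : R < 1 := max_lt (by norm_num) P.ρ_lt
  set S : Set (EuclideanSpace ℝ (Fin n)) := {x | ∀ l, |x l| ≤ R} with hS
  have hclosed : IsClosed S := by
    have : S = ⋂ l, (fun x : EuclideanSpace ℝ (Fin n) => |x l|) ⁻¹' Iic R := by
      ext x; simp [hS]
    rw [this]
    exact isClosed_iInter fun l => isClosed_Iic.preimage (by fun_prop)
  have hScube : S ⊆ cube n := fun x hx l => abs_lt.1 ((hx l).trans_lt hR1)
  have hSc : IsCompact S := Metric.isCompact_of_isClosed_isBounded hclosed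
    ((isBounded_cube n).subset hScube)
  have hsupp : Function.support (P.ubarApprox i j k) ⊆ S := by
    intro x hx
    rw [Function.mem_support, ubarApprox, mul_ne_zero_iff] at hx
    obtain ⟨h1, h2⟩ := hx
    have hnorm := norm_lt_of_cutoff_ne_zero _ h1
    intro l
    by_cases hli : l = i
    · subst hli
      by_contra hlt
      refine h2 ?_
      rw [P.dk_far k (x l) ((le_max_right _ _).trans (not_le.1 hlt).le), base, sub_self]
    by_cases hlj : l = j
    · subst hlj
      by_contra hlt
      have hbig : 3 / 4 < |x l| := (le_max_left _ _).trans_lt (not_le.1 hlt)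
      refine h2 ?_
      have hc := P.c_pos
      have hcle := P.c_le
      have hd := P.dk_pos k (x i)
      have hdle := P.dk_le k (x i)
      rw [base]
      rcases lt_abs.1 hbig with h | h
      · rw [step_of_ge (by rw [le_div_iff₀ hd]; linarith),
          step_of_ge (by rw [le_div_iff₀ hc]; linarith), sub_self]
      · rw [step_of_le (by rw [div_le_iff₀ hd]; linarith),
          step_of_le (by rw [div_le_iff₀ hc]; linarith), sub_self]
    · rw [← transversal_apply hli hlj x]
      exact ((PiLp.norm_apply_le _ l).trans hnorm.le).trans (le_max_left _ _)
  exact ⟨P.contDiff_ubarApprox k, HasCompactSupport.of_support_subset_isCompact hSc hsupp,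
    (closure_minimal hsupp hclosed).trans hScube⟩

/-- The gradient of the approximations is controlled by the reciprocal distance to the contact
set. -/
lemma exists_bound_gradient_ubarApprox : ∃ K, 1 ≤ K ∧
    ∀ k, ∀ x ∈ cube n, 0 < max (P.d (x i)) |x j| →
      ‖gradient (P.ubarApprox i j k) x‖ ≤ K / max (P.d (x i)) |x j| := by
  obtain ⟨B, hB0, hB⟩ := exists_bound_deriv_step
  obtain ⟨B₁, hB₁0, hB₁⟩ := P.exists_bound_fderiv_base (n := n) (j := j)
  obtain ⟨B₂, hB₂0, hB₂⟩ := exists_bound_fderiv_cutoff (i := i) (j := j) (outerBump n)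
  have hC := P.C_nonneg
  refine ⟨B * (1 + P.C) + B₁ + B₂ + 1, by nlinarith, fun k x hx hm => ?_⟩
  set m := max (P.d (x i)) |x j| with hmdef
  have hm1 : m ≤ 1 := max_le (((P.d_le_dk k _).trans (P.dk_le k _)).trans (by linarith [P.c_le]))
    (abs_lt.2 (hx j)).le
  set D := P.dk k (x i) with hD
  have hD0 : 0 < D := P.dk_pos k (x i)
  have hj : HasFDerivAt (fun x : EuclideanSpace ℝ (Fin n) => x j)
      (EuclideanSpace.proj (𝕜 := ℝ) j : EuclideanSpace ℝ (Fin n) →L[ℝ] ℝ) x :=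
    (EuclideanSpace.proj (𝕜 := ℝ) j).hasFDerivAt
  have hi : HasFDerivAt (fun x : EuclideanSpace ℝ (Fin n) => x i)
      (EuclideanSpace.proj (𝕜 := ℝ) i : EuclideanSpace ℝ (Fin n) →L[ℝ] ℝ) x :=
    (EuclideanSpace.proj (𝕜 := ℝ) i).hasFDerivAt
  have hdk : HasDerivAt (P.dk k) (deriv (P.dk k) (x i)) (x i) :=
    ((P.dk_contDiff k).differentiable (by simp) _).hasDerivAt
  have hdkx := hdk.comp_hasFDerivAt x hi
  have hinv : HasFDerivAt (fun x : EuclideanSpace ℝ (Fin n) => (P.dk k (x i))⁻¹)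
      (-(D ^ 2)⁻¹ • deriv (P.dk k) (x i) • (EuclideanSpace.proj (𝕜 := ℝ) i :
        EuclideanSpace ℝ (Fin n) →L[ℝ] ℝ)) x :=
    (hasDerivAt_inv hD0.ne').comp_hasFDerivAt x hdkx
  have hquot := hj.mul hinv
  have hstep := (hasDerivAt_step (x j / D)).comp_hasFDerivAt x
    (f := fun x : EuclideanSpace ℝ (Fin n) => x j * (P.dk k (x i))⁻¹) hquot
  have hcut : HasFDerivAt (cutoff i j (outerBump n)) (fderiv ℝ (cutoff i j (outerBump n)) x) x :=
    ((contDiff_cutoff (i := i) (j := j) (outerBump n)).differentiable (by simp) x).hasFDerivAt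
  have hbase := ((P.contDiff_base (j := j) (n := n)).differentiable (by simp) x).hasFDerivAt
  have htot := (hcut.mul (hstep.sub hbase)).fderiv
  have hfun : P.ubarApprox i j k = (cutoff i j (outerBump n)) *
      ((step ∘ fun x : EuclideanSpace ℝ (Fin n) => x j * (P.dk k (x i))⁻¹) - P.base j) := by
    ext y; simp [ubarApprox, div_eq_mul_inv]
  have hmain : ‖deriv step (x j / D) • (x j • (-(D ^ 2)⁻¹ • deriv (P.dk k) (x i) •
      (EuclideanSpace.proj (𝕜 := ℝ) i : EuclideanSpace ℝ (Fin n) →L[ℝ] ℝ)) +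
      D⁻¹ • (EuclideanSpace.proj (𝕜 := ℝ) j : EuclideanSpace ℝ (Fin n) →L[ℝ] ℝ))‖ ≤
      B * (1 + P.C) / m := by
    -- The step is flat for `|x j| > D / 2`. Elsewhere both `d` and `|x j|` are at most `D`, so `1 /
    -- D ≤ 1 / m`; this makes the bound uniform in `k`.
    by_cases hfar : 1 / 2 < |x j / D|
    · rw [deriv_step_eq_zero hfar, zero_smul, norm_zero]; positivity
    · rw [not_lt, abs_div, abs_of_pos hD0, div_le_iff₀ hD0] at hfar
      have hmD : m ≤ D := max_le (P.d_le_dk k _) (by linarith)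
      have h1 : ‖x j • (-(D ^ 2)⁻¹ • deriv (P.dk k) (x i) •
          (EuclideanSpace.proj (𝕜 := ℝ) i : EuclideanSpace ℝ (Fin n) →L[ℝ] ℝ))‖ ≤ P.C / D := by
        rw [norm_smul, norm_smul, norm_smul, norm_neg, norm_inv, norm_pow, Real.norm_eq_abs,
          Real.norm_eq_abs, Real.norm_eq_abs, abs_of_pos hD0]
        calc _ ≤ D * ((D ^ 2)⁻¹ * (P.C * 1)) := by
              gcongr
              · linarith
              · exact P.dk_deriv k _
              · exact norm_proj_le i
          _ = _ := by field_simp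
      have h2 : ‖D⁻¹ • (EuclideanSpace.proj (𝕜 := ℝ) j : EuclideanSpace ℝ (Fin n) →L[ℝ] ℝ)‖ ≤
          1 / D := by
        rw [norm_smul, norm_inv, Real.norm_eq_abs, abs_of_pos hD0, one_div]
        exact mul_le_of_le_one_right (by positivity) (norm_proj_le j)
      rw [norm_smul, Real.norm_eq_abs]
      calc _ ≤ B * (P.C / D + 1 / D) := by
            gcongr
            · exact hB _
            · exact (norm_add_le _ _).trans (add_le_add h1 h2)
        _ = B * (1 + P.C) / D := by ring
        _ ≤ _ := by gcongr
  rw [norm_gradient, hfun, htot]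
  have hcut1 := cutoff_le_one (i := i) (j := j) (outerBump n) x
  have hcut0 := cutoff_nonneg (i := i) (j := j) (outerBump n) x
  have hval : ‖((step ∘ fun x : EuclideanSpace ℝ (Fin n) => x j * (P.dk k (x i))⁻¹) - P.base j) x‖
      ≤ 1 := by
    refine (abs_sub _ _).trans ?_
    exact (add_le_add (abs_step_le _) (P.abs_base_le (j := j) x)).trans (by norm_num)
  refine (norm_add_le _ _).trans ?_
  rw [norm_smul, norm_smul, Real.norm_eq_abs, abs_of_nonneg hcut0]
  calc _ ≤ 1 * (B * (1 + P.C) / m + B₁) + 1 * B₂ := by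
        gcongr
        · refine (norm_sub_le _ _).trans (add_le_add hmain (hB₁ x))
        · exact hB₂ x
    _ ≤ _ := by
        rw [le_div_iff₀ hm]
        have e : (1 * (B * (1 + P.C) / m + B₁) + 1 * B₂) * m = B * (1 + P.C) + (B₁ + B₂) * m := by
          field_simp
          ring
        rw [e]
        nlinarith

end CantorProfile

namespace CantorProfile

variable {δ : ℝ} {N : ℕ} (P : CantorProfile δ N) {n : ℕ}

/-! ### The coefficient -/

/-- The coefficient: it vanishes where the competitor varies and is comparable with `|x j| ^ r`
where the solenoidal field lives. -/
def coeff (i j : Fin n) (r : ℝ) (x : EuclideanSpace ℝ (Fin n)) : ℝ :=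
  (max (x j - P.d (x i) / 2) 0 ^ r + max (-x j - P.d (x i) / 2) 0 ^ r) * cutoff i j (middleBump n) x

variable {i j : Fin n} {r : ℝ}

lemma continuous_d : Continuous P.d := P.d_contDiff.continuous

lemma coeff_nonneg (x : EuclideanSpace ℝ (Fin n)) : 0 ≤ P.coeff i j r x :=
  mul_nonneg (add_nonneg (Real.rpow_nonneg (le_max_right _ _) _)
    (Real.rpow_nonneg (le_max_right _ _) _)) (cutoff_nonneg _ x)

lemma continuous_coeff (hr : 0 ≤ r) :
    Continuous (P.coeff i j r : EuclideanSpace ℝ (Fin n) → ℝ) := by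
  have hd := P.continuous_d
  refine Continuous.mul (Continuous.add ?_ ?_) (contDiff_cutoff _).continuous
  · exact Continuous.rpow_const (by fun_prop) fun _ => Or.inr hr
  · exact Continuous.rpow_const (by fun_prop) fun _ => Or.inr hr

lemma coeff_le_two (hr : 0 ≤ r) {x : EuclideanSpace ℝ (Fin n)} (hx : x ∈ cube n) :
    P.coeff i j r x ≤ 2 := by
  have hxj := hx j
  have hd := P.d_nonneg (x i)
  have h1 : max (x j - P.d (x i) / 2) 0 ^ r ≤ 1 :=
    Real.rpow_le_one (le_max_right _ _) (max_le (by linarith [hxj.2]) zero_le_one) hr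
  have h2 : max (-x j - P.d (x i) / 2) 0 ^ r ≤ 1 :=
    Real.rpow_le_one (le_max_right _ _) (max_le (by linarith [hxj.1]) zero_le_one) hr
  have h3 := cutoff_le_one (i := i) (j := j) (middleBump n) x
  have h4 := cutoff_nonneg (i := i) (j := j) (middleBump n) x
  rw [coeff]
  calc _ ≤ (1 + 1) * (1 : ℝ) := by gcongr
    _ = 2 := by norm_num

/-- The truncated powers need `d` of class `C^(⌊α⌋₊ + 1)`, hence the choice of `N`, and a fractional
part `b` at least `α - ⌊α⌋₊`. -/
lemma memHolder_coeff {α : ℝ} (hα : 0 ≤ α) (hN : N = ⌊α⌋₊ + 1) {b : ℝ} (hb0 : 0 < b) (hb1 : b ≤ 1)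
    (hαb : α ≤ ⌊α⌋₊ + b) :
    MemHolder α (P.coeff i j (⌊α⌋₊ + b)) (closure (cube n)) := by
  refine memHolder_of_holderReg hα ?_
  have hK := isCompact_closure_cube n
  have hKc := (convex_cube n).closure
  have hd : ContDiff ℝ (⌊α⌋₊ + 1) P.d := by
    refine P.d_contDiff.of_le ?_
    rw [hN]
    push_cast
    exact le_rfl
  have hdx : ContDiff ℝ (⌊α⌋₊ + 1) fun x : EuclideanSpace ℝ (Fin n) => P.d (x i) / 2 :=
    (hd.comp (EuclideanSpace.proj (𝕜 := ℝ) i).contDiff).div_const _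
  have hj : ContDiff ℝ (⌊α⌋₊ + 1) fun x : EuclideanSpace ℝ (Fin n) => x j :=
    (EuclideanSpace.proj (𝕜 := ℝ) j).contDiff
  have hγ : α - ⌊α⌋₊ ≤ b := by linarith
  have h1 := holderReg_truncated_rpow hK hKc hb0 hb1 hγ (hj.sub hdx)
  have h2 := holderReg_truncated_rpow hK hKc hb0 hb1 hγ (hj.neg.sub hdx)
  have h3 := (h1.add h2).bilinear hK hKc (hγ.trans hb1) (ContinuousLinearMap.mul ℝ ℝ)
    ((contDiff_cutoff (i := i) (j := j) (middleBump n)).of_le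
      (m := ⌊α⌋₊ + 1) (by exact_mod_cast le_top))
  exact h3

/-- On the support of the inner cutoff the middle one is 1, and `|x j| - d / 2 ≥ |x j| / 2` once `d
≤ |x j|`. -/
lemma le_coeff (hr : 0 ≤ r) {x : EuclideanSpace ℝ (Fin n)}
    (hθ : cutoff i j (innerBump n) x ≠ 0) (hd : P.d (x i) ≤ |x j|) :
    (|x j| / 2) ^ r ≤ P.coeff i j r x := by
  have h1 : cutoff i j (middleBump n) x = 1 :=
    cutoff_eq_one _ (norm_lt_of_cutoff_ne_zero _ hθ).le
  rw [coeff, h1, mul_one]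
  have hp : ∀ t : ℝ, 0 ≤ max t 0 ^ r := fun t => Real.rpow_nonneg (le_max_right _ _) _
  rcases le_total 0 (x j) with h | h
  · rw [abs_of_nonneg h] at hd ⊢
    have : (x j / 2) ^ r ≤ max (x j - P.d (x i) / 2) 0 ^ r :=
      Real.rpow_le_rpow (by linarith) (le_trans (by linarith) (le_max_left _ _)) hr
    linarith [hp (-x j - P.d (x i) / 2)]
  · rw [abs_of_nonpos h] at hd ⊢
    have : (-x j / 2) ^ r ≤ max (-x j - P.d (x i) / 2) 0 ^ r :=
      Real.rpow_le_rpow (by linarith) (le_trans (by linarith) (le_max_left _ _)) hr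
    linarith [hp (x j - P.d (x i) / 2)]

/-- Where the coefficient is positive, the full competitor is locally constant. -/
lemma gradient_ubar_of_coeff_ne_zero (hr : 0 < r) {x : EuclideanSpace ℝ (Fin n)}
    (hd : 0 < P.d (x i)) (hx : P.coeff i j r x ≠ 0) :
    gradient (P.ubar i j) x = -gradient (P.base j) x := by
  rw [coeff, mul_ne_zero_iff] at hx
  obtain ⟨hx1, hx2⟩ := hx
  have hcut := cutoff_eventually_eq_one (i := i) (j := j) (outerBump n) (x := x)
    (norm_lt_of_cutoff_ne_zero _ hx2)
  have hdc := P.continuous_d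
  have hdpos : ∀ᶠ y : EuclideanSpace ℝ (Fin n) in 𝓝 x, 0 < P.d (y i) := by
    have hc : Continuous fun y : EuclideanSpace ℝ (Fin n) => P.d (y i) := by fun_prop
    exact hc.continuousAt.eventually (lt_mem_nhds hd)
  have hcase : 0 < x j - P.d (x i) / 2 ∨ 0 < -x j - P.d (x i) / 2 := by
    by_contra hcon
    push Not at hcon
    apply hx1
    rw [max_eq_right hcon.1, max_eq_right hcon.2, Real.zero_rpow hr.ne', add_zero]
  obtain ⟨s, hs⟩ : ∃ s : ℝ, ∀ᶠ y : EuclideanSpace ℝ (Fin n) in 𝓝 x, step (y j / P.d (y i)) = s := by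
    rcases hcase with h | h
    · refine ⟨1 / 2, ?_⟩
      have hc : Continuous fun y : EuclideanSpace ℝ (Fin n) => y j - P.d (y i) / 2 := by fun_prop
      filter_upwards [hdpos, hc.continuousAt.eventually (lt_mem_nhds h)] with y h1 h2
      exact step_of_ge (by rw [le_div_iff₀ h1]; linarith)
    · refine ⟨-(1 / 2), ?_⟩
      have hc : Continuous fun y : EuclideanSpace ℝ (Fin n) => -y j - P.d (y i) / 2 := by fun_prop
      filter_upwards [hdpos, hc.continuousAt.eventually (lt_mem_nhds h)] with y h1 h2
      exact step_of_le (by rw [div_le_iff₀ h1]; linarith)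
  have heq : P.ubar i j =ᶠ[𝓝 x] fun y => s - P.base j y := by
    filter_upwards [hcut, hs] with y h1 h2
    rw [ubar, h1, h2, one_mul]
  rw [gradient, heq.fderiv_eq, fderiv_const_sub, map_neg, gradient]

/-- Near points with positive distance to the contact set the approximations are eventually
stationary. -/
lemma ubarApprox_eventually_eq {x : EuclideanSpace ℝ (Fin n)} (hd : 0 < P.d (x i)) :
    ∀ᶠ k in atTop, P.ubarApprox i j k x = P.ubar i j x ∧
      gradient (P.ubarApprox i j k) x = gradient (P.ubar i j) x := by
  obtain ⟨K, hK⟩ := P.dk_eventually (x i) hd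
  filter_upwards [eventually_ge_atTop K] with k hk
  have hc : Continuous fun y : EuclideanSpace ℝ (Fin n) => y i := by fun_prop
  have heq : P.ubarApprox i j k =ᶠ[𝓝 x] P.ubar i j := by
    filter_upwards [hc.continuousAt.eventually (hK k hk)] with y hy
    rw [ubarApprox, ubar, hy]
  refine ⟨heq.eq_of_nhds, ?_⟩
  rw [gradient, heq.fderiv_eq, gradient]

/-! ### Integrability -/

/-- The Cantor set is null: `d ^ (-ε)` is infinite where `d = 0`, yet integrable. -/
lemma ae_d_pos : ∀ᵐ t : ℝ, t ∈ Ioo (-1 : ℝ) 1 → 0 < P.d t := by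
  have hm : Measurable fun t => ENNReal.ofReal (P.d t) ^ (-P.ε) :=
    (P.continuous_d.measurable.ennreal_ofReal).pow_const _
  have h := ae_lt_top hm P.d_integrable.ne
  rw [ae_restrict_iff' measurableSet_Ioo] at h
  filter_upwards [h] with t ht hmem
  by_contra hle
  have h0 : ENNReal.ofReal (P.d t) = 0 := ENNReal.ofReal_eq_zero.2 (not_lt.1 hle)
  have := ht hmem
  rw [h0, ENNReal.zero_rpow_of_neg (by linarith [P.ε_pos])] at this
  exact lt_irrefl _ this

lemma ae_cube_d_pos (i : Fin n) :
    ∀ᵐ x : EuclideanSpace ℝ (Fin n) ∂volume.restrict (cube n), 0 < P.d (x i) :=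
  ae_cube_coord i (p := fun t => 0 < P.d t) P.ae_d_pos

lemma integrableOn_d_rpow : IntegrableOn (fun t => P.d t ^ (-P.ε)) (Ioo (-1) 1) := by
  refine ⟨(P.continuous_d.measurable.pow_const _).aestronglyMeasurable, ?_⟩
  rw [hasFiniteIntegral_iff_ofReal (ae_of_all _ fun t => Real.rpow_nonneg (P.d_nonneg t) _)]
  refine lt_of_le_of_lt (lintegral_mono_ae ?_) P.d_integrable
  rw [ae_restrict_iff' measurableSet_Ioo]
  filter_upwards [P.ae_d_pos] with t ht hmem
  rw [ENNReal.ofReal_rpow_of_pos (ht hmem)]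

/-- The integrable majorant of powers of the gradient. -/
def majorant (i j : Fin n) (s : ℝ) (x : EuclideanSpace ℝ (Fin n)) : ℝ :=
  P.d (x i) ^ (-P.ε) * |x j| ^ (-(1 - s))

lemma integrableOn_majorant (hij : i ≠ j) {s : ℝ} (hs : 0 < s) :
    IntegrableOn (P.majorant i j s : EuclideanSpace ℝ (Fin n) → ℝ) (cube n) :=
  integrableOn_cube_mul hij P.integrableOn_d_rpow (integrableOn_abs_rpow (by linarith))

lemma majorant_nonneg {s : ℝ} (x : EuclideanSpace ℝ (Fin n)) : 0 ≤ P.majorant i j s x :=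
  mul_nonneg (Real.rpow_nonneg (P.d_nonneg _) _) (Real.rpow_nonneg (abs_nonneg _) _)

lemma d_le_one (t : ℝ) : P.d t ≤ 1 := ((P.d_le_dk 0 t).trans (P.dk_le 0 t)).trans
  (by linarith [P.c_le])

lemma max_le_one {x : EuclideanSpace ℝ (Fin n)} (hx : x ∈ cube n) :
    max (P.d (x i)) |x j| ≤ 1 := max_le (P.d_le_one _) (abs_lt.2 (hx j)).le

/-- Split the exponent as `1 + s = 2 * s + (1 - s)`: the small part `2 * s ≤ ε` is charged to `d`,
the rest, below 1, to `|x j|`. Both factors are then integrable in separate variables. -/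
lemma inv_max_rpow_le_majorant {s p : ℝ} (hs0 : 0 < s) (hsε : 2 * s ≤ P.ε) (hs1 : s ≤ 1 / 2)
    (hp : p ≤ 1 + s) {x : EuclideanSpace ℝ (Fin n)} (hx : x ∈ cube n) (hd : 0 < P.d (x i))
    (hxj : x j ≠ 0) : (1 / max (P.d (x i)) |x j|) ^ p ≤ P.majorant i j s x := by
  set m := max (P.d (x i)) |x j| with hm
  have hm0 : 0 < m := lt_max_of_lt_left hd
  have hm1 : m ≤ 1 := P.max_le_one hx
  have hj0 : 0 < |x j| := abs_pos.2 hxj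
  rw [one_div, Real.inv_rpow hm0.le, ← Real.rpow_neg hm0.le]
  calc m ^ (-p) ≤ m ^ (-(1 + s)) := Real.rpow_le_rpow_of_exponent_ge hm0 hm1 (by linarith)
    _ = m ^ (-(2 * s)) * m ^ (-(1 - s)) := by rw [← Real.rpow_add hm0]; congr 1; ring
    _ ≤ P.d (x i) ^ (-(2 * s)) * |x j| ^ (-(1 - s)) := by
        exact mul_le_mul (Real.rpow_le_rpow_of_nonpos hd (le_max_left _ _) (by linarith))
          (Real.rpow_le_rpow_of_nonpos hj0 (le_max_right _ _) (by linarith))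
          (Real.rpow_nonneg hm0.le _) (Real.rpow_nonneg hd.le _)
    _ ≤ _ := by
        rw [majorant]
        gcongr ?_ * _
        exact Real.rpow_le_rpow_of_exponent_ge hd (P.d_le_one _) (by linarith)

/-- The singular competitor lies in `W^{1,1}_0`, with its pointwise gradient as weak gradient. -/
lemma ubar_smul_mem (hij : i ≠ j) (M : ℝ) :
    HasWeakGrad (cube n) (M • P.ubar i j) (M • gradient (P.ubar i j)) ∧
      M • P.ubar i j ∈ W11Zero (cube n) ∧ IntegrableOn (M • gradient (P.ubar i j)) (cube n) := by
  obtain ⟨K, hK1, hK⟩ := P.exists_bound_gradient_ubarApprox (i := i) (j := j) (n := n)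
  set s := min P.ε 1 / 2 with hs
  have hε := P.ε_pos
  have hs0 : 0 < s := by have : 0 < min P.ε 1 := lt_min hε one_pos; linarith
  have hsε : 2 * s ≤ P.ε := by have := min_le_left P.ε 1; linarith
  have hs1 : s ≤ 1 / 2 := by have := min_le_right P.ε 1; linarith
  have hgr : ∀ k x, gradient (M • P.ubarApprox i j k) x = M • gradient (P.ubarApprox i j k) x := by
    intro k x
    rw [gradient, fderiv_const_smul ((P.contDiff_ubarApprox k).differentiable (by simp) x),
      map_smulₛₗ, gradient]
    simp
  refine mem_W11Zero_of_dominated (isOpen_cube n) (φ := fun k => M • P.ubarApprox i j k)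
    (G := fun x => |M| * (K * P.majorant i j s x)) (fun k => ?_)
    (((P.integrableOn_majorant hij hs0).const_mul K).const_mul |M|) (fun k => ?_) (fun k => ?_) ?_ ?_
  · obtain ⟨h1, h2, h3⟩ := P.ubarApprox_mem (i := i) (j := j) k
    exact ⟨contDiff_const.smul h1, h2.smul_left,
      (closure_mono (Function.support_const_smul_subset M _)).trans h3⟩
  · filter_upwards [P.ae_cube_d_pos i, ae_cube_coord_ne_zero j,
      ae_restrict_mem (isOpen_cube n).measurableSet] with x hd hj hx
    -- Exponent 0 says that the majorant is at least 1, so it also dominates the function values.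
    have h1 := P.inv_max_rpow_le_majorant hs0 hsε hs1 (p := 0) (by linarith) hx hd hj
    rw [Real.rpow_zero] at h1
    rw [Pi.smul_apply, norm_smul, Real.norm_eq_abs, Real.norm_eq_abs]
    refine mul_le_mul_of_nonneg_left ((P.abs_ubarApprox_le k x).trans ?_) (abs_nonneg M)
    nlinarith
  · filter_upwards [P.ae_cube_d_pos i, ae_cube_coord_ne_zero j,
      ae_restrict_mem (isOpen_cube n).measurableSet] with x hd hj hx
    have h1 := P.inv_max_rpow_le_majorant hs0 hsε hs1 (p := 1) (by linarith) hx hd hj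
    rw [Real.rpow_one] at h1
    rw [hgr, norm_smul, Real.norm_eq_abs]
    refine mul_le_mul_of_nonneg_left ((hK k x hx (lt_max_of_lt_left hd)).trans ?_) (abs_nonneg M)
    rw [div_eq_mul_one_div]
    exact mul_le_mul_of_nonneg_left h1 (by linarith)
  · filter_upwards [P.ae_cube_d_pos i] with x hd
    refine Tendsto.const_smul (tendsto_const_nhds.congr' ?_) M
    filter_upwards [P.ubarApprox_eventually_eq (j := j) hd] with k hk using hk.1.symm
  · filter_upwards [P.ae_cube_d_pos i] with x hd
    simp only [hgr]
    refine Tendsto.const_smul (tendsto_const_nhds.congr' ?_) M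
    filter_upwards [P.ubarApprox_eventually_eq (j := j) hd] with k hk using hk.2.symm

/-- The bound is uniform along the approximations, and at such a point their gradients eventually
equal that of `ubar`. -/
lemma exists_bound_gradient_ubar : ∃ K, 1 ≤ K ∧
    ∀ x ∈ cube n, 0 < P.d (x i) →
      ‖gradient (P.ubar i j) x‖ ≤ K * (1 / max (P.d (x i)) |x j|) := by
  obtain ⟨K, hK1, hK⟩ := P.exists_bound_gradient_ubarApprox (i := i) (j := j) (n := n)
  refine ⟨K, hK1, fun x hx hd => ?_⟩
  obtain ⟨k, hk⟩ := (P.ubarApprox_eventually_eq (j := j) hd).exists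
  rw [← hk.2, ← div_eq_mul_one_div]
  exact hK k x hx (lt_max_of_lt_left hd)

end CantorProfile

lemma exists_bound_gradient_test {n : ℕ} {U : Set (EuclideanSpace ℝ (Fin n))}
    {φ : EuclideanSpace ℝ (Fin n) → ℝ} (hφ : φ ∈ testFunctions U) :
    ∃ B, ∀ x, ‖gradient φ x‖ ≤ B := by
  obtain ⟨B, hB⟩ := (hφ.2.1.fderiv (𝕜 := ℝ)).exists_bound_of_continuous
    (hφ.1.continuous_fderiv (by simp))
  exact ⟨B, fun x => by rw [norm_gradient]; exact hB x⟩

namespace CantorProfile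

variable {δ : ℝ} {N : ℕ} (P : CantorProfile δ N) {n : ℕ} {i j : Fin n} {r q : ℝ}

/-! ### The flux functional -/

/-- The flux is bounded by `streamX`, which vanishes where `F` is constant on `[x i - |x j|, x i +
|x j|]`. -/
lemma d_lt_of_flux_ne_zero (hδ : δ < 1) {x W : EuclideanSpace ℝ (Fin n)} (hxj : x j ≠ 0)
    (hf : P.flux i j (cutoff i j (innerBump n)) x W ≠ 0) :
    cutoff i j (innerBump n) x ≠ 0 ∧ P.d (x i) < |x j| := by
  constructor
  · intro h0
    exact hf (by rw [flux, h0, zero_mul])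
  · by_contra hle
    have h1 := P.abs_flux_le (i := i) hδ (cutoff_nonneg (i := i) (j := j) (innerBump n)) x W hxj
    rw [P.streamX_eq_zero (abs_nonneg _) (not_lt.1 hle), mul_zero, zero_mul, mul_zero] at h1
    exact hf (abs_nonpos_iff.1 h1)

lemma coeff_ne_zero_of_flux_ne_zero (hδ : δ < 1) (hr : 0 ≤ r) {x W : EuclideanSpace ℝ (Fin n)}
    (hxj : x j ≠ 0) (hf : P.flux i j (cutoff i j (innerBump n)) x W ≠ 0) :
    P.coeff i j r x ≠ 0 := by
  obtain ⟨h1, h2⟩ := P.d_lt_of_flux_ne_zero hδ hxj hf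
  have h3 := P.le_coeff hr h1 h2.le
  have h4 : 0 < (|x j| / 2) ^ r := Real.rpow_pos_of_pos (by have := abs_pos.2 hxj; linarith) _
  exact (h4.trans_le h3).ne'

/-- Prepares Hölder's inequality: on the support of the field the coefficient is at least `(|x j| /
2) ^ r`, so `‖W‖` costs a weight `|x j| ^ (-r / q)` on top of the field's `|x j| ^ (-δ)`. -/
lemma flux_le_weight_mul (hδ0 : 0 ≤ δ) (hδ : δ < 1) (hr : 0 ≤ r) (hq : 0 < q)
    {x W : EuclideanSpace ℝ (Fin n)} (hxj : x j ≠ 0) :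
    |P.flux i j (cutoff i j (innerBump n)) x W| ≤
      2 * P.C * 2 ^ (r / q) * |x j| ^ (-(δ + r / q)) * (P.coeff i j r x * ‖W‖ ^ q) ^ (1 / q) := by
  have hj0 : 0 < |x j| := abs_pos.2 hxj
  have hC := P.C_nonneg
  have ha := P.coeff_nonneg (i := i) (j := j) (r := r) x
  by_cases hf : P.flux i j (cutoff i j (innerBump n)) x W = 0
  · rw [hf, abs_zero]
    have : 0 ≤ P.coeff i j r x * ‖W‖ ^ q := mul_nonneg ha (Real.rpow_nonneg (norm_nonneg _) _)
    positivity
  obtain ⟨h1, h2⟩ := P.d_lt_of_flux_ne_zero hδ hxj hf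
  have h3 := P.le_coeff hr h1 h2.le
  have hX := P.streamX_le hδ0 hj0 (x i)
  have hX0 := P.streamX_nonneg hj0.le (x i)
  have hθ1 := cutoff_le_one (i := i) (j := j) (innerBump n) x
  have hθ0 := cutoff_nonneg (i := i) (j := j) (innerBump n) x
  have hrt : (|x j| / 2) ^ (r / q) * ‖W‖ ≤ (P.coeff i j r x * ‖W‖ ^ q) ^ (1 / q) := by
    rw [Real.mul_rpow ha (Real.rpow_nonneg (norm_nonneg _) _), ← Real.rpow_mul (norm_nonneg _),
      mul_one_div_cancel hq.ne', Real.rpow_one]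
    refine mul_le_mul_of_nonneg_right ?_ (norm_nonneg _)
    rw [show r / q = r * (1 / q) by ring, Real.rpow_mul (by positivity)]
    exact Real.rpow_le_rpow (by positivity) h3 (by positivity)
  calc _ ≤ 1 * (2 * (P.C * |x j| ^ (-δ)) * ‖W‖) := by
        refine (P.abs_flux_le hδ (cutoff_nonneg (i := i) (j := j) (innerBump n)) x W hxj).trans ?_
        gcongr
    _ = 2 * P.C * 2 ^ (r / q) * |x j| ^ (-(δ + r / q)) * ((|x j| / 2) ^ (r / q) * ‖W‖) := by
        rw [Real.div_rpow hj0.le (by norm_num), neg_add, Real.rpow_add hj0, Real.rpow_neg hj0.le (r / q)]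
        have e1 : (0 : ℝ) < 2 ^ (r / q) := by positivity
        have e2 : 0 < |x j| ^ (r / q) := by positivity
        field_simp
    _ ≤ _ := by gcongr

/-- The flux functional is bounded by the coefficient part of the energy. -/
lemma exists_flux_bound (hij : i ≠ j) (hδ0 : 0 ≤ δ) (hδ : δ < 1) (hr : 0 ≤ r) (hq : 1 < q)
    (hexp : δ * q + r < q - 1) : ∃ b : ℝ, 0 < b ∧
      ∀ W : EuclideanSpace ℝ (Fin n) → EuclideanSpace ℝ (Fin n),
        AEStronglyMeasurable W (volume.restrict (cube n)) →
        ENNReal.ofReal |∫ x in cube n, P.flux i j (cutoff i j (innerBump n)) x (W x)| ≤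
          ENNReal.ofReal b *
            (∫⁻ x in cube n, ENNReal.ofReal (P.coeff i j r x * ‖W x‖ ^ q)) ^ (1 / q) := by
  have hq0 : 0 < q := by linarith
  set p := q / (q - 1) with hp
  have hq1 : 0 < q - 1 := by linarith
  have hp0 : 0 < p := div_pos hq0 hq1
  have hpq : p.HolderConjugate q := by
    have := (Real.HolderConjugate.conjExponent hq).symm
    rwa [Real.conjExponent] at this
  set w : EuclideanSpace ℝ (Fin n) → ℝ := fun x =>
    2 * P.C * 2 ^ (r / q) * |x j| ^ (-(δ + r / q)) with hw
  have hC := P.C_nonneg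
  have hw0 : ∀ x, 0 ≤ w x := fun x => by simp only [hw]; positivity
  have hjm : Measurable fun x : EuclideanSpace ℝ (Fin n) => x j :=
    (EuclideanSpace.proj (𝕜 := ℝ) j).continuous.measurable
  have hwm : Measurable w := by simp only [hw]; fun_prop
  have hwint : ∫⁻ x in cube n, ENNReal.ofReal (w x) ^ p < ⊤ := by
    -- The weight lies in the dual space exactly when its exponent times `q / (q - 1)` exceeds `-1`,
    -- which is `hexp`.
    have hI := (integrableOn_cube_abs_rpow (n := n) hij (s := -(δ + r / q) * p) (by
      have e : -(δ + r / q) * p = -((δ * q + r) / (q - 1)) := by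
        rw [hp]; field_simp
      rw [e, neg_lt_neg_iff, div_lt_one hq1]
      exact hexp)).const_mul ((2 * P.C * 2 ^ (r / q)) ^ p)
    refine lt_of_le_of_lt (lintegral_mono fun x => ?_) hI.lintegral_lt_top
    rw [ENNReal.ofReal_rpow_of_nonneg (hw0 x) hp0.le]
    refine ENNReal.ofReal_le_ofReal (le_of_eq ?_)
    simp only [hw]
    rw [Real.mul_rpow (by positivity) (by positivity), ← Real.rpow_mul (abs_nonneg _)]
  set B := (∫⁻ x in cube n, ENNReal.ofReal (w x) ^ p) ^ (1 / p) with hB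
  have hBtop : B ≠ ⊤ := (ENNReal.rpow_lt_top_of_nonneg (by positivity) hwint.ne).ne
  -- The added 1 keeps the constant positive even if `B = 0`.
  refine ⟨B.toReal + 1, by positivity, fun W hW => ?_⟩
  have hBle : B ≤ ENNReal.ofReal (B.toReal + 1) := by
    rw [← ENNReal.ofReal_toReal hBtop, ENNReal.toReal_ofReal ENNReal.toReal_nonneg]
    exact ENNReal.ofReal_le_ofReal (by linarith)
  have hgm : AEMeasurable (fun x => ENNReal.ofReal (P.coeff i j r x * ‖W x‖ ^ q) ^ (1 / q))
      (volume.restrict (cube n)) :=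
    (((P.continuous_coeff hr).measurable.aemeasurable.mul
      (hW.norm.aemeasurable.pow_const q)).ennreal_ofReal).pow_const _
  calc ENNReal.ofReal |∫ x in cube n, P.flux i j (cutoff i j (innerBump n)) x (W x)|
      ≤ ∫⁻ x in cube n, ENNReal.ofReal |P.flux i j (cutoff i j (innerBump n)) x (W x)| := by
        have := enorm_integral_le_lintegral_enorm (μ := volume.restrict (cube n))
          (fun x => P.flux i j (cutoff i j (innerBump n)) x (W x))
        simpa only [Real.enorm_eq_ofReal_abs] using this
    _ ≤ ∫⁻ x in cube n, ((fun x => ENNReal.ofReal (w x)) *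
          fun x => ENNReal.ofReal (P.coeff i j r x * ‖W x‖ ^ q) ^ (1 / q)) x := by
        refine lintegral_mono_ae ?_
        filter_upwards [ae_cube_coord_ne_zero j] with x hx
        rw [Pi.mul_apply, ENNReal.ofReal_rpow_of_nonneg
          (mul_nonneg (P.coeff_nonneg x) (Real.rpow_nonneg (norm_nonneg _) _)) (by positivity),
          ← ENNReal.ofReal_mul (hw0 x)]
        exact ENNReal.ofReal_le_ofReal (P.flux_le_weight_mul hδ0 hδ hr hq0 hx)
    _ ≤ B * (∫⁻ x in cube n,
          (ENNReal.ofReal (P.coeff i j r x * ‖W x‖ ^ q) ^ (1 / q)) ^ q) ^ (1 / q) :=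
        ENNReal.lintegral_mul_le_Lp_mul_Lq _ hpq hwm.ennreal_ofReal.aemeasurable hgm
    _ ≤ _ := by
        simp only [← ENNReal.rpow_mul, one_div_mul_cancel hq0.ne', ENNReal.rpow_one]
        gcongr

lemma flux_gradient_base (x : EuclideanSpace ℝ (Fin n)) (hij : i ≠ j)
    {θ : EuclideanSpace ℝ (Fin n) → ℝ} :
    P.flux i j θ x (gradient (P.base j) x) =
      θ x * (P.streamX (x i) |x j| * (deriv step (x j / P.c) / P.c)) := by
  rw [flux, gradient_apply, gradient_apply, (P.hasFDerivAt_base x).fderiv]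
  simp [hij]

lemma integrableOn_flux_base (hij : i ≠ j) (hδ0 : 0 ≤ δ) (hδ : δ < 1) :
    IntegrableOn (fun x => P.flux i j (cutoff i j (innerBump n)) x (gradient (P.base j) x))
      (cube n) := by
  obtain ⟨B, -, hB⟩ := P.exists_bound_fderiv_base (n := n) (j := j)
  exact P.integrableOn_flux hij hδ0 hδ (contDiff_cutoff _).continuous (cutoff_nonneg _)
    (cutoff_le_one _)
    (continuous_gradient (P.contDiff_base.of_le (by simp))).aestronglyMeasurable
    (fun x _ => by rw [norm_gradient]; exact hB x)

lemma exists_deriv_step_pos : ∃ t ∈ Ioo (0 : ℝ) (1 / 2), 0 < deriv step t := by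
  obtain ⟨t, ht, he⟩ := exists_deriv_eq_slope step (show (0 : ℝ) < 1 / 2 by norm_num)
    contDiff_step.continuous.continuousOn (contDiff_step.differentiable (by simp)).differentiableOn
  refine ⟨t, ht, ?_⟩
  rw [he]
  have h1 : step (1 / 2) = 1 / 2 := step_of_ge le_rfl
  have h2 : step 0 < 1 / 2 := by
    have := Real.smoothTransition.lt_one_of_lt_one (x := 0 + 1 / 2) (by norm_num)
    rw [step]; linarith
  rw [h1]
  apply div_pos <;> linarith

/-- The flux of the smooth boundary datum is positive. -/
lemma flux_base_pos (hij : i ≠ j) (hδ0 : 0 ≤ δ) (hδ : δ < 1) :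
    0 < ∫ x in cube n, P.flux i j (cutoff i j (innerBump n)) x (gradient (P.base j) x) := by
  have hc := P.c_pos
  have hcle := P.c_le
  obtain ⟨t, ht, hst⟩ := exists_deriv_step_pos
  -- A height at which the reference step has positive slope. It is at most `1 / 2`, so
  -- `exists_streamX_pos` gives an abscissa where the flux density is positive; continuity there
  -- gives positive measure.
  set y := t * P.c with hy
  have hy0 : 0 < y := mul_pos ht.1 hc
  have hy1 : y ≤ 1 / 2 := by have := ht.2; nlinarith
  obtain ⟨a, ha, hXa⟩ := P.exists_streamX_pos hy0 hy1
  set f : EuclideanSpace ℝ (Fin n) → ℝ :=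
    fun x => P.flux i j (cutoff i j (innerBump n)) x (gradient (P.base j) x) with hf
  have hfe : ∀ x, f x = cutoff i j (innerBump n) x *
      (P.streamX (x i) |x j| * (deriv step (x j / P.c) / P.c)) := fun x =>
    P.flux_gradient_base x hij
  have hnn : ∀ x, 0 ≤ f x := fun x => by
    rw [hfe]
    exact mul_nonneg (cutoff_nonneg _ x) (mul_nonneg (P.streamX_nonneg (abs_nonneg _) _)
      (div_nonneg monotone_step.deriv_nonneg hc.le))
  set z : EuclideanSpace ℝ (Fin n) := EuclideanSpace.single i a + EuclideanSpace.single j y with hz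
  have hzi : z i = a := by simp [hz, hij]
  have hzj : z j = y := by simp [hz, hij.symm]
  have hzcube : z ∈ cube n := by
    intro l
    by_cases hli : l = i
    · rw [hli, hzi]; exact ha
    by_cases hlj : l = j
    · rw [hlj, hzj]; exact ⟨by linarith, by linarith⟩
    · simp [hz, hli, hlj]
  have hztr : transversal i j z = 0 := by
    have e : z = a • EuclideanSpace.single i (1 : ℝ) + y • EuclideanSpace.single j (1 : ℝ) := by
      ext l
      by_cases h1 : l = i <;> by_cases h2 : l = j <;> simp [hz, h1, h2]
    rw [e, map_add, map_smul, map_smul, transversal_single_left hij, transversal_single_right hij]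
    simp
  have hfz : 0 < f z := by
    rw [hfe, cutoff_eq_one _ (by rw [hztr, norm_zero]; exact (innerBump n).rIn_pos.le), one_mul, hzi,
      hzj, abs_of_pos hy0, hy, mul_div_cancel_right₀ _ hc.ne']
    exact mul_pos hXa (div_pos hst hc)
  have hcont : ContinuousAt f z := by
    have hfun : f = fun x => cutoff i j (innerBump n) x *
      (P.streamX (x i) |x j| * (deriv step (x j / P.c) / P.c)) := funext hfe
    rw [hfun]
    have hpair : ContinuousAt (fun x : EuclideanSpace ℝ (Fin n) => (x i, |x j|)) z := by fun_prop
    have hopen : {p : ℝ × ℝ | 0 < p.2} ∈ 𝓝 (z i, |z j|) :=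
      (isOpen_lt continuous_const continuous_snd).mem_nhds (by
        rw [mem_ofPred_eq, hzj]; exact abs_pos.2 hy0.ne')
    have hX := ContinuousAt.comp (f := fun x : EuclideanSpace ℝ (Fin n) => (x i, |x j|))
      ((P.continuousOn_streamX hδ).continuousAt hopen) hpair
    have hds : Continuous (deriv step) := contDiff_step.continuous_deriv (by simp)
    refine (contDiff_cutoff _).continuous.continuousAt.mul (hX.mul ?_)
    fun_prop
  rw [integral_pos_iff_support_of_nonneg hnn (P.integrableOn_flux_base hij hδ0 hδ)]
  have hnhds : Function.support f ∩ cube n ∈ 𝓝 z := by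
    filter_upwards [hcont.eventually (lt_mem_nhds hfz), (isOpen_cube n).mem_nhds hzcube] with x h1 h2
    exact ⟨h1.ne', h2⟩
  rw [Measure.restrict_apply' (isOpen_cube n).measurableSet]
  exact Measure.measure_pos_of_mem_nhds volume hnhds

/-- Where the field is nonzero so is the coefficient, and there `base + ubar` is locally constant.
Hence `ubar` carries the opposite of the flux of `base`, which no test function can do. -/
lemma flux_ubar_ae_eq (hδ : δ < 1) :
    (fun x => P.flux i j (cutoff i j (innerBump n)) x (gradient (P.ubar i j) x))
      =ᵐ[volume.restrict (cube n)]
    fun x => -P.flux i j (cutoff i j (innerBump n)) x (gradient (P.base j) x) := by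
  filter_upwards [P.ae_cube_d_pos i, ae_cube_coord_ne_zero j] with x hd hj
  -- Any positive exponent would do, as only the zero set of the coefficient matters here.
  by_cases ha : P.coeff i j 1 x = 0
  · have h0 : ∀ W, P.flux i j (cutoff i j (innerBump n)) x W = 0 := fun W => by
      by_contra hne
      exact P.coeff_ne_zero_of_flux_ne_zero hδ zero_le_one hj hne ha
    rw [h0, h0, neg_zero]
  · rw [P.gradient_ubar_of_coeff_ne_zero one_pos hd ha, ← neg_one_smul ℝ, flux_smul, neg_one_mul]

/-- Test functions carry no flux, so the flux depends only on the reference field `V`. -/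
lemma integral_flux_add_test (hij : i ≠ j) (hδ0 : 0 ≤ δ) (hδ : δ < 1)
    {φ : EuclideanSpace ℝ (Fin n) → ℝ} (hφ : φ ∈ testFunctions (cube n))
    {V W : EuclideanSpace ℝ (Fin n) → EuclideanSpace ℝ (Fin n)}
    (hW : W =ᵐ[volume.restrict (cube n)] V + gradient φ)
    (hV : IntegrableOn (fun x => P.flux i j (cutoff i j (innerBump n)) x (V x)) (cube n)) :
    ∫ x in cube n, P.flux i j (cutoff i j (innerBump n)) x (W x) =
      ∫ x in cube n, P.flux i j (cutoff i j (innerBump n)) x (V x) := by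
  obtain ⟨B, hB⟩ := exists_bound_gradient_test hφ
  have hI := P.integrableOn_flux (i := i) (j := j) (θ := cutoff i j (innerBump n)) hij hδ0 hδ
    (contDiff_cutoff (innerBump n)).continuous (cutoff_nonneg _) (cutoff_le_one _)
    (continuous_gradient (hφ.1.of_le (by simp))).aestronglyMeasurable (fun x _ => hB x)
  have h0 := P.integral_flux_test (i := i) (j := j) (θ := cutoff i j (innerBump n)) hδ0 hδ hij hφ (contDiff_cutoff (innerBump n))
    (cutoff_nonneg _) (cutoff_le_one _)
    (fderiv_cutoff_apply_eq_zero _ (transversal_single_left hij))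
    (fderiv_cutoff_apply_eq_zero _ (transversal_single_right hij))
  have e : ∫ x in cube n, P.flux i j (cutoff i j (innerBump n)) x (W x) =
      ∫ x in cube n, (P.flux i j (cutoff i j (innerBump n)) x (V x) +
        P.flux i j (cutoff i j (innerBump n)) x (gradient φ x)) := by
    refine integral_congr_ae ?_
    filter_upwards [hW] with x hx
    rw [hx, Pi.add_apply, flux_add]
  rw [e, integral_add hV hI, h0, add_zero]

end CantorProfile

/-! ### Growth of the integrands -/

lemma GrowthFunction.exists_mul_le {g : ℝ → ℝ} (hg : GrowthFunction g) {σ : ℝ} (hσ : 0 < σ) :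
    ∃ c, 0 ≤ c ∧ ∀ t, 0 ≤ t → t * g t ≤ c * (1 + 2 * t ^ (1 + σ)) := by
  obtain ⟨c, hc⟩ := hg.subpolynomial σ hσ
  refine ⟨|c|, abs_nonneg c, fun t ht => ?_⟩
  have hpow : t * t ^ σ = t ^ (1 + σ) := by
    rw [Real.rpow_one_add' ht (by linarith)]
  have hp0 : 0 ≤ t ^ (1 + σ) := Real.rpow_nonneg ht _
  have hle : t ≤ 1 + t ^ (1 + σ) := by
    rcases le_total t 1 with h | h
    · linarith
    · have := Real.rpow_le_rpow_of_exponent_le h (show 1 ≤ 1 + σ by linarith)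
      rw [Real.rpow_one] at this
      linarith
  calc t * g t ≤ t * (|c| * (1 + t ^ σ)) := by
        refine mul_le_mul_of_nonneg_left ((hc t ht).trans ?_) ht
        exact mul_le_mul_of_nonneg_right (le_abs_self c) (by positivity)
    _ = |c| * (t + t * t ^ σ) := by ring
    _ ≤ _ := by
        rw [hpow]
        exact mul_le_mul_of_nonneg_left (by linarith) (abs_nonneg c)

section Integrand

variable {n : ℕ} {L : EuclideanSpace ℝ (Fin n) → ℝ} {g : ℝ → ℝ} {Λ μ : ℝ}

lemma dense_compl_zero (i : Fin n) : Dense ({0}ᶜ : Set (EuclideanSpace ℝ (Fin n))) := by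
  have : Nonempty (Fin n) := ⟨i⟩
  have : (𝓝[≠] (0 : EuclideanSpace ℝ (Fin n))).NeBot := Module.punctured_nhds_neBot ℝ _ 0
  exact dense_compl_singleton 0

/-- The growth bounds are assumed off the origin only; they extend by continuity and density, the
index `i` ensuring positive dimension. -/
lemma EllipticIntegrand.nonneg (hL : EllipticIntegrand L g Λ μ) (hg : GrowthFunction g)
    (hΛ : 1 ≤ Λ) (i : Fin n) (z : EuclideanSpace ℝ (Fin n)) : 0 ≤ L z := by
  have hcl : IsClosed {z | 0 ≤ L z} := isClosed_le continuous_const hL.contDiff_one.continuous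
  have hsub : ({0}ᶜ : Set (EuclideanSpace ℝ (Fin n))) ⊆ {z | 0 ≤ L z} := fun z hz =>
    le_trans (mul_nonneg (by positivity) (mul_nonneg (norm_nonneg z) (hg.nonneg _ (norm_nonneg z))))
      (hL.growth_lower z hz)
  exact closure_minimal hsub hcl (dense_compl_zero i z)

lemma EllipticIntegrand.le (hL : EllipticIntegrand L g Λ μ) (hg : GrowthFunction g)
    (i : Fin n) (z : EuclideanSpace ℝ (Fin n)) : L z ≤ Λ * (‖z‖ * g ‖z‖) + Λ := by
  have hgc : Continuous fun z : EuclideanSpace ℝ (Fin n) => g ‖z‖ :=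
    hg.continuousOn.comp_continuous continuous_norm fun z => norm_nonneg z
  have hcl : IsClosed {z | L z ≤ Λ * (‖z‖ * g ‖z‖) + Λ} :=
    isClosed_le hL.contDiff_one.continuous
      ((continuous_const.mul (continuous_norm.mul hgc)).add continuous_const)
  have hsub : ({0}ᶜ : Set (EuclideanSpace ℝ (Fin n))) ⊆ {z | L z ≤ Λ * (‖z‖ * g ‖z‖) + Λ} :=
    fun z hz => hL.growth_upper z hz
  exact closure_minimal hsub hcl (dense_compl_zero i z)

end Integrand

lemma exists_const_add_lt_mul_rpow {A₁ A₂ k p q : ℝ} (hA₁ : 0 ≤ A₁) (hk : 0 < k)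
    (hp : 0 ≤ p) (hpq : p < q) : ∃ M : ℝ, 1 ≤ M ∧ A₁ + A₂ * M ^ p < (M * k) ^ q := by
  have hk' : 0 < k ^ q := Real.rpow_pos_of_pos hk q
  obtain ⟨M, hM1, hM⟩ := ((eventually_ge_atTop (1 : ℝ)).and
    ((tendsto_rpow_atTop (sub_pos.2 hpq)).eventually_gt_atTop ((A₁ + A₂) / k ^ q))).exists
  refine ⟨M, hM1, ?_⟩
  have hM0 : 0 < M := by linarith
  have hMp : 1 ≤ M ^ p := Real.one_le_rpow hM1 hp
  rw [div_lt_iff₀ hk'] at hM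
  calc A₁ + A₂ * M ^ p ≤ (A₁ + A₂) * M ^ p := by nlinarith
    _ < M ^ (q - p) * k ^ q * M ^ p := mul_lt_mul_of_pos_right hM (by linarith)
    _ = (M * k) ^ q := by
        rw [Real.mul_rpow hM0.le hk.le, mul_right_comm, ← Real.rpow_add hM0, sub_add_cancel]

namespace CantorProfile

variable {δ : ℝ} {N : ℕ} (P : CantorProfile δ N) {n : ℕ} {i j : Fin n} {r q s Λ μ : ℝ}
  {g : ℝ → ℝ} {L : EuclideanSpace ℝ (Fin n) → ℝ}

/-! ### Energy bounds -/

lemma hasWeakGrad_smul_base (M : ℝ) :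
    HasWeakGrad (cube n) (M • P.base j) (M • gradient (P.base j)) :=
  (hasWeakGrad_gradient (P.contDiff_base.of_le (by simp))).const_smul M

lemma hasWeakGrad_ubar (hij : i ≠ j) :
    HasWeakGrad (cube n) (P.ubar i j) (gradient (P.ubar i j)) := by
  simpa only [one_smul] using (P.ubar_smul_mem hij 1).1

lemma ubar_mem_W11Zero (hij : i ≠ j) : P.ubar i j ∈ W11Zero (cube n) := by
  simpa only [one_smul] using (P.ubar_smul_mem hij 1).2.1

lemma memLp_top_ubar (hij : i ≠ j) : MemLp (P.ubar i j) ⊤ (volume.restrict (cube n)) :=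
  memLp_top_of_bound (P.ubar_mem_W11Zero hij).1.1.aestronglyMeasurable 1
    (ae_of_all _ fun x => P.abs_ubar_le x)

lemma continuous_gradient_base :
    Continuous (gradient (P.base j) : EuclideanSpace ℝ (Fin n) → EuclideanSpace ℝ (Fin n)) :=
  continuous_gradient (P.contDiff_base.of_le (by simp))

/-- On competitors that differ from the boundary datum by a test function, the energy grows at
least like the `q`-th power of the datum. -/
lemma le_energy_base_add_test (hij : i ≠ j) (hδ0 : 0 ≤ δ) (hδ : δ < 1) (hq : 0 < q)
    (hL : ∀ z, 0 ≤ L z) {b : ℝ} (hb : 0 < b)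
    (hflux : ∀ W : EuclideanSpace ℝ (Fin n) → EuclideanSpace ℝ (Fin n),
      AEStronglyMeasurable W (volume.restrict (cube n)) →
      ENNReal.ofReal |∫ x in cube n, P.flux i j (cutoff i j (innerBump n)) x (W x)| ≤
        ENNReal.ofReal b *
          (∫⁻ x in cube n, ENNReal.ofReal (P.coeff i j r x * ‖W x‖ ^ q)) ^ (1 / q))
    {M : ℝ} (hM : 0 ≤ M) {φ : EuclideanSpace ℝ (Fin n) → ℝ} (hφ : φ ∈ testFunctions (cube n)) :
    ENNReal.ofReal ((M * ((∫ x in cube n,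
        P.flux i j (cutoff i j (innerBump n)) x (gradient (P.base j) x)) / b)) ^ q) ≤
      energy L (P.coeff i j r) s q (cube n) (M • P.base j + φ) := by
  set κ := ∫ x in cube n, P.flux i j (cutoff i j (innerBump n)) x (gradient (P.base j) x) with hκ
  have hκ0 : 0 < κ := P.flux_base_pos hij hδ0 hδ
  set W := weakGrad (cube n) (M • P.base j + φ) with hWdef
  have hφ1 : ContDiff ℝ 1 φ := hφ.1.of_le (by simp)
  have hW : W =ᵐ[volume.restrict (cube n)] M • gradient (P.base j) + gradient φ :=
    ((P.hasWeakGrad_smul_base M).add (hasWeakGrad_gradient hφ1)).weakGrad_ae_eq (isOpen_cube n)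
  have hWm : AEStronglyMeasurable W (volume.restrict (cube n)) :=
    ((P.continuous_gradient_base.const_smul M).add
      (continuous_gradient hφ1)).aestronglyMeasurable.congr hW.symm
  -- The flux is `M * κ` for every `φ`; `hflux` then turns it into a lower bound of order `M ^ q`.
  have h_int : ∫ x in cube n, P.flux i j (cutoff i j (innerBump n)) x (W x) = M * κ := by
    have e : ∀ x, P.flux i j (cutoff i j (innerBump n)) x ((M • gradient (P.base j)) x) =
        M * P.flux i j (cutoff i j (innerBump n)) x (gradient (P.base j) x) := fun x => by
      rw [Pi.smul_apply, flux_smul]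
    have hI : IntegrableOn (fun x => P.flux i j (cutoff i j (innerBump n)) x
        ((M • gradient (P.base j)) x)) (cube n) := by
      simp only [e]
      exact (P.integrableOn_flux_base hij hδ0 hδ).const_mul M
    rw [P.integral_flux_add_test hij hδ0 hδ hφ hW hI]
    simp only [e]
    rw [integral_const_mul]
  have h1 := hflux W hWm
  rw [h_int, abs_of_nonneg (by positivity)] at h1
  have h2 : ENNReal.ofReal (M * (κ / b)) ≤
      (∫⁻ x in cube n, ENNReal.ofReal (P.coeff i j r x * ‖W x‖ ^ q)) ^ q⁻¹ := by
    rw [one_div] at h1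
    rw [← mul_div_assoc, ENNReal.ofReal_div_of_pos hb]
    exact ENNReal.div_le_of_le_mul' h1
  rw [ENNReal.le_rpow_inv_iff hq, ENNReal.ofReal_rpow_of_nonneg (by positivity) hq.le] at h2
  refine h2.trans (lintegral_mono fun x => ENNReal.ofReal_le_ofReal ?_)
  have hpow : ‖W x‖ ^ q ≤ (s ^ 2 + ‖W x‖ ^ 2) ^ (q / 2) := by
    have e : ‖W x‖ ^ q = (‖W x‖ ^ 2) ^ (q / 2) := by
      rw [← Real.rpow_natCast, ← Real.rpow_mul (norm_nonneg _)]
      congr 1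
      push_cast
      ring
    rw [e]
    exact Real.rpow_le_rpow (by positivity) (by linarith [sq_nonneg s]) (by positivity)
  have := mul_le_mul_of_nonneg_left hpow (P.coeff_nonneg (i := i) (j := j) (r := r) x)
  linarith [hL (W x)]

/-- The singular competitor has energy growing at most like a power `1 + σ` of the datum. -/
lemma exists_energy_base_add_ubar_le (hij : i ≠ j) (hr : 0 < r) (hq : 0 < q)
    (hs : s ∈ Icc (0 : ℝ) 1) (hΛ : 1 ≤ Λ) (hg : GrowthFunction g)
    (hL : EllipticIntegrand L g Λ μ) {σ : ℝ} (hσ : 0 < σ) (hσε : 2 * σ ≤ P.ε) (hσ1 : σ ≤ 1 / 2) :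
    ∃ A₁ A₂ : ℝ, 0 ≤ A₁ ∧ ∀ M : ℝ, 0 ≤ M →
      energy L (P.coeff i j r) s q (cube n) (M • P.base j + M • P.ubar i j) ≤
        ENNReal.ofReal (A₁ + A₂ * M ^ (1 + σ)) := by
  obtain ⟨c, hc0, hc⟩ := hg.exists_mul_le hσ
  obtain ⟨K, hK1, hK⟩ := P.exists_bound_gradient_ubar (n := n) (i := i) (j := j)
  obtain ⟨B, hB0, hB⟩ := P.exists_bound_fderiv_base (n := n) (j := j)
  -- The 2 bounds the coefficient term: it is nonzero only where the total gradient vanishes, and `s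
  -- ≤ 1` remains. `D` collects the part with growth `M ^ (1 + σ)`.
  set A := Λ * c + Λ + 2 with hA
  set D := 2 * Λ * c * (B + K) ^ (1 + σ) with hD
  have hI := P.integrableOn_majorant (n := n) hij hσ
  refine ⟨A * volume.real (cube n), D * ∫ x in cube n, P.majorant i j σ x, by positivity,
    fun M hM => ?_⟩
  have hW := ((P.hasWeakGrad_smul_base (j := j) M).add (P.ubar_smul_mem hij M).1).weakGrad_ae_eq
    (isOpen_cube n)
  have hIM : Integrable (fun x => A + D * M ^ (1 + σ) * P.majorant i j σ x)
      (volume.restrict (cube n)) := (integrable_const A).add (hI.const_mul (D * M ^ (1 + σ)))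
  have hval : ∫ x in cube n, (A + D * M ^ (1 + σ) * P.majorant i j σ x) =
      A * volume.real (cube n) + D * (∫ x in cube n, P.majorant i j σ x) * M ^ (1 + σ) := by
    rw [integral_add (integrable_const A) (hI.const_mul (D * M ^ (1 + σ))), integral_const_mul,
      setIntegral_const, smul_eq_mul]
    ring
  rw [← hval, ofReal_integral_eq_lintegral_ofReal hIM (ae_of_all _ fun x => by
    have := P.majorant_nonneg (i := i) (j := j) (s := σ) x
    simp only [Pi.zero_apply]
    positivity)]
  refine lintegral_mono_ae ?_
  filter_upwards [hW, P.ae_cube_d_pos i, ae_cube_coord_ne_zero j,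
    ae_restrict_mem (isOpen_cube n).measurableSet] with x hWx hd hj hx
  refine ENNReal.ofReal_le_ofReal ?_
  set Z := weakGrad (cube n) (M • P.base j + M • P.ubar i j) x with hZ
  have hZe : Z = M • (gradient (P.base j) x + gradient (P.ubar i j) x) := by
    rw [hWx, smul_add]; rfl
  set m := max (P.d (x i)) |x j| with hm
  have hm0 : 0 < m := lt_max_of_lt_left hd
  have hm1 : 1 ≤ 1 / m := by
    rw [le_div_iff₀ hm0, one_mul]; exact P.max_le_one hx
  have hZn : ‖Z‖ ≤ M * ((B + K) * (1 / m)) := by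
    rw [hZe, norm_smul, Real.norm_of_nonneg hM]
    refine mul_le_mul_of_nonneg_left ?_ hM
    have h1 : ‖gradient (P.base j) x‖ ≤ B := by rw [norm_gradient]; exact hB x
    have h2 := hK x hx hd
    have h3 := norm_add_le (gradient (P.base j) x) (gradient (P.ubar i j) x)
    have h4 : B ≤ B * (1 / m) := le_mul_of_one_le_right hB0.le hm1
    rw [add_mul]
    linarith
  have hZp : ‖Z‖ ^ (1 + σ) ≤ M ^ (1 + σ) * ((B + K) ^ (1 + σ) * P.majorant i j σ x) := by
    have h1 := P.inv_max_rpow_le_majorant hσ hσε hσ1 le_rfl hx hd hj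
    calc ‖Z‖ ^ (1 + σ) ≤ (M * ((B + K) * (1 / m))) ^ (1 + σ) :=
          Real.rpow_le_rpow (norm_nonneg _) hZn (by linarith)
      _ = M ^ (1 + σ) * ((B + K) ^ (1 + σ) * (1 / m) ^ (1 + σ)) := by
          rw [Real.mul_rpow hM (by positivity), Real.mul_rpow (by positivity) (by positivity)]
      _ ≤ _ := by gcongr
  have hLZ : L Z ≤ Λ * (c * (1 + 2 * (M ^ (1 + σ) * ((B + K) ^ (1 + σ) * P.majorant i j σ x)))) +
      Λ := by
    refine (hL.le hg i Z).trans ?_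
    have h1 : ‖Z‖ * g ‖Z‖ ≤
        c * (1 + 2 * (M ^ (1 + σ) * ((B + K) ^ (1 + σ) * P.majorant i j σ x))) :=
      (hc ‖Z‖ (norm_nonneg _)).trans (by gcongr)
    exact add_le_add_left (mul_le_mul_of_nonneg_left h1 (by linarith)) Λ
  have haZ : P.coeff i j r x * (s ^ 2 + ‖Z‖ ^ 2) ^ (q / 2) ≤ 2 := by
    by_cases ha : P.coeff i j r x = 0
    · rw [ha, zero_mul]; norm_num
    · have hZ0 : Z = 0 := by
        rw [hZe, P.gradient_ubar_of_coeff_ne_zero hr hd ha, add_neg_cancel, smul_zero]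
      rw [hZ0, norm_zero, zero_pow two_ne_zero, add_zero]
      have h1 : (s ^ 2) ^ (q / 2) ≤ 1 :=
        Real.rpow_le_one (sq_nonneg s) (pow_le_one₀ hs.1 hs.2) (by positivity)
      have h2 := P.coeff_le_two (i := i) (j := j) hr.le hx
      have h3 := P.coeff_nonneg (i := i) (j := j) (r := r) x
      have h4 : 0 ≤ (s ^ 2) ^ (q / 2) := by positivity
      nlinarith
  calc _ ≤ (Λ * (c * (1 + 2 * (M ^ (1 + σ) * ((B + K) ^ (1 + σ) * P.majorant i j σ x)))) + Λ) + 2 :=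
        add_le_add hLZ haZ
    _ = _ := by rw [hA, hD]; ring

/-- Where the coefficient is positive, the gradient of `ubar` is minus that of the bounded smooth
step; elsewhere only the nearly linear term counts. -/
lemma modular_ubar_lt_top (hij : i ≠ j) (hr : 0 < r) (hq : 0 < q) (hg : GrowthFunction g)
    {σ : ℝ} (hσ : 0 < σ) (hσε : 2 * σ ≤ P.ε) (hσ1 : σ ≤ 1 / 2) :
    modular g (P.coeff i j r) q (cube n) (P.ubar i j) < ⊤ := by
  obtain ⟨c, hc0, hc⟩ := hg.exists_mul_le hσ
  obtain ⟨K, hK1, hK⟩ := P.exists_bound_gradient_ubar (n := n) (i := i) (j := j)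
  obtain ⟨B, hB0, hB⟩ := P.exists_bound_fderiv_base (n := n) (j := j)
  have hI := P.integrableOn_majorant (n := n) hij hσ
  have hIM : Integrable (fun x => c + 2 * B ^ q + 2 * c * K ^ (1 + σ) * P.majorant i j σ x)
      (volume.restrict (cube n)) := (integrable_const _).add (hI.const_mul _)
  refine lt_of_le_of_lt (lintegral_mono_ae ?_) hIM.lintegral_lt_top
  filter_upwards [(P.hasWeakGrad_ubar hij).weakGrad_ae_eq (isOpen_cube n), P.ae_cube_d_pos i,
    ae_cube_coord_ne_zero j, ae_restrict_mem (isOpen_cube n).measurableSet] with x hWx hd hj hx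
  refine ENNReal.ofReal_le_ofReal ?_
  rw [hWx]
  set Z := gradient (P.ubar i j) x with hZ
  set m := max (P.d (x i)) |x j| with hm
  have hm0 : 0 < m := lt_max_of_lt_left hd
  have hZp : ‖Z‖ ^ (1 + σ) ≤ K ^ (1 + σ) * P.majorant i j σ x := by
    have h1 := P.inv_max_rpow_le_majorant hσ hσε hσ1 le_rfl hx hd hj
    calc ‖Z‖ ^ (1 + σ) ≤ (K * (1 / m)) ^ (1 + σ) :=
          Real.rpow_le_rpow (norm_nonneg _) (hK x hx hd) (by linarith)
      _ = K ^ (1 + σ) * (1 / m) ^ (1 + σ) := Real.mul_rpow (by linarith) (by positivity)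
      _ ≤ _ := by gcongr
  have hgZ : ‖Z‖ * g ‖Z‖ ≤ c * (1 + 2 * (K ^ (1 + σ) * P.majorant i j σ x)) := by
    refine (hc ‖Z‖ (norm_nonneg _)).trans ?_
    gcongr
  have haZ : P.coeff i j r x * ‖Z‖ ^ q ≤ 2 * B ^ q := by
    by_cases ha : P.coeff i j r x = 0
    · rw [ha, zero_mul]; positivity
    · have hZB : ‖Z‖ ≤ B := by
        rw [hZ, P.gradient_ubar_of_coeff_ne_zero hr hd ha, norm_neg, norm_gradient]
        exact hB x
      exact mul_le_mul (P.coeff_le_two hr.le hx) (Real.rpow_le_rpow (norm_nonneg _) hZB hq.le)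
        (Real.rpow_nonneg (norm_nonneg _) _) zero_le_two
  calc _ ≤ c * (1 + 2 * (K ^ (1 + σ) * P.majorant i j σ x)) + 2 * B ^ q := add_le_add hgZ haZ
    _ = _ := by ring

/-- Differences of test functions and `ubar` carry a fixed amount of flux, hence a modular bounded
from below. -/
lemma le_modular_test_sub_ubar (hij : i ≠ j) (hδ0 : 0 ≤ δ) (hδ : δ < 1) (hq : 0 < q)
    (hg : GrowthFunction g) {b : ℝ}
    (hflux : ∀ W : EuclideanSpace ℝ (Fin n) → EuclideanSpace ℝ (Fin n),
      AEStronglyMeasurable W (volume.restrict (cube n)) →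
      ENNReal.ofReal |∫ x in cube n, P.flux i j (cutoff i j (innerBump n)) x (W x)| ≤
        ENNReal.ofReal b *
          (∫⁻ x in cube n, ENNReal.ofReal (P.coeff i j r x * ‖W x‖ ^ q)) ^ (1 / q))
    {φ : EuclideanSpace ℝ (Fin n) → ℝ} (hφ : φ ∈ testFunctions (cube n)) :
    ENNReal.ofReal (∫ x in cube n,
        P.flux i j (cutoff i j (innerBump n)) x (gradient (P.base j) x)) ≤
      ENNReal.ofReal b * modular g (P.coeff i j r) q (cube n) (φ - P.ubar i j) ^ (1 / q) := by
  set κ := ∫ x in cube n, P.flux i j (cutoff i j (innerBump n)) x (gradient (P.base j) x) with hκ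
  have hκ0 : 0 < κ := P.flux_base_pos hij hδ0 hδ
  have hφ1 : ContDiff ℝ 1 φ := hφ.1.of_le (by simp)
  obtain ⟨hV, -, hVint⟩ := P.ubar_smul_mem (n := n) hij (-1)
  set V := (-1 : ℝ) • gradient (P.ubar i j : EuclideanSpace ℝ (Fin n) → ℝ) with hVdef
  have hsub : φ - P.ubar i j = (-1 : ℝ) • P.ubar i j + φ := by
    rw [neg_one_smul, neg_add_eq_sub]
  have hW : weakGrad (cube n) (φ - P.ubar i j) =ᵐ[volume.restrict (cube n)] V + gradient φ := by
    rw [hsub]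
    exact (hV.add (hasWeakGrad_gradient hφ1)).weakGrad_ae_eq (isOpen_cube n)
  set W := weakGrad (cube n) (φ - P.ubar i j) with hWdef
  have hWm : AEStronglyMeasurable W (volume.restrict (cube n)) :=
    (hVint.aestronglyMeasurable.add
      (continuous_gradient hφ1).aestronglyMeasurable).congr hW.symm
  have hfl : (fun x => P.flux i j (cutoff i j (innerBump n)) x (V x))
      =ᵐ[volume.restrict (cube n)]
      fun x => P.flux i j (cutoff i j (innerBump n)) x (gradient (P.base j) x) := by
    filter_upwards [P.flux_ubar_ae_eq (i := i) (j := j) (n := n) hδ] with x hx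
    rw [hVdef, Pi.smul_apply, flux_smul, hx, neg_one_mul, neg_neg]
  have h_int : ∫ x in cube n, P.flux i j (cutoff i j (innerBump n)) x (W x) = κ := by
    rw [P.integral_flux_add_test hij hδ0 hδ hφ hW
      ((P.integrableOn_flux_base hij hδ0 hδ).congr hfl.symm), hκ]
    exact integral_congr_ae hfl
  have h1 := hflux W hWm
  rw [h_int, abs_of_pos hκ0] at h1
  refine h1.trans ?_
  refine mul_le_mul_right (ENNReal.rpow_le_rpow (lintegral_mono fun x => ?_) (by positivity)) _
  refine ENNReal.ofReal_le_ofReal ?_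
  have := mul_nonneg (norm_nonneg (W x)) (hg.nonneg _ (norm_nonneg (W x)))
  linarith

end CantorProfile

end DoublePhase

end

/-! ### Choice of parameters and conclusion -/

open DoublePhase

theorem theorem1p3 (n : ℕ) (hn : 2 ≤ n) (α q s Λ μ : ℝ) (hα : 0 < α) (hq : 1 + α < q)
    (hs : s ∈ Set.Icc (0 : ℝ) 1) (hΛ : 1 ≤ Λ) (hμ : 1 ≤ μ)
    (g : ℝ → ℝ) (hg : DoublePhase.GrowthFunction g)
    (L : EuclideanSpace ℝ (Fin n) → ℝ) (hL : DoublePhase.EllipticIntegrand L g Λ μ) :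
    ∃ a ubar utilde : EuclideanSpace ℝ (Fin n) → ℝ,
      (∀ x ∈ closure (DoublePhase.cube n), 0 ≤ a x) ∧
      DoublePhase.MemHolder α a (closure (DoublePhase.cube n)) ∧
      ubar ∈ DoublePhase.W11Zero (DoublePhase.cube n) ∧
      MeasureTheory.MemLp ubar ⊤ (MeasureTheory.volume.restrict (DoublePhase.cube n)) ∧
      DoublePhase.modular g a q (DoublePhase.cube n) ubar < ⊤ ∧
      ContDiffOn ℝ ((⊤ : ℕ∞) : WithTop ℕ∞) utilde (closure (DoublePhase.cube n)) ∧
      (⨅ v ∈ DoublePhase.W11Zero (DoublePhase.cube n),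
          DoublePhase.energy L a s q (DoublePhase.cube n) (utilde + v)) <
        (⨅ φ ∈ DoublePhase.testFunctions (DoublePhase.cube n),
          DoublePhase.energy L a s q (DoublePhase.cube n) (utilde + φ)) ∧
      ¬ ∃ u : ℕ → EuclideanSpace ℝ (Fin n) → ℝ,
          (∀ i, u i ∈ DoublePhase.testFunctions (DoublePhase.cube n)) ∧
          Filter.Tendsto
            (fun i => DoublePhase.modular g a q (DoublePhase.cube n) (u i - ubar))
            Filter.atTop (nhds 0) := by
  obtain ⟨i, j, hij⟩ : ∃ i j : Fin n, i ≠ j :=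
    ⟨⟨0, by omega⟩, ⟨1, by omega⟩, by simp [Fin.ext_iff]⟩
  have hq0 : 0 < q := by linarith
  have hfl := Nat.lt_floor_add_one α
  have hfl' := Nat.floor_le hα.le
  obtain ⟨δ, hδ0, hδ1, hδα, hδq⟩ : ∃ δ : ℝ, 0 < δ ∧ δ < 1 ∧ δ ≤ ⌊α⌋₊ + 1 - α ∧
      δ * q + (α + δ) < q - 1 := by
    -- The first entry gives `δ * (q + 1) ≤ (q - 1 - α) / 2`, half of the available room; the second
    -- keeps the fractional exponent `β` below at most 1.
    refine ⟨min (min ((q - 1 - α) / (2 * (q + 1))) (⌊α⌋₊ + 1 - α)) (1 / 2), ?_, ?_, ?_, ?_⟩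
    · exact lt_min (lt_min (div_pos (by linarith) (by linarith)) (by linarith)) (by norm_num)
    · exact (min_le_right _ _).trans_lt (by norm_num)
    · exact (min_le_left _ _).trans (min_le_right _ _)
    · have h := (min_le_left (min ((q - 1 - α) / (2 * (q + 1))) (⌊α⌋₊ + 1 - α)) (1 / 2)).trans
        (min_le_left _ _)
      rw [le_div_iff₀ (by linarith)] at h
      linarith
  obtain ⟨P⟩ := exists_cantorProfile hδ0 hδ1 (⌊α⌋₊ + 1)
  -- The coefficient's exponent is `α + δ` rather than `α`, so that its fractional part `β` is
  -- positive even for integer `α`.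
  set β := α + δ - ⌊α⌋₊ with hβ
  set r := (⌊α⌋₊ : ℝ) + β with hr
  have hrα : r = α + δ := by rw [hr, hβ]; ring
  have hr0 : 0 < r := by linarith
  -- Small enough for the majorant to be integrable and for `1 + σ < q`.
  set σ := min (min P.ε 1) (q - 1) / 2 with hσ
  have hσ0 : 0 < σ := half_pos (lt_min (lt_min P.ε_pos one_pos) (by linarith))
  have hσε : 2 * σ ≤ P.ε := by
    have := (min_le_left (min P.ε 1) (q - 1)).trans (min_le_left _ _); linarith
  have hσ1 : σ ≤ 1 / 2 := by
    have := (min_le_left (min P.ε 1) (q - 1)).trans (min_le_right _ _); linarith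
  have hσq : 1 + σ < q := by
    have := min_le_right (min P.ε 1) (q - 1); linarith
  obtain ⟨b, hb, hflux⟩ := P.exists_flux_bound (r := r) (q := q) hij hδ0.le hδ1 hr0.le
    (by linarith) (by rw [hrα]; exact hδq)
  obtain ⟨A₁, A₂, hA₁, hA⟩ := P.exists_energy_base_add_ubar_le (r := r) (s := s) hij hr0 hq0 hs hΛ
    hg hL hσ0 hσε hσ1
  have hκ0 := P.flux_base_pos (n := n) hij hδ0.le hδ1
  obtain ⟨M, hM1, hM⟩ := exists_const_add_lt_mul_rpow (A₂ := A₂) hA₁ (div_pos hκ0 hb)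
    (show 0 ≤ 1 + σ by linarith) hσq
  have hM0 : 0 < M := by linarith
  refine ⟨P.coeff i j r, P.ubar i j, M • P.base j, fun x _ => P.coeff_nonneg x,
    P.memHolder_coeff hα.le rfl (by linarith) (by linarith) (by linarith), P.ubar_mem_W11Zero hij,
    P.memLp_top_ubar hij, P.modular_ubar_lt_top hij hr0 hq0 hg hσ0 hσε hσ1,
    (contDiff_const.smul P.contDiff_base).contDiffOn, ?_, ?_⟩
  · refine lt_of_le_of_lt ((iInf₂_le _ (P.ubar_smul_mem hij M).2.1).trans (hA M hM0.le)) ?_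
    refine ((ENNReal.ofReal_lt_ofReal_iff (by positivity)).2 hM).trans_le ?_
    exact le_iInf₂ fun φ hφ => P.le_energy_base_add_test hij hδ0.le hδ1 hq0
      (hL.nonneg hg hΛ i) hb hflux hM0.le hφ
  · rintro ⟨u, hu, hlim⟩
    have hlim' := ENNReal.Tendsto.const_mul (a := ENNReal.ofReal b)
      ((ENNReal.continuous_rpow_const (y := 1 / q)).continuousAt.tendsto.comp hlim)
      (Or.inr ENNReal.ofReal_ne_top)
    rw [ENNReal.zero_rpow_of_pos (by positivity), mul_zero] at hlim'
    -- Modular convergence would force the fixed positive flux of `base` to be at most 0.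
    have hle := ge_of_tendsto' hlim' fun k =>
      P.le_modular_test_sub_ubar (g := g) hij hδ0.le hδ1 hq0 hg hflux (hu k)
    exact absurd (ENNReal.ofReal_pos.2 hκ0) (not_lt.2 hle)
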